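/- Let $G$ be a finite simple graph whose vertices carry labels $\phi_G(v),\chi_G(v),\psi_G(v)\in\mathbb{Q}$, and let $y\in\mathbb{Q}$. The labeled interlace polynomial is $$Q_\lambda(G)=\sum_{P}\Big(\prod_{v\in\phi(P)}\phi_G(v)\Big)\Big(\prod_{v\in\chi(P)}\chi_G(v)\Big)\Big(\prod_{v\in\psi(P)}\psi_G(v)\Big)\,y^{\nu(G_P)},$$ where $P$ ranges over the ordered partitions $V(G)=\phi(P)\sqcup\chi(P)\sqcup\psi(P)$ (parts may be empty), $G_P$ is obtained from $G$ by deleting the vertices of $\phi(P)$ and attaching a loop at every vertex of $\psi(P)$, and $\nu(G_P)$ is the nullity over $GF(2)$ of the adjacency matrix of $G_P$. For disjoint simple graphs $H,K$ and $S\subseteq V(H)$, $T\subseteq V(K)$, the join $(H,S)*(K,T)$ is $H\cup K$ together with all edges between $S$ and $T$; if $|V(H)|,|V(K)|\ge 2$, then $G=(H,S)*(K,T)$ is called a split of $G$. The split width $\mathrm{sw}(G)$ is defined recursively as the largest integer such that $\mathrm{sw}(G)\le|V(G)|$ and $\mathrm{sw}(G)\le\max\{|V(H)|,\ \mathrm{sw}((\{h\},\{h\})*(K,T))\}$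 for every split $G=(H,S)*(K,T)$, where $h$ is a new vertex. **Theorem.** Evaluating $Q_\lambda$ in $\mathbb{Q}$ on $\mathbb{Q}$-labeled simple graphs is fixed-parameter tractable with split width as the parameter. That is, there are an algorithm, a computable function $f:\mathbb{N}\to\mathbb{N}$ and a constant $c$ such that, for every $\mathbb{Q}$-labeled simple graph $G$ and every $y\in\mathbb{Q}$, the algorithm computes the rational number $Q_\lambda(G)$ from $(G,y)$ in at most $f(\mathrm{sw}(G))\cdot N^{c}$ steps, where $N$ is the size of the input (adjacency matrix, and rational numbers in binary) and steps are counted with bit cost. -/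

import Mathlib

universe u v

/-! ### Labeled simple graphs and the labeled interlace polynomial -/

/-- An `R`-labeled simple graph: a simple graph with three vertex labelings in `R`. -/
structure LabeledGraph (V : Type u) (R : Type v) where
  graph : SimpleGraph V
  phi : V → R
  chi : V → R
  psi : V → R

/-- The three classes of a labeled partition of a vertex set. -/
inductive PartClass : Type
  | phi
  | chi
  | psi
  deriving DecidableEq

instance : Fintype PartClass where
  elems := {PartClass.phi, PartClass.chi, PartClass.psi}
  complete := by intro c; cases c <;> simp

/-- A labeled partition `P` of `V`, i.e. an ordered partition of `V` into three pairwise disjoint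
(possibly empty) subsets `φ(P)`, `χ(P)`, `ψ(P)`; the function tells which subset holds a vertex. -/
abbrev LabeledPartition (V : Type u) : Type u := V → PartClass

open Classical in
/-- The adjacency matrix over `GF(2)` of the looped graph `G_P`, which is obtained from `G` by
removing every vertex of `φ(P)` and attaching a loop at every vertex of `ψ(P)`. -/
noncomputable def adjMatrixOf {V : Type u} (G : SimpleGraph V) (P : LabeledPartition V) :
    Matrix {v : V // P v ≠ PartClass.phi} {v : V // P v ≠ PartClass.phi} (ZMod 2) :=
  Matrix.of fun v w =>
    if G.Adj v.1 w.1 ∨ (v = w ∧ P v.1 = PartClass.psi) then 1 else 0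

/-- `ν(G_P)`: the number of vertices of `G_P` minus the `GF(2)`-rank of its adjacency matrix. -/
noncomputable def nullityOf {V : Type u} [Fintype V] (G : SimpleGraph V)
    (P : LabeledPartition V) : ℕ :=
  Fintype.card {v : V // P v ≠ PartClass.phi} - (adjMatrixOf G P).rank

/-- The labeled interlace polynomial `Q_λ(G)`, for a chosen element `y` of the label ring. -/
noncomputable def labeledInterlace {V : Type u} {R : Type v} [Fintype V] [DecidableEq V]
    [CommRing R] (G : LabeledGraph V R) (y : R) : R :=
  ∑ P : LabeledPartition V,
    (∏ v with P v = PartClass.phi, G.phi v) * (∏ v with P v = PartClass.chi, G.chi v) *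
      (∏ v with P v = PartClass.psi, G.psi v) * y ^ nullityOf G.graph P

/-! ### Joins, splits and split width -/

/-- The join `(H, S) * (K, T)`: the disjoint union of `H` and `K` together with all edges between
`S` and `T`. -/
def joinGraph {α : Type u} {β : Type v} (H : SimpleGraph α) (S : Set α) (K : SimpleGraph β)
    (T : Set β) : SimpleGraph (α ⊕ β) where
  Adj
    | Sum.inl a, Sum.inl b => H.Adj a b
    | Sum.inl a, Sum.inr b => a ∈ S ∧ b ∈ T
    | Sum.inr a, Sum.inl b => b ∈ S ∧ a ∈ T
    | Sum.inr a, Sum.inr b => K.Adj a b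
  symm := ⟨by
    rintro (a | a) (b | b) h
    · exact SimpleGraph.Adj.symm (G := H) h
    · exact h
    · exact h
    · exact SimpleGraph.Adj.symm (G := K) h⟩
  loopless := ⟨by
    rintro (a | a) h
    · exact H.loopless.irrefl a h
    · exact K.loopless.irrefl a h⟩

/-- `G` has the split `G = (H, S) * (K, T)`, where `V(H) = A` and `V(K) = Aᶜ` have at least two
elements each (`H` and `K` are then the induced subgraphs `G[A]` and `G[Aᶜ]`). -/
def IsSplit {V : Type u} (G : SimpleGraph V) (A : Set V) (S : Set A)
    (T : Set (Aᶜ : Set V)) : Prop :=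
  2 ≤ A.ncard ∧ 2 ≤ (Aᶜ).ncard ∧
    G.comap (Sum.elim Subtype.val Subtype.val) = joinGraph (G.induce A) S (G.induce Aᶜ) T

/-- The split reduction `({h}, {h}) * (K, T)` of `G = (H, S) * (K, T)` with respect to `H`, where
`V(H) = A`: the graph `K = G[Aᶜ]` with one new vertex `h` adjoined, such that `N(h) = T`. -/
def splitReduction {V : Type u} (G : SimpleGraph V) (A : Set V)
    (T : Set (Aᶜ : Set V)) : SimpleGraph (Unit ⊕ (Aᶜ : Set V)) :=
  joinGraph (⊥ : SimpleGraph Unit) Set.univ (G.induce Aᶜ) T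

theorem card_splitReduction_lt {V : Type u} [Finite V] {A : Set V} (hA : 2 ≤ A.ncard) :
    Nat.card (Unit ⊕ (Aᶜ : Set V)) < Nat.card V := by
  have h := Set.ncard_add_ncard_compl A
  rw [Nat.card_sum, Nat.card_unique, Nat.card_coe_set_eq]
  omega

/-- The split width `sw(G)`: the largest integer with `sw(G) ≤ |V(G)|` and, for every split
`G = (H, S) * (K, T)`, `sw(G) ≤ max {|V(H)|, sw(({h}, {h}) * (K, T))}`. The recursion is on the
number of vertices. -/
noncomputable def splitWidth {V : Type u} [Finite V] (G : SimpleGraph V) : ℕ :=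
  sSup {k : ℕ | k ≤ Nat.card V ∧
    ∀ (A : Set V) (S : Set A) (T : Set (Aᶜ : Set V)), IsSplit G A S T →
      k ≤ max A.ncard (splitWidth (splitReduction G A T))}
termination_by Nat.card V
decreasing_by
  rename_i hs
  exact card_splitReduction_lt hs.1

theorem isGreatest_splitWidth {V : Type u} [Finite V] (G : SimpleGraph V) :
    IsGreatest {k : ℕ | k ≤ Nat.card V ∧
      ∀ (A : Set V) (S : Set A) (T : Set (Aᶜ : Set V)), IsSplit G A S T →
        k ≤ max A.ncard (splitWidth (splitReduction G A T))} (splitWidth G) := by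
  have hb : BddAbove {k : ℕ | k ≤ Nat.card V ∧
      ∀ (A : Set V) (S : Set A) (T : Set (Aᶜ : Set V)), IsSplit G A S T →
        k ≤ max A.ncard (splitWidth (splitReduction G A T))} := ⟨Nat.card V, fun k hk => hk.1⟩
  rw [splitWidth]
  exact ⟨Nat.sSup_mem ⟨0, Nat.zero_le _, fun _ _ _ _ => Nat.zero_le _⟩ hb,
    fun k hk => le_csSup hb hk⟩

/-! ### The model of computation

Programs compute on binary trees ("S-expressions"), as in pure Lisp or the textbook language
WHILE: they can build a pair, take the components of a pair, test for the empty tree, and loop.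
The only primitive test is for the empty tree, and there is no primitive arithmetic.

The cost is a bit cost: every operation is charged the full size of the tree to which it is
applied, as if that tree were read and copied symbol by symbol. Hence the running time also bounds
the size of every tree that is produced, and this cost is polynomially related to the
number of steps of a Turing machine that works on the parenthesized words of the trees. -/

/-- The data: finite binary trees without node labels. -/
abbrev Data : Type := BinaryTree Unit

namespace Data

/-- The pair of two trees. -/
def pair (a b : Data) : Data := BinaryTree.node () a b

/-- First component (the empty tree has an empty first component). -/
def fst : Data → Data
  | BinaryTree.nil => BinaryTree.nil
  | BinaryTree.node _ a _ => a

/-- Second component (the empty tree has an empty second component). -/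
def snd : Data → Data
  | BinaryTree.nil => BinaryTree.nil
  | BinaryTree.node _ _ b => b

/-- Size of a tree: its number of leaves, so that the tree is a word of `2 * size - 1` symbols. -/
def size (a : Data) : ℕ := a.numLeaves

/-! Encodings: numbers are written in binary, least significant bit first; a rational number is
given by its sign, numerator and denominator in lowest terms. -/

def ofBool : Bool → Data
  | false => BinaryTree.nil
  | true => pair BinaryTree.nil BinaryTree.nil

def ofList : List Data → Data
  | [] => BinaryTree.nil
  | a :: l => pair a (ofList l)

def ofNat (n : ℕ) : Data := ofList (n.bits.map ofBool)

def ofRat (q : ℚ) : Data :=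
  pair (ofBool (decide (q < 0))) (pair (ofNat q.num.natAbs) (ofNat q.den))

end Data

/-- Programs. -/
inductive Prog : Type
  | empty : Prog
  | ident : Prog
  | fst : Prog
  | snd : Prog
  | pair (p q : Prog) : Prog
  | seq (p q : Prog) : Prog
  | cond (c p q : Prog) : Prog
  | loop (c p : Prog) : Prog

/-- `Prog.Runs p a b t`: on input `a` the program `p` halts with output `b` at cost `t`.
`seq p q` applies first `p`, then `q`; `cond c p q` applies `p` if the result of `c` is nonempty
and `q` otherwise; `loop c p` applies `p` as long as the result of `c` is nonempty. -/
inductive Prog.Runs : Prog → Data → Data → ℕ → Prop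
  | empty (a : Data) : Runs Prog.empty a BinaryTree.nil a.size
  | ident (a : Data) : Runs Prog.ident a a a.size
  | fst (a : Data) : Runs Prog.fst a a.fst a.size
  | snd (a : Data) : Runs Prog.snd a a.snd a.size
  | pair {p q : Prog} {a b c : Data} {s t : ℕ} :
      Runs p a b s → Runs q a c t → Runs (Prog.pair p q) a (Data.pair b c) (a.size + s + t)
  | seq {p q : Prog} {a b c : Data} {s t : ℕ} :
      Runs p a b s → Runs q b c t → Runs (Prog.seq p q) a c (a.size + s + t)
  | cond_then {c p q : Prog} {a b d : Data} {s t : ℕ} :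
      Runs c a b s → b ≠ BinaryTree.nil → Runs p a d t →
        Runs (Prog.cond c p q) a d (a.size + s + t)
  | cond_else {c p q : Prog} {a d : Data} {s t : ℕ} :
      Runs c a BinaryTree.nil s → Runs q a d t → Runs (Prog.cond c p q) a d (a.size + s + t)
  | loop_stop {c p : Prog} {a : Data} {s : ℕ} :
      Runs c a BinaryTree.nil s → Runs (Prog.loop c p) a a (a.size + s)
  | loop_step {c p : Prog} {a b d e : Data} {s t r : ℕ} :
      Runs c a b s → b ≠ BinaryTree.nil → Runs p a d t → Runs (Prog.loop c p) d e r →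
        Runs (Prog.loop c p) a e (a.size + s + t + r)

/-- Programs are deterministic: output and cost are determined by the input. -/
theorem Prog.Runs.det {p : Prog} {a b b' : Data} {t t' : ℕ} (h : Prog.Runs p a b t)
    (h' : Prog.Runs p a b' t') : b = b' ∧ t = t' := by
  induction h generalizing b' t' with
  | empty a => cases h'; exact ⟨rfl, rfl⟩
  | ident a => cases h'; exact ⟨rfl, rfl⟩
  | fst a => cases h'; exact ⟨rfl, rfl⟩
  | snd a => cases h'; exact ⟨rfl, rfl⟩
  | pair _ _ ih1 ih2 =>
    cases h' with
    | pair k1 k2 => obtain ⟨rfl, rfl⟩ := ih1 k1; obtain ⟨rfl, rfl⟩ := ih2 k2; exact ⟨rfl, rfl⟩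
  | seq _ _ ih1 ih2 =>
    cases h' with
    | seq k1 k2 => obtain ⟨rfl, rfl⟩ := ih1 k1; obtain ⟨rfl, rfl⟩ := ih2 k2; exact ⟨rfl, rfl⟩
  | cond_then _ hb _ ih1 ih2 =>
    cases h' with
    | cond_then k1 _ k2 =>
      obtain ⟨rfl, rfl⟩ := ih1 k1; obtain ⟨rfl, rfl⟩ := ih2 k2; exact ⟨rfl, rfl⟩
    | cond_else k1 _ => exact absurd (ih1 k1).1 hb
  | cond_else _ _ ih1 ih2 =>
    cases h' with
    | cond_then k1 hb _ => exact absurd (ih1 k1).1.symm hb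
    | cond_else k1 k2 =>
      obtain ⟨_, rfl⟩ := ih1 k1; obtain ⟨rfl, rfl⟩ := ih2 k2; exact ⟨rfl, rfl⟩
  | loop_stop _ ih1 =>
    cases h' with
    | loop_stop k1 => obtain ⟨_, rfl⟩ := ih1 k1; exact ⟨rfl, rfl⟩
    | loop_step k1 hb _ _ => exact absurd (ih1 k1).1.symm hb
  | loop_step _ hb _ _ ih1 ih2 ih3 =>
    cases h' with
    | loop_stop k1 => exact absurd (ih1 k1).1 hb
    | loop_step k1 _ k2 k3 =>
      obtain ⟨_, rfl⟩ := ih1 k1; obtain ⟨rfl, rfl⟩ := ih2 k2; obtain ⟨rfl, rfl⟩ := ih3 k3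
      exact ⟨rfl, rfl⟩

/-! ### Fixed-parameter tractability -/

/-- The problem of computing `output x` from `input x` is fixed-parameter tractable with parameter
`param x`: one program solves all instances, in time at most `f (param x) * |input x| ^ c` for a
computable function `f` and a constant `c`. The program is not told the parameter. -/
def FixedParameterTractable {ι : Type u} (input : ι → Data) (param : ι → ℕ)
    (output : ι → Data) : Prop :=
  ∃ (p : Prog) (f : ℕ → ℕ) (c : ℕ), Computable f ∧
    ∀ x : ι, ∃ t : ℕ, t ≤ f (param x) * (input x).size ^ c ∧ p.Runs (input x) (output x) t

/-- An instance of the evaluation problem: a `ℚ`-labeled simple graph, with vertex set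
`{0, …, n - 1}`, and a rational number `y`. -/
structure EvalInstance where
  n : ℕ
  G : LabeledGraph (Fin n) ℚ
  y : ℚ

namespace EvalInstance

open Classical in
/-- The input word: `y`, followed by the list of the vertices, each given by its three labels
and its row of the adjacency matrix. -/
noncomputable def input (x : EvalInstance) : Data :=
  Data.pair (Data.ofRat x.y) (Data.ofList (List.ofFn fun v : Fin x.n =>
    Data.ofList [Data.ofRat (x.G.phi v), Data.ofRat (x.G.chi v), Data.ofRat (x.G.psi v),
      Data.ofList (List.ofFn fun w : Fin x.n => Data.ofBool (decide (x.G.graph.Adj v w)))]))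

end EvalInstance

/-! Let `A` and `B` be the two sides of a cut of rank at most one: `u ∈ A` and `w ∈ B` are adjacent
iff `s u` and `t w` hold. Fix a labeled partition and let `M_A`, `M_B` be the looped adjacency
matrices of the sides. A kernel vector of the whole is a pair `(x, z)` with `M_A x = e s` and `M_B z
= b t`, where `e = t ⬝ z` and `b = s ⬝ x`. So the kernel depends on `A` only through the four
numbers of solutions of `M_A x = e s` with `s ⬝ x = b` (`kerCount_append`). Because `M_A` is
symmetric, this table has only three possible shapes (`solCount_trichotomy`). If `M_A x = s` is
solvable, then `s` is orthogonal to the kernel, `s ⬝ x` has the same value for all solutions, and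
this value separates two shapes; if it is not solvable, half of the kernel is orthogonal to `s`. Up
to a power of two these are the tables of one vertex that is deleted, looped, or kept without a loop
(`solCount_singleton`).

Hence `A` can be replaced by a single vertex `h`. Each of its three labels is the sum of the weights
of those partitions of `A` that have the corresponding shape, with the power of `y` that accounts
for the lost nullity (`val_contribution`, `listPoly_collapse`). Brute force over partitions and
vectors finds these labels in time exponential in `|A|` only.

The algorithm repeatedly collapses the smallest side of a split, or everything if there is no split.
A vertex `a ∈ A` lends its number and its row to `h`, so every intermediate graph is an induced
subgraph of the input graph `G`, with new labels. Splits are found by closure: once `a ∈ A` and `b ∉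
A` are chosen, with `a`, `b` adjacent if any edge crosses the cut, the functions `s` and `t` are
determined, and a vertex that violates them must join `A`.

The collapsed sets are small for the following reason. If `A` is a smallest side and `b` is a vertex
outside, then `A ∪ {b}` admits no split, as a split inside it would extend to a split of the whole
graph with a smaller side. A set of at least four vertices without a split has at most `sw(G) + 1`
elements: in every split reduction it either survives, with one vertex replaced by the new one, or
lies in the reduced side up to one vertex (`SplitFree.card_le`). Together this gives
`length_bestCollapse_le_splitWidth`. The width is never computed; it enters only the time bound.

It remains to compute with numbers of polynomial length. Labels are kept as integers over one common
denominator, every collapse multiplying the polynomial by a power of the denominator of `y`, and a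
multiplicative norm bounds their growth (`stateWeight_collapseStep_le`). All programs are composed
from `CompIn`, polynomial time in the input plus a parameter; the parameter is finally `3 ^ (sw(G) +
3)`. -/

/-! ### Polynomial bounds -/

/-- `T` is bounded by a polynomial in `X`. -/
def PolyBd {ι : Type*} (X T : ι → ℕ) : Prop := ∃ c, ∀ i, T i ≤ (X i + 2) ^ c

namespace PolyBd

variable {ι κ : Type*} {X Y S T : ι → ℕ}

theorem mono (h : PolyBd X T) (hST : ∀ i, S i ≤ T i) : PolyBd X S :=
  let ⟨c, hc⟩ := h
  ⟨c, fun i => (hST i).trans (hc i)⟩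

theorem self : PolyBd X X := ⟨1, fun i => by simp⟩

theorem of_le (h : ∀ i, T i ≤ X i) : PolyBd X T := self.mono h

/-- The base `X i + 2` is at least two, so its powers absorb every constant; the same fact absorbs
the factor two in a sum. -/
theorem const (k : ℕ) : PolyBd X fun _ => k :=
  ⟨k, fun i => k.lt_two_pow_self.le.trans (Nat.pow_le_pow_left (by omega) k)⟩

theorem mul (hS : PolyBd X S) (hT : PolyBd X T) : PolyBd X fun i => S i * T i := by
  obtain ⟨a, ha⟩ := hS
  obtain ⟨b, hb⟩ := hT
  exact ⟨a + b, fun i => by rw [pow_add]; exact Nat.mul_le_mul (ha i) (hb i)⟩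

theorem add (hS : PolyBd X S) (hT : PolyBd X T) : PolyBd X fun i => S i + T i := by
  obtain ⟨a, ha⟩ := hS
  obtain ⟨b, hb⟩ := hT
  refine ⟨a + b + 1, fun i => ?_⟩
  have h1 : (X i + 2) ^ a ≤ (X i + 2) ^ (a + b) := Nat.pow_le_pow_right (by omega) (by omega)
  have h2 : (X i + 2) ^ b ≤ (X i + 2) ^ (a + b) := Nat.pow_le_pow_right (by omega) (by omega)
  calc S i + T i ≤ (X i + 2) ^ (a + b) * 2 := by linarith [ha i, hb i]
    _ ≤ (X i + 2) ^ (a + b + 1) := by rw [pow_succ]; gcongr; omega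

theorem pow (hT : PolyBd X T) (k : ℕ) : PolyBd X fun i => T i ^ k := by
  obtain ⟨a, ha⟩ := hT
  exact ⟨a * k, fun i => by rw [pow_mul]; exact Nat.pow_le_pow_left (ha i) k⟩

theorem trans (hT : PolyBd X T) (hX : PolyBd Y X) : PolyBd Y T := by
  obtain ⟨c, hc⟩ := hT
  exact ((hX.add (const 2)).pow c).mono hc

theorem comp (h : PolyBd X T) (g : κ → ι) : PolyBd (fun k => X (g k)) fun k => T (g k) :=
  let ⟨c, hc⟩ := h
  ⟨c, fun k => hc (g k)⟩

end PolyBd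

/-! ### Families of runs in polynomial time -/

namespace Data

@[simp] theorem size_nil : size BinaryTree.nil = 1 := rfl

@[simp] theorem size_pair (a b : Data) : (pair a b).size = a.size + b.size := rfl

theorem pair_ne_nil (a b : Data) : pair a b ≠ BinaryTree.nil := fun h => nomatch h

theorem one_le_size (a : Data) : 1 ≤ a.size := by
  induction a with
  | nil => exact le_rfl
  | node _ a b ha _ => exact ha.trans (Nat.le_add_right _ _)

theorem size_fst_le (a : Data) : a.fst.size ≤ a.size := by
  cases a with
  | nil => exact le_rfl
  | node _ a b => exact Nat.le_add_right _ _

theorem size_snd_le (a : Data) : a.snd.size ≤ a.size := by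
  cases a with
  | nil => exact le_rfl
  | node _ a b => exact Nat.le_add_left _ _

end Data

/-- Every operation is charged for the tree it reads, so a time bound is also a space bound, and
compositions need no separate size estimate. -/
theorem Prog.Runs.size_le {p : Prog} {a b : Data} {t : ℕ} (h : p.Runs a b t) : b.size ≤ t := by
  induction h with
  | empty a => exact a.one_le_size
  | ident a => exact le_rfl
  | fst a => exact a.size_fst_le
  | snd a => exact a.size_snd_le
  | pair _ _ h1 h2 => rw [Data.size_pair]; omega
  | seq _ _ h1 h2 => omega
  | cond_then _ _ _ h1 h2 => omega
  | cond_else _ _ h1 h2 => omega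
  | loop_stop _ h => omega
  | loop_step _ _ _ _ _ h => omega

theorem Prog.Runs.size_input_le {p : Prog} {a b : Data} {t : ℕ} (h : p.Runs a b t) :
    a.size ≤ t := by
  cases h <;> omega

/-- One program maps `x i` to `y i` for every `i`, in time polynomial in `X i`. -/
def PolyRuns {ι : Type*} (X : ι → ℕ) (x y : ι → Data) : Prop :=
  ∃ (p : Prog) (T : ι → ℕ), PolyBd X T ∧ ∀ i, ∃ t ≤ T i, p.Runs (x i) (y i) t

namespace PolyRuns

variable {ι κ : Type*} {X Y : ι → ℕ} {x y z : ι → Data}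

theorem size_input (h : PolyRuns X x y) : PolyBd X fun i => (x i).size :=
  let ⟨_, _, hT, h⟩ := h
  hT.mono fun i => let ⟨_, ht, hr⟩ := h i; hr.size_input_le.trans ht

theorem size_output (h : PolyRuns X x y) : PolyBd X fun i => (y i).size :=
  let ⟨_, _, hT, h⟩ := h
  hT.mono fun i => let ⟨_, ht, hr⟩ := h i; hr.size_le.trans ht

theorem mono (h : PolyRuns X x y) (hX : PolyBd Y X) : PolyRuns Y x y :=
  let ⟨p, T, hT, h⟩ := h
  ⟨p, T, hT.trans hX, h⟩

theorem reindex (h : PolyRuns X x y) (g : κ → ι) :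
    PolyRuns (fun k => X (g k)) (fun k => x (g k)) fun k => y (g k) :=
  let ⟨p, _, hT, h⟩ := h
  ⟨p, _, hT.comp g, fun k => h (g k)⟩

theorem id (h : PolyBd X fun i => (x i).size) : PolyRuns X x x :=
  ⟨Prog.ident, _, h, fun _ => ⟨_, le_rfl, Prog.Runs.ident _⟩⟩

theorem comp (h : PolyRuns X x y) (h' : PolyRuns X y z) : PolyRuns X x z := by
  have hx := h.size_input
  obtain ⟨p, T, hT, hp⟩ := h
  obtain ⟨q, S, hS, hq⟩ := h'
  refine ⟨Prog.seq p q, _, (hx.add hT).add hS, fun i => ?_⟩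
  obtain ⟨t, ht, hr⟩ := hp i
  obtain ⟨s, hs, hr'⟩ := hq i
  exact ⟨_, by omega, hr.seq hr'⟩

theorem fst (h : PolyRuns X x y) : PolyRuns X x fun i => (y i).fst :=
  h.comp ⟨Prog.fst, _, h.size_output, fun _ => ⟨_, le_rfl, Prog.Runs.fst _⟩⟩

theorem snd (h : PolyRuns X x y) : PolyRuns X x fun i => (y i).snd :=
  h.comp ⟨Prog.snd, _, h.size_output, fun _ => ⟨_, le_rfl, Prog.Runs.snd _⟩⟩

theorem pair (h : PolyRuns X x y) (h' : PolyRuns X x z) :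
    PolyRuns X x fun i => Data.pair (y i) (z i) := by
  have hx := h.size_input
  obtain ⟨p, T, hT, hp⟩ := h
  obtain ⟨q, S, hS, hq⟩ := h'
  refine ⟨Prog.pair p q, _, (hx.add hT).add hS, fun i => ?_⟩
  obtain ⟨t, ht, hr⟩ := hp i
  obtain ⟨s, hs, hr'⟩ := hq i
  exact ⟨_, by omega, hr.pair hr'⟩

theorem const (d : Data) (h : PolyBd X fun i => (x i).size) : PolyRuns X x fun _ => d := by
  induction d with
  | nil => exact ⟨Prog.empty, _, h, fun _ => ⟨_, le_rfl, Prog.Runs.empty _⟩⟩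
  | node _ a b ha hb => exact ha.pair hb

theorem cond {b : ι → Data} (hb : PolyRuns X x b)
    (hy : PolyRuns (fun i : {i // b i ≠ BinaryTree.nil} => X i) (fun i => x i) fun i => y i)
    (hz : PolyRuns (fun i : {i // b i = BinaryTree.nil} => X i) (fun i => x i) fun i => y i) :
    PolyRuns X x y := by
  have hx := hb.size_input
  obtain ⟨p, T, hT, hp⟩ := hb
  obtain ⟨q, S, ⟨c, hS⟩, hq⟩ := hy
  obtain ⟨r, R, ⟨d, hR⟩, hr⟩ := hz
  -- The branch bounds exist only on the instances that take the branch; powers of `X i + 2` extend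
  -- them to all instances.
  have hpow : ∀ c, PolyBd X fun i => (X i + 2) ^ c := fun c => ⟨c, fun _ => le_rfl⟩
  refine ⟨Prog.cond p q r, _, ((hx.add hT).add (hpow c)).add (hpow d), fun i => ?_⟩
  obtain ⟨t, ht, h1⟩ := hp i
  by_cases hi : b i = BinaryTree.nil
  · obtain ⟨s, hs, h2⟩ := hr ⟨i, hi⟩
    have := hR ⟨i, hi⟩
    exact ⟨_, by simp only at this hs ⊢; omega, Prog.Runs.cond_else (hi ▸ h1) h2⟩
  · obtain ⟨s, hs, h2⟩ := hq ⟨i, hi⟩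
    have := hS ⟨i, hi⟩
    exact ⟨_, by simp only at this hs ⊢; omega, Prog.Runs.cond_then h1 hi h2⟩

end PolyRuns

/-- One round pays for the size of the state, the test and the body. The first of these is at most
the cost of the test, whence `3 * K`; the last test accounts for `n + 1`. -/
theorem Prog.Runs.iterate {c p : Prog} {K : ℕ} (n : ℕ) (st : ℕ → Data)
    (hc : ∀ j < n, ∃ b t, t ≤ K ∧ b ≠ BinaryTree.nil ∧ c.Runs (st j) b t)
    (hp : ∀ j < n, ∃ t ≤ K, p.Runs (st j) (st (j + 1)) t)
    (hn : ∃ t ≤ K, c.Runs (st n) BinaryTree.nil t) :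
    ∃ t ≤ (n + 1) * (3 * K), (Prog.loop c p).Runs (st 0) (st n) t := by
  induction n generalizing st with
  | zero =>
    obtain ⟨t, ht, hr⟩ := hn
    have := hr.size_input_le
    exact ⟨_, by omega, hr.loop_stop⟩
  | succ n ih =>
    obtain ⟨r, hr, hr'⟩ := ih (fun j => st (j + 1)) (fun j hj => hc _ (by omega))
      (fun j hj => hp _ (by omega)) hn
    obtain ⟨b, s, hs, hb, h1⟩ := hc 0 (by omega)
    obtain ⟨t, ht, h2⟩ := hp 0 (by omega)
    have := h1.size_input_le
    refine ⟨_, ?_, Prog.Runs.loop_step h1 hb h2 hr'⟩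
    calc _ ≤ (n + 1) * (3 * K) + 3 * K := by omega
      _ = _ := by ring

/-! ### Encoded types and functions computable in polynomial time -/

/-- Types whose elements are encoded as trees. -/
class Enc (α : Type) where
  enc : α → Data

open Enc (enc)

section Instances

variable {α β : Type} [Enc α] [Enc β]

instance : Enc Bool := ⟨Data.ofBool⟩
instance : Enc Unit := ⟨fun _ => BinaryTree.nil⟩
instance : Enc ℕ := ⟨Data.ofNat⟩
instance : Enc ℚ := ⟨Data.ofRat⟩
instance : Enc (α × β) := ⟨fun x => Data.pair (enc x.1) (enc x.2)⟩
instance : Enc (List α) := ⟨fun l => Data.ofList (l.map enc)⟩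

end Instances

/-- The size of the encoding. -/
def esize {α : Type} [Enc α] (a : α) : ℕ := (enc a).size

/-- `f` is computed by one program in time polynomial in the size of the argument plus `M`. -/
@[fun_prop]
def CompIn {δ β : Type} [Enc δ] [Enc β] (f : δ → β) (M : δ → ℕ) : Prop :=
  PolyRuns (fun d => esize d + M d) enc fun d => enc (f d)

section

variable {α β γ δ : Type} [Enc α] [Enc β] [Enc γ] [Enc δ] {M : δ → ℕ}

@[simp] theorem esize_mk (a : α) (b : β) : esize (a, b) = esize a + esize b := rfl

theorem esize_prod (a : α × β) : esize a = esize a.1 + esize a.2 := rfl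

@[simp] theorem esize_nil : esize ([] : List α) = 1 := rfl

@[simp] theorem esize_cons (a : α) (l : List α) : esize (a :: l) = esize a + esize l := rfl

theorem one_le_esize (a : α) : 1 ≤ esize a := Data.one_le_size _

theorem esize_bool (b : Bool) : esize b ≤ 2 := by cases b <;> decide

theorem esize_append (l l' : List α) : esize (l ++ l') + 1 = esize l + esize l' := by
  induction l with
  | nil => simp; omega
  | cons a l ih => simp; omega

theorem esize_eq_sum (l : List α) : esize l = (l.map esize).sum + 1 := by
  induction l with
  | nil => rfl
  | cons a l ih => simp [ih, add_assoc]

theorem length_lt_esize (l : List α) : l.length < esize l := by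
  induction l with
  | nil => exact Nat.zero_lt_one
  | cons a l ih => have := one_le_esize a; simp; omega

theorem esize_le_of_mem {a : α} {l : List α} (h : a ∈ l) : esize a ≤ esize l := by
  rw [esize_eq_sum]
  exact (List.single_le_sum (by simp) _ (List.mem_map_of_mem h)).trans (Nat.le_succ _)

theorem esize_sublist {l l' : List α} (h : l.Sublist l') : esize l ≤ esize l' := by
  simp only [esize_eq_sum]
  exact Nat.succ_le_succ ((h.map esize).sum_le_sum (by simp))

namespace CompIn

theorem size_output {f : δ → β} (h : CompIn f M) :
    PolyBd (fun d => esize d + M d) fun d => esize (f d) :=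
  PolyRuns.size_output h

theorem polyBd_esize : PolyBd (fun d => esize d + M d) fun d => esize d :=
  PolyBd.of_le fun _ => Nat.le_add_right _ _

@[fun_prop]
theorem id : CompIn (fun d : δ => d) M := PolyRuns.id polyBd_esize

@[fun_prop]
theorem const (b : β) : CompIn (fun _ : δ => b) M := PolyRuns.const _ polyBd_esize

/-- The parameter of `g` has to be controlled only at the values of `f`. This is how exponential
parameters are passed on to the caller. -/
theorem comp_of_le {N : β → ℕ} {g : β → γ} {f : δ → β} (hg : CompIn g N) (hf : CompIn f M)
    (hN : PolyBd (fun d => esize d + M d) fun d => N (f d)) : CompIn (fun d => g (f d)) M :=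
  PolyRuns.comp hf ((PolyRuns.reindex hg f).mono (hf.size_output.add hN))

theorem comp {g : β → γ} {f : δ → β} (hg : CompIn g fun _ => 0) (hf : CompIn f M) :
    CompIn (fun d => g (f d)) M :=
  hg.comp_of_le hf (PolyBd.const 0)

theorem mono {N : δ → ℕ} {f : δ → β} (h : CompIn f N) (hN : PolyBd (fun d => esize d + M d) N) :
    CompIn f M :=
  h.comp_of_le id hN

/-- Programs see only codes, so a function may be replaced by one with values in another type if the
codes agree, for instance a rational number by its sign, numerator and denominator. -/
theorem of_enc_eq {f : δ → β} {g : δ → γ} (h : CompIn f M) (he : ∀ d, enc (f d) = enc (g d)) :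
    CompIn g M := by
  have : (fun d => enc (f d)) = fun d => enc (g d) := funext he
  unfold CompIn at h ⊢
  rwa [this] at h

@[fun_prop]
theorem fst {f : δ → α × β} (h : CompIn f M) : CompIn (fun d => (f d).1) M := PolyRuns.fst h

@[fun_prop]
theorem snd {f : δ → α × β} (h : CompIn f M) : CompIn (fun d => (f d).2) M := PolyRuns.snd h

@[fun_prop]
theorem prodMk {f : δ → α} {g : δ → β} (hf : CompIn f M) (hg : CompIn g M) :
    CompIn (fun d => (f d, g d)) M :=
  PolyRuns.pair hf hg

@[fun_prop]
theorem cons {f : δ → α} {g : δ → List α} (hf : CompIn f M) (hg : CompIn g M) :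
    CompIn (fun d => f d :: g d) M :=
  PolyRuns.pair hf hg

@[fun_prop]
theorem tail {f : δ → List α} (hf : CompIn f M) : CompIn (fun d => (f d).tail) M :=
  CompIn.of_enc_eq (f := fun d => (f d).tail) (by
    have h := PolyRuns.snd hf
    have e : (fun d => (enc (f d)).snd) = fun d => enc (f d).tail :=
      funext fun d => by cases f d <;> rfl
    unfold CompIn
    rwa [← e]) fun _ => rfl

@[fun_prop]
theorem ite {b : δ → Bool} {f g : δ → β} (hb : CompIn b M) (hf : CompIn f M) (hg : CompIn g M) :
    CompIn (fun d => if b d = true then f d else g d) M := by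
  refine PolyRuns.cond hb ?_ ?_
  · have h := PolyRuns.reindex hf (Subtype.val : {d // enc (b d) ≠ BinaryTree.nil} → δ)
    have e : ∀ d : {d // enc (b d) ≠ BinaryTree.nil}, b d = true := fun d => by
      by_contra hd
      exact d.2 (by rw [Bool.not_eq_true] at hd; rw [hd]; rfl)
    simpa only [e, if_true] using h
  · have h := PolyRuns.reindex hg (Subtype.val : {d // enc (b d) = BinaryTree.nil} → δ)
    have e : ∀ d : {d // enc (b d) = BinaryTree.nil}, b d = false := fun d => by
      by_contra hd
      have := d.2
      rw [Bool.not_eq_false] at hd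
      rw [hd] at this
      exact Data.pair_ne_nil _ _ this
    simpa only [e, Bool.false_eq_true, if_false] using h

@[fun_prop]
theorem isEmpty {l : δ → List α} (hl : CompIn l M) : CompIn (fun d => (l d).isEmpty) M := by
  refine PolyRuns.cond hl ?_ ?_
  · have e : ∀ d : {d // enc (l d) ≠ BinaryTree.nil}, (l d).isEmpty = false := fun d => by
      cases h : l d with
      | nil => exact absurd (by rw [h]; rfl) d.2
      | cons a l => rfl
    simp only [e]
    exact PolyRuns.const _ (polyBd_esize.comp _)
  · have e : ∀ d : {d // enc (l d) = BinaryTree.nil}, (l d).isEmpty = true := fun d => by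
      have := d.2
      cases h : l d with
      | nil => rfl
      | cons a l => rw [h] at this; exact absurd this (Data.pair_ne_nil _ _)
    simp only [e]
    exact PolyRuns.const _ (polyBd_esize.comp _)

@[fun_prop]
theorem headD {l : δ → List α} {a : δ → α} (hl : CompIn l M) (ha : CompIn a M) :
    CompIn (fun d => (l d).headD (a d)) M := by
  refine PolyRuns.cond hl ?_ ?_
  · have e : ∀ d : {d // enc (l d) ≠ BinaryTree.nil},
        enc ((l d).headD (a d)) = (enc (l d)).fst := fun d => by
      cases h : l d with
      | nil => exact absurd (by rw [h]; rfl) d.2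
      | cons a l => rfl
    simp only [e]
    exact (PolyRuns.reindex hl _).fst
  · have e : ∀ d : {d // enc (l d) = BinaryTree.nil}, (l d).headD (a d) = a d := fun d => by
      have := d.2
      cases h : l d with
      | nil => rfl
      | cons a l => rw [h] at this; exact absurd this (Data.pair_ne_nil _ _)
    simp only [e]
    exact PolyRuns.reindex ha _

/-- The loop carries the triple of argument, accumulator and remaining list. Polynomially many
polynomial steps may still produce exponentially large data, so the size of every intermediate
accumulator, and the parameter of every step actually taken, must be bounded in advance. -/
theorem foldl {l : δ → List α} {b : δ → β} {s : δ → β → α → β} {N : δ × β × α → ℕ}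
    (hl : CompIn l M) (hb : CompIn b M) (hs : CompIn (fun q : δ × β × α => s q.1 q.2.1 q.2.2) N)
    {R : δ → ℕ} (hR : PolyBd (fun d => esize d + M d) R)
    (hacc : ∀ d l', l' <+: l d → esize (l'.foldl (s d) (b d)) ≤ R d)
    (hN : ∀ d l' a, l' ++ [a] <+: l d → N (d, l'.foldl (s d) (b d), a) ≤ R d) :
    CompIn (fun d => (l d).foldl (s d) (b d)) M := by
  let ι := δ × β × α × List α
  let X : ι → ℕ := fun q => esize (q.1, q.2.1, q.2.2.1 :: q.2.2.2) + N (q.1, q.2.1, q.2.2.1)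
  let x : ι → Data := fun q => enc (q.1, q.2.1, q.2.2.1 :: q.2.2.2)
  have hx : PolyBd X fun q => (x q).size := PolyBd.of_le fun _ => Nat.le_add_right _ _
  have hx0 : PolyRuns X x x := PolyRuns.id hx
  have htriple : PolyRuns X x fun q => enc (q.1, q.2.1, q.2.2.1) :=
    hx0.fst.pair (hx0.snd.fst.pair hx0.snd.snd.fst)
  have hstep : PolyRuns X x fun q => enc (s q.1 q.2.1 q.2.2.1) := by
    refine htriple.comp ((PolyRuns.reindex hs fun q : ι => (q.1, q.2.1, q.2.2.1)).mono ?_)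
    exact PolyBd.of_le fun q => by simp only [X, esize_mk, esize_cons]; omega
  have hbody : PolyRuns X x fun q => enc (q.1, s q.1 q.2.1 q.2.2.1, q.2.2.2) :=
    hx0.fst.pair (hstep.pair hx0.snd.snd.snd)
  obtain ⟨p, T, ⟨c, hT⟩, hp⟩ := hbody
  let test : Prog := Prog.seq Prog.snd Prog.snd
  -- The first summand pays for the test, which reads at most three trees of the size of the state;
  -- the second is the polynomial bound of the body.
  let K : δ → ℕ := fun d => 3 * (esize d + R d + esize (l d)) +
    (esize d + R d + esize (l d) + R d + 2) ^ c
  have hK : PolyBd (fun d => esize d + M d) K := by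
    have h1 := (polyBd_esize.add hR).add hl.size_output
    exact ((PolyBd.const 3).mul h1).add (((h1.add hR).add (PolyBd.const 2)).pow c)
  have hinit : PolyRuns (fun d => esize d + M d) enc fun d => enc (d, b d, l d) :=
    (PolyRuns.id polyBd_esize).pair (PolyRuns.pair hb hl)
  have hloop : PolyRuns (fun d => esize d + M d) (fun d => enc (d, b d, l d))
      fun d => enc (d, (l d).foldl (s d) (b d), ([] : List α)) := by
    have hlen := hl.size_output.mono fun d => (length_lt_esize (l d)).le
    refine ⟨Prog.loop test p, _,
      (hlen.add (PolyBd.const 1)).mul ((PolyBd.const 3).mul hK), fun d => ?_⟩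
    let st : ℕ → Data := fun j => enc (d, ((l d).take j).foldl (s d) (b d), (l d).drop j)
    have hsz : ∀ j, (st j).size ≤ esize d + R d + esize (l d) := fun j => by
      have h1 := hacc d _ (List.take_prefix j (l d))
      have h2 := esize_sublist (List.drop_sublist j (l d))
      change esize (d, ((l d).take j).foldl (s d) (b d), (l d).drop j) ≤ _
      simp only [esize_mk]; omega
    have htest : ∀ j, ∃ t ≤ K d, test.Runs (st j) (enc ((l d).drop j)) t := fun j => by
      refine ⟨_, ?_, (Prog.Runs.snd (st j)).seq (Prog.Runs.snd _)⟩
      have h1 := hsz j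
      have h2 := Data.size_snd_le (st j)
      have h3 := Nat.zero_le ((esize d + R d + esize (l d) + R d + 2) ^ c)
      simp only [K]; omega
    have hfin : st (l d).length = enc (d, (l d).foldl (s d) (b d), ([] : List α)) := by
      simp [st]
    have h0 : st 0 = enc (d, b d, l d) := by simp [st]
    simp only [← hfin, ← h0]
    refine Prog.Runs.iterate (l d).length st ?_ ?_ ?_
    · intro j hj
      obtain ⟨t, ht, hr⟩ := htest j
      refine ⟨_, t, ht, ?_, hr⟩
      rw [List.drop_eq_getElem_cons hj]
      exact Data.pair_ne_nil _ _
    · intro j hj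
      obtain ⟨t, ht, hr⟩ := hp (d, ((l d).take j).foldl (s d) (b d), (l d)[j], (l d).drop (j + 1))
      refine ⟨t, ht.trans ?_, ?_⟩
      · refine (hT _).trans ((Nat.pow_le_pow_left ?_ c).trans (Nat.le_add_left _ _))
        have h1 := hsz j
        have h2 := hN d ((l d).take j) (l d)[j] (by
          rw [List.take_append_getElem hj]; exact List.take_prefix _ _)
        have h3 : (st j).size = esize (d, ((l d).take j).foldl (s d) (b d), (l d).drop j) := rfl
        rw [List.drop_eq_getElem_cons hj] at h3
        simp only [X] at h2 ⊢
        omega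
      · have e1 : st j = x (d, ((l d).take j).foldl (s d) (b d), (l d)[j], (l d).drop (j + 1)) := by
          simp only [st, x, List.drop_eq_getElem_cons hj]
        have e2 : st (j + 1) = enc (d, s d (((l d).take j).foldl (s d) (b d)) (l d)[j],
            (l d).drop (j + 1)) := by
          simp only [st, List.take_succ_eq_append_getElem hj, List.foldl_append, List.foldl_cons,
            List.foldl_nil]
        rw [e1, e2]
        exact hr
    · obtain ⟨t, ht, hr⟩ := htest (l d).length
      rw [List.drop_length] at hr
      exact ⟨t, ht, hr⟩
  exact (hinit.comp hloop).snd.fst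

/-- A fold whose accumulator grows only by amounts that do not depend on it. -/
theorem foldl_of_growth_of_le {l : δ → List α} {b : δ → β} {s : δ → β → α → β} {N : δ × α → ℕ}
    (hl : CompIn l M) (hb : CompIn b M)
    (hs : CompIn (fun q : δ × β × α => s q.1 q.2.1 q.2.2) fun q => N (q.1, q.2.2))
    {G R : δ → ℕ} (hG : PolyBd (fun d => esize d + M d) G)
    (hR : PolyBd (fun d => esize d + M d) R)
    (hN : ∀ d, ∀ a ∈ l d, N (d, a) ≤ R d)
    (hgrow : ∀ d acc, ∀ a ∈ l d, esize (s d acc a) ≤ esize acc + G d) :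
    CompIn (fun d => (l d).foldl (s d) (b d)) M := by
  refine foldl (R := fun d => esize (b d) + esize (l d) * G d + R d) hl hb hs
    ((hb.size_output.add (hl.size_output.mul hG)).add hR) (fun d l' h => ?_)
    fun d l' a h => (hN d a (h.subset (by simp))).trans (Nat.le_add_left _ _)
  have key : ∀ l' : List α, l' ⊆ l d →
      esize (l'.foldl (s d) (b d)) ≤ esize (b d) + l'.length * G d := by
    intro l'
    induction l' using List.reverseRecOn with
    | nil => simp
    | append_singleton l' a ih =>
      intro hsub
      have h1 := ih fun x hx => hsub (by simp [hx])
      have h2 := hgrow d (l'.foldl (s d) (b d)) a (hsub (by simp))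
      rw [List.foldl_append, List.foldl_cons, List.foldl_nil, List.length_append,
        List.length_singleton, add_mul]
      omega
  have h1 := key l' h.subset
  have h2 : l'.length * G d ≤ esize (l d) * G d :=
    Nat.mul_le_mul_right _ (h.length_le.trans (length_lt_esize _).le)
  omega

theorem polyBd_self : PolyBd (fun d : δ => esize d + M d) M :=
  PolyBd.of_le fun _ => Nat.le_add_left _ _

theorem foldl_of_growth {l : δ → List α} {b : δ → β} {s : δ → β → α → β}
    (hl : CompIn l M) (hb : CompIn b M)
    (hs : CompIn (fun q : δ × β × α => s q.1 q.2.1 q.2.2) fun q => M q.1)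
    {G : δ → ℕ} (hG : PolyBd (fun d => esize d + M d) G)
    (hgrow : ∀ d acc, ∀ a ∈ l d, esize (s d acc a) ≤ esize acc + G d) :
    CompIn (fun d => (l d).foldl (s d) (b d)) M :=
  foldl_of_growth_of_le (N := fun p => M p.1) hl hb hs hG polyBd_self (fun _ _ _ => le_rfl) hgrow

end CompIn

end

/-! ### Lists and Booleans -/

section

variable {α β γ δ : Type} [Enc α] [Enc β] [Enc γ] [Enc δ] {M : δ → ℕ}

namespace CompIn

@[fun_prop]
theorem not {f : δ → Bool} (hf : CompIn f M) : CompIn (fun d => !f d) M :=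
  (hf.ite (const false) (const true)).of_enc_eq fun d => by cases f d <;> rfl

@[fun_prop]
theorem and {f g : δ → Bool} (hf : CompIn f M) (hg : CompIn g M) :
    CompIn (fun d => f d && g d) M :=
  (hf.ite hg (const false)).of_enc_eq fun d => by cases f d <;> rfl

@[fun_prop]
theorem or {f g : δ → Bool} (hf : CompIn f M) (hg : CompIn g M) :
    CompIn (fun d => f d || g d) M :=
  (hf.ite (const true) hg).of_enc_eq fun d => by cases f d <;> rfl

@[fun_prop]
theorem xor {f g : δ → Bool} (hf : CompIn f M) (hg : CompIn g M) :
    CompIn (fun d => f d ^^ g d) M :=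
  (hf.ite hg.not hg).of_enc_eq fun d => by cases f d <;> cases g d <;> rfl

@[fun_prop]
theorem boolEq {f g : δ → Bool} (hf : CompIn f M) (hg : CompIn g M) :
    CompIn (fun d => f d == g d) M :=
  (hf.ite hg hg.not).of_enc_eq fun d => by cases f d <;> cases g d <;> rfl

@[fun_prop]
theorem reverse {l : δ → List α} (hl : CompIn l M) : CompIn (fun d => (l d).reverse) M := by
  have h := foldl_of_growth (s := fun _ acc a => a :: acc) hl (const ([] : List α))
    (by fun_prop) hl.size_output fun d acc a ha => by
      have := esize_le_of_mem ha
      simp only [esize_cons]; omega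
  simpa using h

/-- A right fold is a left fold over the reversed list, and prefixes become suffixes. -/
theorem foldr {l : δ → List α} {b : δ → β} {s : δ → α → β → β} {N : δ × β × α → ℕ}
    (hl : CompIn l M) (hb : CompIn b M) (hs : CompIn (fun q : δ × β × α => s q.1 q.2.2 q.2.1) N)
    {R : δ → ℕ} (hR : PolyBd (fun d => esize d + M d) R)
    (hacc : ∀ d l', l' <:+ l d → esize (l'.foldr (s d) (b d)) ≤ R d)
    (hN : ∀ d l' a, a :: l' <:+ l d → N (d, l'.foldr (s d) (b d), a) ≤ R d) :
    CompIn (fun d => (l d).foldr (s d) (b d)) M := by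
  have h := foldl (s := fun d acc a => s d a acc) hl.reverse hb hs hR (fun d l' h => by
      rw [← List.foldr_reverse]
      exact hacc d _ (by simpa using List.reverse_suffix.2 h))
    fun d l' a h => by
      rw [← List.foldr_reverse]
      exact hN d _ a (by simpa using List.reverse_suffix.2 h)
  simpa using h

@[fun_prop]
theorem append {l l' : δ → List α} (hl : CompIn l M) (hl' : CompIn l' M) :
    CompIn (fun d => l d ++ l' d) M := by
  have h := foldl_of_growth (s := fun _ acc a => a :: acc) hl.reverse hl'
    (by fun_prop) hl.size_output fun d acc a ha => by
      have := esize_le_of_mem (List.mem_reverse.1 ha)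
      simp only [esize_cons]; omega
  simpa using h

/-- A member of a list is no larger than the list, so one bound per `d` serves all images at once;
the maps and unions below need such a uniform bound. -/
theorem polyBd_image {l : δ → List α} {f : δ → α → β} {N : δ × α → ℕ} (hl : CompIn l M)
    (hf : CompIn (fun p : δ × α => f p.1 p.2) N) {R : δ → ℕ}
    (hR : PolyBd (fun d => esize d + M d) R) (hN : ∀ d, ∀ a ∈ l d, N (d, a) ≤ R d) :
    ∃ G : δ → ℕ, PolyBd (fun d => esize d + M d) G ∧ ∀ d, ∀ a ∈ l d, esize (f d a) ≤ G d := by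
  obtain ⟨c, hc⟩ := hf.size_output
  refine ⟨fun d => (esize d + esize (l d) + R d + 2) ^ c,
    (((polyBd_esize.add hl.size_output).add hR).add (PolyBd.const 2)).pow c, fun d a ha => ?_⟩
  refine (hc (d, a)).trans (Nat.pow_le_pow_left ?_ c)
  have := esize_le_of_mem ha
  have := hN d a ha
  simp only [esize_mk]; omega

theorem flatMap_of_le {l : δ → List α} {f : δ → α → List β} {N : δ × α → ℕ} (hl : CompIn l M)
    (hf : CompIn (fun p : δ × α => f p.1 p.2) N) {R : δ → ℕ}
    (hR : PolyBd (fun d => esize d + M d) R) (hN : ∀ d, ∀ a ∈ l d, N (d, a) ≤ R d) :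
    CompIn (fun d => (l d).flatMap (f d)) M := by
  obtain ⟨G, hG, hG'⟩ := polyBd_image hl hf hR hN
  have h := foldl_of_growth_of_le (s := fun d acc a => acc ++ f d a) hl (const ([] : List β))
    (append (by fun_prop) (hf.comp_of_le (f := fun q : δ × List β × α => (q.1, q.2.2))
      (by fun_prop) (PolyBd.of_le fun _ => Nat.le_add_left _ _))) hG hR hN fun d acc a ha => by
      have := hG' d a ha
      have := esize_append acc (f d a)
      omega
  refine h.of_enc_eq fun d => ?_
  have key : ∀ (l : List α) acc,
      l.foldl (fun acc a => acc ++ f d a) acc = acc ++ l.flatMap (f d) := by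
    intro l
    induction l with
    | nil => simp
    | cons a l ih => intro acc; simp [ih]
  rw [key, List.nil_append]

theorem flatMap {l : δ → List α} {f : δ → α → List β} (hl : CompIn l M)
    (hf : CompIn (fun p : δ × α => f p.1 p.2) fun p => M p.1) :
    CompIn (fun d => (l d).flatMap (f d)) M :=
  flatMap_of_le hl hf polyBd_self fun _ _ _ => le_rfl

theorem map_of_le {l : δ → List α} {f : δ → α → β} {N : δ × α → ℕ} (hl : CompIn l M)
    (hf : CompIn (fun p : δ × α => f p.1 p.2) N) {R : δ → ℕ}
    (hR : PolyBd (fun d => esize d + M d) R) (hN : ∀ d, ∀ a ∈ l d, N (d, a) ≤ R d) :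
    CompIn (fun d => (l d).map (f d)) M := by
  have h := flatMap_of_le (f := fun d a => [f d a]) hl (hf.cons (const [])) hR hN
  refine h.of_enc_eq fun d => ?_
  congr 1
  induction l d <;> simp_all

theorem map {l : δ → List α} {f : δ → α → β} (hl : CompIn l M)
    (hf : CompIn (fun p : δ × α => f p.1 p.2) fun p => M p.1) :
    CompIn (fun d => (l d).map (f d)) M :=
  map_of_le hl hf polyBd_self fun _ _ _ => le_rfl

theorem ctx {f : δ → β} (hf : CompIn f M) :
    CompIn (fun q : δ × γ => f q.1) fun q => M q.1 :=
  hf.comp_of_le (f := fun q : δ × γ => q.1) (by fun_prop) polyBd_self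

theorem filter {l : δ → List α} {f : δ → α → Bool} (hl : CompIn l M)
    (hf : CompIn (fun p : δ × α => f p.1 p.2) fun p => M p.1) :
    CompIn (fun d => (l d).filter (f d)) M := by
  have h := flatMap (f := fun d a => if f d a = true then [a] else []) hl
    (ite hf (by fun_prop) (const []))
  refine h.of_enc_eq fun d => ?_
  congr 1
  induction l d with
  | nil => rfl
  | cons a l ih => rw [List.flatMap_cons, ih, List.filter_cons]; split_ifs <;> rfl

theorem any {l : δ → List α} {f : δ → α → Bool} (hl : CompIn l M)
    (hf : CompIn (fun p : δ × α => f p.1 p.2) fun p => M p.1) :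
    CompIn (fun d => (l d).any (f d)) M := by
  have h := (filter hl hf).isEmpty.not
  refine h.of_enc_eq fun d => ?_
  congr 1
  induction l d with
  | nil => rfl
  | cons a l ih => rw [List.any_cons, ← ih, List.filter_cons]; cases f d a <;> rfl

theorem all {l : δ → List α} {f : δ → α → Bool} (hl : CompIn l M)
    (hf : CompIn (fun p : δ × α => f p.1 p.2) fun p => M p.1) :
    CompIn (fun d => (l d).all (f d)) M := by
  have h := (any (f := fun d a => !f d a) hl hf.not).not
  refine h.of_enc_eq fun d => ?_
  rw [List.not_any_eq_all_not]
  simp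

@[fun_prop]
theorem dropLength {l : δ → List α} {l' : δ → List β} (hl : CompIn l M) (hl' : CompIn l' M) :
    CompIn (fun d => (l d).drop (l' d).length) M := by
  have h := foldl_of_growth (s := fun _ acc _ => acc.tail) hl' hl
    (by fun_prop) (PolyBd.const 0) fun d acc a ha => esize_sublist (List.tail_sublist _)
  refine h.of_enc_eq fun d => ?_
  congr 1
  generalize l d = l
  induction l' d generalizing l with
  | nil => rfl
  | cons a l' ih => rw [List.foldl_cons, ih, List.length_cons, List.drop_tail]

@[fun_prop]
theorem lengthLE {l : δ → List α} {l' : δ → List β} (hl : CompIn l M) (hl' : CompIn l' M) :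
    CompIn (fun d => decide ((l d).length ≤ (l' d).length)) M := by
  have h := (hl.dropLength hl').isEmpty
  refine h.of_enc_eq fun d => ?_
  congr 1
  rw [Bool.eq_iff_iff]; simp

@[fun_prop]
theorem lengthLT {l : δ → List α} {l' : δ → List β} (hl : CompIn l M) (hl' : CompIn l' M) :
    CompIn (fun d => decide ((l d).length < (l' d).length)) M := by
  have h := (hl'.lengthLE hl).not
  refine h.of_enc_eq fun d => ?_
  congr 1
  rw [Bool.eq_iff_iff]; simp

@[fun_prop]
theorem lengthEq {l : δ → List α} {l' : δ → List β} (hl : CompIn l M) (hl' : CompIn l' M) :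
    CompIn (fun d => decide ((l d).length = (l' d).length)) M := by
  have h := (hl.lengthLE hl').and (hl'.lengthLE hl)
  refine h.of_enc_eq fun d => ?_
  congr 1
  rw [Bool.eq_iff_iff]; simp; omega

end CompIn

end

/-! ### Binary arithmetic -/

/-- The number with a given list of binary digits, least significant digit first. -/
def bitsVal (l : List Bool) : ℕ := l.foldr Nat.bit 0

@[simp] theorem bitsVal_nil : bitsVal [] = 0 := rfl

@[simp] theorem bitsVal_cons (b : Bool) (l : List Bool) :
    bitsVal (b :: l) = 2 * bitsVal l + b.toNat := Nat.bit_val _ _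

theorem bitsVal_bits (n : ℕ) : bitsVal n.bits = n := by
  induction n using Nat.binaryRec' with
  | zero => rfl
  | bit b n h ih => rw [Nat.bits_append_bit _ _ h, bitsVal_cons, ih, Nat.bit_val]

theorem bitsVal_append (l l' : List Bool) :
    bitsVal (l ++ l') = bitsVal l + 2 ^ l.length * bitsVal l' := by
  induction l with
  | nil => simp
  | cons b l ih => simp only [List.cons_append, bitsVal_cons, ih, List.length_cons]; ring

theorem bitsVal_lt (l : List Bool) : bitsVal l < 2 ^ l.length := by
  induction l with
  | nil => simp
  | cons b l ih =>
    have := b.toNat_le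
    rw [bitsVal_cons, List.length_cons, pow_succ]
    omega

/-- This is two's complement: to add the complement and a carry of one is to subtract, up to a power
of two. -/
theorem bitsVal_map_not (l : List Bool) :
    bitsVal (l.map (!·)) + bitsVal l + 1 = 2 ^ l.length := by
  induction l with
  | nil => rfl
  | cons b l ih =>
    rw [List.map_cons, bitsVal_cons, bitsVal_cons, List.length_cons, pow_succ, ← ih]
    cases b <;> simp <;> ring

theorem bitsVal_map_false {α : Type} (l : List α) : bitsVal (l.map fun _ => false) = 0 := by
  induction l <;> simp_all

/-- The sum of two binary numbers and a carry, with one digit more than the first of them. -/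
def addBits : Bool → List Bool → List Bool → List Bool
  | c, [], _ => [c]
  | c, x :: xs, ys =>
    (x ^^ (ys.headD false ^^ c)) ::
      addBits ((x && ys.headD false) || (c && (x || ys.headD false))) xs ys.tail

theorem bitsVal_addBits (c : Bool) (xs ys : List Bool) (h : ys.length ≤ xs.length) :
    bitsVal (addBits c xs ys) = bitsVal xs + bitsVal ys + c.toNat := by
  induction xs generalizing c ys with
  | nil =>
    obtain rfl := List.eq_nil_of_length_eq_zero (Nat.le_zero.1 h)
    simp [addBits]
  | cons x xs ih =>
    rw [addBits, bitsVal_cons, ih _ _ (by simp at h ⊢; omega), bitsVal_cons]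
    cases ys with
    | nil => cases x <;> cases c <;> simp; omega
    | cons y ys =>
      rw [bitsVal_cons]
      cases x <;> cases y <;> cases c <;> (simp; omega)

theorem exists_addBits_eq (c : Bool) (xs ys : List Bool) :
    ∃ l c', addBits c xs ys = l ++ [c'] ∧ l.length = xs.length := by
  induction xs generalizing c ys with
  | nil => exact ⟨[], c, rfl, rfl⟩
  | cons x xs ih =>
    obtain ⟨l, c', h, hl⟩ := ih ((x && ys.headD false) || (c && (x || ys.headD false))) ys.tail
    exact ⟨_ :: l, c', by rw [addBits, h]; rfl, by simp [hl]⟩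

/-- The difference of two binary numbers with a sign digit (`true` for a nonnegative value),
most significant digit first. -/
def subBits (xs ys : List Bool) : List Bool :=
  (addBits true (xs ++ ys.map fun _ => false)
    ((ys ++ xs.map fun _ => false).map (!·))).reverse

/-- Both numbers are padded to a common length `k`, and the sum is `2 ^ k + m - n`. Its top digit is
set exactly for `n ≤ m`, and then the other digits hold the difference. -/
theorem subBits_spec (m n : ℕ) :
    (subBits m.bits n.bits).headD false = decide (n ≤ m) ∧
      (n ≤ m → bitsVal (subBits m.bits n.bits).tail.reverse = m - n) := by
  set xs := m.bits ++ n.bits.map fun _ => false with hxs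
  set ys := n.bits ++ m.bits.map fun _ => false with hys
  have hlen : ys.length = xs.length := by simp [hxs, hys, add_comm]
  have hx : bitsVal xs = m := by rw [hxs, bitsVal_append, bitsVal_bits, bitsVal_map_false]; simp
  have hy : bitsVal ys = n := by rw [hys, bitsVal_append, bitsVal_bits, bitsVal_map_false]; simp
  obtain ⟨l, c, h, hl⟩ := exists_addBits_eq true xs (ys.map (!·))
  have h1 := bitsVal_addBits true xs (ys.map (!·)) (by simp [hlen])
  have h2 := bitsVal_map_not ys
  have h3 := bitsVal_lt l
  rw [h, bitsVal_append, bitsVal_cons, bitsVal_nil, hx] at h1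
  rw [hy, hlen] at h2
  rw [hl] at h1 h3
  have e : subBits m.bits n.bits = c :: l.reverse := by
    rw [subBits, ← hxs, ← hys, h]; simp
  rw [e]
  simp only [List.headD_cons, List.tail_cons, List.reverse_reverse]
  cases c
  · simp at h1
    exact ⟨by rw [eq_comm, decide_eq_false_iff_not]; omega, fun hnm => by omega⟩
  · simp at h1
    exact ⟨by rw [eq_comm, decide_eq_true_iff]; omega, fun hnm => by omega⟩

section

variable {α β γ δ : Type} [Enc α] [Enc β] [Enc γ] [Enc δ] {M : δ → ℕ}

theorem esize_bits (n : ℕ) : esize n.bits = esize n := rfl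

/-- A binary digit contributes at most two leaves, and the end of the list one more. -/
theorem esize_nat_le_of_lt {n k : ℕ} (h : n < 2 ^ k) : esize n ≤ 2 * k + 1 := by
  have h1 : n.bits.length ≤ k := by rw [Nat.size_eq_bits_len]; exact Nat.size_le.2 h
  have h2 : ∀ l : List Bool, esize l ≤ 2 * l.length + 1 := fun l => by
    induction l with
    | nil => simp
    | cons b l ih => have := esize_bool b; simp; omega
  have h3 := h2 n.bits
  rw [esize_bits] at h3
  omega

theorem lt_two_pow_esize (n : ℕ) : n < 2 ^ esize n := by
  refine Nat.size_le.1 ?_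
  rw [← Nat.size_eq_bits_len, ← esize_bits]
  exact (length_lt_esize _).le

/-- The size is not monotone, because a digit one costs more than a digit zero; comparing the
numbers of digits loses a factor of two. -/
theorem esize_nat_le_of_le {m n : ℕ} (h : m ≤ n) : esize m ≤ 2 * esize n + 1 :=
  esize_nat_le_of_lt (h.trans_lt (lt_two_pow_esize n))

namespace CompIn

@[fun_prop]
theorem bits {n : δ → ℕ} (hn : CompIn n M) : CompIn (fun d => (n d).bits) M :=
  hn.of_enc_eq fun _ => rfl

@[fun_prop]
theorem bit {b : δ → Bool} {n : δ → ℕ} (hb : CompIn b M) (hn : CompIn n M) :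
    CompIn (fun d => Nat.bit (b d) (n d)) M := by
  have h : CompIn (fun d => if ((n d).bits.isEmpty && !b d) = true then [] else
    b d :: (n d).bits) M := by fun_prop
  refine h.of_enc_eq fun d => ?_
  change _ = enc (Nat.bit (b d) (n d)).bits
  congr 1
  rcases Nat.eq_zero_or_pos (n d) with hz | hz
  · rw [hz]; cases b d <;> simp
  · have : (n d).bits.isEmpty = false := by
      cases hbits : (n d).bits with
      | nil => have := bitsVal_bits (n d); rw [hbits, bitsVal_nil] at this; omega
      | cons => rfl
    rw [this, Nat.bits_append_bit _ _ fun h => by omega]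
    rfl

@[fun_prop]
theorem bitsVal {l : δ → List Bool} (hl : CompIn l M) : CompIn (fun d => bitsVal (l d)) M := by
  refine foldr (N := fun q => M q.1) (R := fun d => 2 * esize (l d) + 1 + M d) hl (const 0)
    (by fun_prop) ((((PolyBd.const 2).mul hl.size_output).add (PolyBd.const 1)).add
      (PolyBd.of_le fun _ => Nat.le_add_left _ _)) (fun d l' h => ?_) fun d l' a h =>
      Nat.le_add_left _ _
  have h1 := esize_nat_le_of_lt (bitsVal_lt l')
  have h2 := length_lt_esize l'
  have h3 := esize_sublist h.sublist
  change esize (_root_.bitsVal l') ≤ _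
  omega

@[fun_prop]
theorem addBits {c : δ → Bool} {xs ys : δ → List Bool} (hc : CompIn c M) (hx : CompIn xs M)
    (hy : CompIn ys M) : CompIn (fun d => addBits (c d) (xs d) (ys d)) M := by
  have h := foldl_of_growth (δ := δ) (M := M)
    (s := fun _ (q : Bool × List Bool × List Bool) x =>
      ((x && q.2.1.headD false) || (q.1 && (x || q.2.1.headD false)), q.2.1.tail,
        (x ^^ (q.2.1.headD false ^^ q.1)) :: q.2.2))
    hx (b := fun d => (c d, ys d, [])) (by fun_prop) (by fun_prop) (PolyBd.const 4)
    fun d acc a _ => by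
      have h1 := esize_bool ((a && acc.2.1.headD false) || (acc.1 && (a || acc.2.1.headD false)))
      have h2 := esize_bool (a ^^ (acc.2.1.headD false ^^ acc.1))
      have h3 := esize_sublist (List.tail_sublist acc.2.1)
      rw [esize_prod acc, esize_prod acc.2]
      simp only [esize_mk, esize_cons]
      omega
  have h' := (h.fst.cons h.snd.snd).reverse
  refine h'.of_enc_eq fun d => ?_
  congr 1
  have key : ∀ (xs : List Bool) (c : Bool) (ys out : List Bool),
      let r := xs.foldl (fun (q : Bool × List Bool × List Bool) x =>
      ((x && q.2.1.headD false) || (q.1 && (x || q.2.1.headD false)), q.2.1.tail,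
        (x ^^ (q.2.1.headD false ^^ q.1)) :: q.2.2)) (c, ys, out)
      (r.1 :: r.2.2).reverse = out.reverse ++ _root_.addBits c xs ys := by
    intro xs
    induction xs with
    | nil => intro c ys out; simp [_root_.addBits]
    | cons x xs ih => intro c ys out; simp only [List.foldl_cons, ih, _root_.addBits]; simp
  simpa using key (xs d) (c d) (ys d) []

@[fun_prop]
theorem add {m n : δ → ℕ} (hm : CompIn m M) (hn : CompIn n M) : CompIn (fun d => m d + n d) M := by
  have h1 : CompIn (fun d => (n d).bits.map fun _ => false) M := map (by fun_prop) (by fun_prop)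
  have h : CompIn (fun d => _root_.bitsVal (_root_.addBits false
      ((m d).bits ++ (n d).bits.map fun _ => false) (n d).bits)) M := by fun_prop
  refine h.of_enc_eq fun d => ?_
  rw [bitsVal_addBits _ _ _ (by simp), bitsVal_append, bitsVal_map_false, bitsVal_bits,
    bitsVal_bits]
  simp

theorem subBits {xs ys : δ → List Bool} (hx : CompIn xs M) (hy : CompIn ys M) :
    CompIn (fun d => subBits (xs d) (ys d)) M := by
  have h1 : CompIn (fun d => (ys d).map fun _ => false) M := map hy (by fun_prop)
  have h2 : CompIn (fun d => (xs d).map fun _ => false) M := map hx (by fun_prop)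
  have h3 : CompIn (fun d => ((ys d ++ (xs d).map fun _ => false)).map (!·)) M :=
    map (f := fun _ b => !b) (by fun_prop) (by fun_prop)
  unfold _root_.subBits
  fun_prop

@[fun_prop]
theorem natLE {m n : δ → ℕ} (hm : CompIn m M) (hn : CompIn n M) :
    CompIn (fun d => decide (m d ≤ n d)) M :=
  ((subBits hn.bits hm.bits).headD (const false)).of_enc_eq fun d => by
    rw [(subBits_spec (n d) (m d)).1]

@[fun_prop]
theorem sub {m n : δ → ℕ} (hm : CompIn m M) (hn : CompIn n M) : CompIn (fun d => m d - n d) M :=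
  ((natLE hn hm).ite (subBits hm.bits hn.bits).tail.reverse.bitsVal (const 0)).of_enc_eq
    fun d => by
    by_cases h : n d ≤ m d
    · rw [decide_eq_true h, if_pos rfl, (subBits_spec (m d) (n d)).2 h]
    · rw [decide_eq_false h, Nat.sub_eq_zero_of_le (by omega)]; rfl

@[fun_prop]
theorem mul {m n : δ → ℕ} (hm : CompIn m M) (hn : CompIn n M) : CompIn (fun d => m d * n d) M := by
  -- Horner's scheme: every intermediate value is the product of a top segment of the digits of `m
  -- d` with `n d`, and so has at most the sum of the two lengths.
  have h := foldr (l := fun d => (m d).bits) (b := fun _ => 0) (N := fun q => M q.1)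
    (s := fun d (b : Bool) acc => Nat.bit false acc + if b = true then n d else 0)
    (R := fun d => 2 * (esize (m d) + esize (n d)) + 1 + M d) hm.bits (const 0)
    (add (by fun_prop) (ite (by fun_prop) (hn.comp_of_le (f := fun q : δ × ℕ × Bool => q.1)
      (by fun_prop) (PolyBd.of_le fun _ => Nat.le_add_left _ _)) (const 0)))
    ((((PolyBd.const 2).mul (hm.size_output.add hn.size_output)).add (PolyBd.const 1)).add
      (PolyBd.of_le fun _ => Nat.le_add_left _ _))
  have key : ∀ (l : List Bool) (k : ℕ),
      l.foldr (fun b acc => Nat.bit false acc + if b = true then k else 0) 0 =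
        _root_.bitsVal l * k := by
    intro l k
    induction l with
    | nil => simp
    | cons b l ih =>
      rw [List.foldr_cons, ih, bitsVal_cons]
      cases b <;> simp [Nat.bit_val] <;> ring
  refine (h (fun d l' hl' => ?_) fun d l' a _ => Nat.le_add_left _ _).of_enc_eq fun d => ?_
  · rw [key]
    have h1 : _root_.bitsVal l' < 2 ^ esize (m d) := by
      refine (bitsVal_lt l').trans_le (Nat.pow_le_pow_right (by omega) ?_)
      rw [← esize_bits]
      exact hl'.length_le.trans (length_lt_esize _).le
    have h2 := lt_two_pow_esize (n d)
    have h3 : _root_.bitsVal l' * n d < 2 ^ (esize (m d) + esize (n d)) := by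
      rw [pow_add]; exact Nat.mul_lt_mul'' h1 h2
    have := esize_nat_le_of_lt h3
    omega
  · rw [key, bitsVal_bits]

end CompIn

end

/-! ### Division and greatest common divisors -/

/-- Long division of a binary number: quotient and remainder. -/
def divModBits (l : List Bool) (n : ℕ) : ℕ × ℕ :=
  l.foldr (fun b q =>
    (Nat.bit (decide (n ≤ Nat.bit b q.2)) q.1,
      if decide (n ≤ Nat.bit b q.2) = true then Nat.bit b q.2 - n else Nat.bit b q.2)) (0, 0)

theorem divModBits_cons (b : Bool) (l : List Bool) (n : ℕ) :
    divModBits (b :: l) n = (Nat.bit (decide (n ≤ Nat.bit b (divModBits l n).2)) (divModBits l n).1,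
      if n ≤ Nat.bit b (divModBits l n).2 then Nat.bit b (divModBits l n).2 - n
        else Nat.bit b (divModBits l n).2) := by
  unfold divModBits
  simp only [List.foldr_cons, decide_eq_true_eq]

/-- The divisor may be zero here, since the size estimate of the fold has to cover that case as
well. -/
theorem divModBits_le (l : List Bool) (n : ℕ) :
    (divModBits l n).1 < 2 ^ l.length ∧ (divModBits l n).2 < 2 ^ l.length := by
  induction l with
  | nil => simp [divModBits]
  | cons b l ih =>
    rw [divModBits_cons]
    obtain ⟨h1, h2⟩ := ih
    generalize divModBits l n = r at *
    have hb := Bool.toNat_le b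
    have hb' := Bool.toNat_le (decide (n ≤ Nat.bit b r.2))
    simp only [List.length_cons, pow_succ, Nat.bit_val] at *
    exact ⟨by omega, by split_ifs <;> omega⟩

theorem divModBits_spec (l : List Bool) {n : ℕ} (hn : 0 < n) :
    (divModBits l n).1 * n + (divModBits l n).2 = bitsVal l ∧ (divModBits l n).2 < n := by
  induction l with
  | nil => simpa [divModBits] using hn
  | cons b l ih =>
    rw [divModBits_cons]
    obtain ⟨h1, h2⟩ := ih
    have hb := Bool.toNat_le b
    rw [bitsVal_cons, ← h1]
    generalize divModBits l n = r at *
    simp only [Nat.bit_val] at *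
    by_cases h : n ≤ 2 * r.2 + b.toNat
    · simp only [h, decide_true, if_true, Bool.toNat_true]
      refine ⟨?_, by omega⟩
      zify [h]
      ring
    · simp only [h, decide_false, if_false, Bool.toNat_false]
      exact ⟨by ring, by omega⟩

theorem divModBits_zero_snd (l : List Bool) : (divModBits l 0).2 = bitsVal l := by
  induction l with
  | nil => rfl
  | cons b l ih => rw [divModBits_cons, ih, bitsVal_cons, ← Nat.bit_val]; simp

theorem divModBits_eq (m n : ℕ) :
    (0 < n → (divModBits m.bits n).1 = m / n) ∧ (divModBits m.bits n).2 = m % n := by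
  rcases Nat.eq_zero_or_pos n with rfl | hn
  · exact ⟨fun h => absurd h (lt_irrefl _), by rw [divModBits_zero_snd, bitsVal_bits, Nat.mod_zero]⟩
  · obtain ⟨h1, h2⟩ := divModBits_spec m.bits hn
    rw [bitsVal_bits, mul_comm, add_comm] at h1
    obtain ⟨h3, h4⟩ := (Nat.div_mod_unique hn).2 ⟨h1, h2⟩
    exact ⟨fun _ => h3.symm, h4.symm⟩

/-- One step of the Euclidean algorithm. -/
def euclidStep (q : ℕ × ℕ) : ℕ × ℕ := if q.2.bits.isEmpty = true then q else (q.2, q.1 % q.2)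

theorem bits_isEmpty (n : ℕ) : n.bits.isEmpty = decide (n = 0) := by
  rcases Nat.eq_zero_or_pos n with rfl | h
  · rfl
  · rw [decide_eq_false (by omega)]
    cases hbits : n.bits with
    | nil => have := bitsVal_bits n; rw [hbits, bitsVal_nil] at this; omega
    | cons => rfl

theorem euclidStep_le (q : ℕ × ℕ) :
    (euclidStep q).1 ≤ max q.1 q.2 ∧ (euclidStep q).2 ≤ max q.1 q.2 := by
  unfold euclidStep
  split_ifs
  · exact ⟨le_max_left _ _, le_max_right _ _⟩
  · exact ⟨le_max_right _ _, (Nat.mod_le _ _).trans (le_max_left _ _)⟩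

/-- With the larger number in front, the remainder is less than half of it, so each step lowers the
total number of binary digits by at least one. -/
theorem iterate_euclidStep_of_le (k : ℕ) (q : ℕ × ℕ) (h : q.2 ≤ q.1)
    (hk : q.1.size + q.2.size ≤ k) : (euclidStep^[k] q).1 = q.1.gcd q.2 := by
  induction k generalizing q with
  | zero =>
    have h1 : q.2.size = 0 := by omega
    rw [Nat.size_eq_zero] at h1
    simp [h1]
  | succ k ih =>
    rw [Function.iterate_succ_apply]
    unfold euclidStep
    rw [bits_isEmpty]
    rcases Nat.eq_zero_or_pos q.2 with h0 | h0
    · rw [decide_eq_true h0, if_pos rfl]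
      have : euclidStep^[k] q = q :=
        Function.iterate_fixed (by unfold euclidStep; rw [bits_isEmpty, decide_eq_true h0]; rfl) k
      change (euclidStep^[k] q).1 = _
      rw [this, h0, Nat.gcd_zero_right]
    · rw [decide_eq_false (by omega), if_neg (by simp)]
      change (euclidStep^[k] (q.2, q.1 % q.2)).1 = _
      have hlt := Nat.mod_lt q.1 h0
      have h2 : 2 * (q.1 % q.2) < q.1 := by
        have h3 := Nat.div_add_mod q.1 q.2
        have h4 : q.2 * 1 ≤ q.2 * (q.1 / q.2) := Nat.mul_le_mul_left _ (Nat.div_pos h h0)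
        omega
      have h3 : (q.1 % q.2).size + 1 ≤ q.1.size := by
        rcases Nat.eq_zero_or_pos (q.1 % q.2) with h5 | h5
        · rw [h5, Nat.size_zero]
          exact Nat.size_pos.2 (by omega)
        · have h6 : Nat.size (2 * (q.1 % q.2)) = (q.1 % q.2).size + 1 := by
            have := Nat.size_bit (b := false) (n := q.1 % q.2) (by simp [Nat.bit_val]; omega)
            simpa [Nat.bit_val] using this
          rw [← h6]
          exact Nat.size_le_size h2.le
      rw [ih (q.2, q.1 % q.2) hlt.le (by simp only; omega)]
      change q.2.gcd (q.1 % q.2) = _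
      rw [Nat.gcd_comm q.2, ← Nat.gcd_rec, Nat.gcd_comm]

/-- The extra step exchanges the two numbers if the smaller one comes first. -/
theorem iterate_euclidStep (k m n : ℕ) (hk : m.size + n.size + 1 ≤ k) :
    (euclidStep^[k] (m, n)).1 = m.gcd n := by
  rcases Nat.le_total n m with h | h
  · exact iterate_euclidStep_of_le k (m, n) h (by simp only; omega)
  · obtain ⟨k, rfl⟩ : ∃ j, k = j + 1 := ⟨k - 1, by omega⟩
    rcases Nat.eq_zero_or_pos n with rfl | h0
    · exact iterate_euclidStep_of_le _ (m, 0) (by simp) (by simp only; omega)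
    · rw [Function.iterate_succ_apply]
      have e : euclidStep (m, n) = (n, m % n) := by
        unfold euclidStep
        rw [bits_isEmpty, decide_eq_false (by simp only; omega)]
        rfl
      have h1 := Nat.size_le_size (Nat.mod_le m n)
      rw [e, iterate_euclidStep_of_le k (n, m % n) (Nat.mod_lt _ h0).le (by simp only; omega)]
      change n.gcd (m % n) = _
      rw [Nat.gcd_comm n, ← Nat.gcd_rec, Nat.gcd_comm]

section

variable {α β γ δ : Type} [Enc α] [Enc β] [Enc γ] [Enc δ] {M : δ → ℕ}

namespace CompIn

theorem divModBits {l : δ → List Bool} {n : δ → ℕ} (hl : CompIn l M) (hn : CompIn n M) :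
    CompIn (fun d => divModBits (l d) (n d)) M := by
  refine comp (g := fun q : List Bool × ℕ => _root_.divModBits q.1 q.2) ?_ (prodMk hl hn)
  refine foldr (N := fun _ => 0) (R := fun d => 4 * esize d + 2) (l := fun q : List Bool × ℕ => q.1)
    (s := fun d b q => (Nat.bit (decide (d.2 ≤ Nat.bit b q.2)) q.1,
      if decide (d.2 ≤ Nat.bit b q.2) = true then Nat.bit b q.2 - d.2 else Nat.bit b q.2))
    (by fun_prop) (const (0, 0)) (by fun_prop)
    (((PolyBd.const 4).mul polyBd_esize).add (PolyBd.const 2)) (fun d l' h => ?_) fun d l' a h =>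
      Nat.zero_le _
  obtain ⟨h1, h2⟩ := divModBits_le l' d.2
  have h1' := esize_nat_le_of_lt h1
  have h2' := esize_nat_le_of_lt h2
  have h3 := length_lt_esize l'
  have h4 := esize_sublist h.sublist
  change esize (_root_.divModBits l' d.2) ≤ _
  rw [esize_prod, esize_prod d]
  omega

@[fun_prop]
theorem div {m n : δ → ℕ} (hm : CompIn m M) (hn : CompIn n M) : CompIn (fun d => m d / n d) M :=
  (hn.bits.isEmpty.ite (const 0) (divModBits hm.bits hn).fst).of_enc_eq fun d => by
    rw [bits_isEmpty]
    rcases Nat.eq_zero_or_pos (n d) with h | h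
    · rw [h]; simp
    · rw [decide_eq_false (by omega), if_neg (by simp), (divModBits_eq (m d) (n d)).1 h]

@[fun_prop]
theorem mod {m n : δ → ℕ} (hm : CompIn m M) (hn : CompIn n M) : CompIn (fun d => m d % n d) M :=
  (divModBits hm.bits hn).snd.of_enc_eq fun d => by rw [(divModBits_eq (m d) (n d)).2]

@[fun_prop]
theorem gcd {m n : δ → ℕ} (hm : CompIn m M) (hn : CompIn n M) :
    CompIn (fun d => (m d).gcd (n d)) M := by
  have hstep : CompIn (fun q : δ × (ℕ × ℕ) × Bool => euclidStep q.2.1) fun q => M q.1 := by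
    unfold euclidStep; fun_prop
  have key : ∀ (l : List Bool) (q : ℕ × ℕ),
      l.foldl (fun q _ => euclidStep q) q = euclidStep^[l.length] q := fun l => by
    induction l with
    | nil => simp
    | cons b l ih => intro q; rw [List.foldl_cons, ih]; rfl
  have hle : ∀ (k : ℕ) (q : ℕ × ℕ), (euclidStep^[k] q).1 ≤ q.1 + q.2 ∧
      (euclidStep^[k] q).2 ≤ q.1 + q.2 := fun k q => by
    have h : ∀ k, (euclidStep^[k] q).1 ≤ max q.1 q.2 ∧ (euclidStep^[k] q).2 ≤ max q.1 q.2 := by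
      intro k
      induction k with
      | zero => simp
      | succ k ih =>
        rw [Function.iterate_succ_apply']
        have := euclidStep_le (euclidStep^[k] q)
        omega
    have := h k
    omega
  have h := foldl (N := fun q => M q.1) (R := fun d => 4 * esize (m d + n d) + 2 + M d)
    -- Only the length of this list matters: it is a clock for the required number of Euclidean
    -- steps.
    (l := fun d => true :: ((m d).bits ++ (n d).bits)) (b := fun d => (m d, n d))
    (s := fun _ q _ => euclidStep q) (by fun_prop) (by fun_prop) hstep
    ((((PolyBd.const 4).mul (hm.add hn).size_output).add (PolyBd.const 2)).add
      (PolyBd.of_le fun _ => Nat.le_add_left _ _)) (fun d l' h => by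
        rw [key, esize_prod]
        obtain ⟨h1, h2⟩ := hle l'.length (m d, n d)
        simp only at h1 h2
        have h1' := esize_nat_le_of_le h1
        have h2' := esize_nat_le_of_le h2
        omega) fun d l' a h => Nat.le_add_left _ _
  refine h.fst.of_enc_eq fun d => ?_
  rw [key, iterate_euclidStep _ _ _ (by
    rw [List.length_cons, List.length_append, Nat.size_eq_bits_len, Nat.size_eq_bits_len])]

/-- Reduction of a fraction to lowest terms. -/
theorem ratOfNats {p q n : δ → ℕ} (hp : CompIn p M) (hq : CompIn q M) (hn : CompIn n M)
    (h0 : ∀ d, 0 < n d) : CompIn (fun d => (((p d : ℚ) - q d) / n d)) M := by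
  -- One of the two truncated differences is zero, so their sum is the absolute value of `p - q`.
  have h : CompIn (fun d => (!decide (q d ≤ p d),
      ((p d - q d) + (q d - p d)) / (((p d - q d) + (q d - p d)).gcd (n d)),
      n d / (((p d - q d) + (q d - p d)).gcd (n d)))) M := by fun_prop
  refine h.of_enc_eq fun d => ?_
  have hn0 := h0 d
  generalize p d = p at *
  generalize q d = q at *
  generalize n d = n at *
  have habs : (p - q) + (q - p) = ((p : ℤ) - q).natAbs := by omega
  have hr : ((p : ℚ) - q) / n = (((p : ℤ) - q : ℤ) : ℚ) / ((n : ℤ) : ℚ) := by push_cast; rfl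
  rw [habs, hr]
  set r : ℚ := (((p : ℤ) - q : ℤ) : ℚ) / ((n : ℤ) : ℚ) with hrdef
  have hsign : (!decide (q ≤ p)) = decide (r < 0) := by
    have : r < 0 ↔ ¬ q ≤ p := by
      rw [hrdef, div_lt_iff₀ (by exact_mod_cast hn0), zero_mul]
      constructor
      · intro h h'; have : ((p : ℤ) - q : ℤ) < 0 := by exact_mod_cast h
        omega
      · intro h; have : ((p : ℤ) - q : ℤ) < 0 := by omega
        exact_mod_cast this
    by_cases hqp : q ≤ p <;> simp [this, hqp]
  have e : r = Rat.normalize ((p : ℤ) - q) n hn0.ne' := by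
    rw [Rat.normalize_eq_mkRat, Rat.mkRat_eq_div, hrdef]; rfl
  have hnd : r.num.natAbs = ((p : ℤ) - q).natAbs / ((p : ℤ) - q).natAbs.gcd n ∧
      r.den = n / ((p : ℤ) - q).natAbs.gcd n := by
    rw [e, Rat.normalize_eq]
    refine ⟨?_, rfl⟩
    simp only
    rw [Int.natAbs_ediv_of_dvd (Int.natCast_dvd.2 (Nat.gcd_dvd_left _ _)), Int.natAbs_natCast]
  change Data.pair _ (Data.pair _ _) = Data.ofRat r
  rw [Data.ofRat, ← hsign, hnd.1, hnd.2]
  rfl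

end CompIn

end

/-! ### Integers as differences of natural numbers -/

/-- A pair `(p, q)` that stands for the integer `p - q`. -/
abbrev IntPair : Type := ℕ × ℕ

namespace IntPair

/-- The value of a pair. -/
def val (z : IntPair) : ℚ := z.1 - z.2

/-- A multiplicative bound for the entries of a pair. -/
def norm (z : IntPair) : ℕ := z.1 + z.2

/-- Addition of pairs. -/
def plus (z w : IntPair) : IntPair := (z.1 + w.1, z.2 + w.2)

/-- Multiplication of pairs. -/
def times (z w : IntPair) : IntPair := (z.1 * w.1 + z.2 * w.2, z.1 * w.2 + z.2 * w.1)

/-- The sum of a list of pairs. -/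
def sum (l : List IntPair) : IntPair := l.foldr plus (0, 0)

/-- The product of a list of pairs. -/
def prod (l : List IntPair) : IntPair := l.foldr times (1, 0)

theorem val_plus (z w : IntPair) : (plus z w).val = z.val + w.val := by
  simp only [val, plus]; push_cast; ring

theorem val_times (z w : IntPair) : (times z w).val = z.val * w.val := by
  simp only [val, times]; push_cast; ring

theorem norm_plus (z w : IntPair) : (plus z w).norm = z.norm + w.norm := by
  simp only [norm, plus]; ring

/-- The norm is the value with the minus sign turned into a plus sign, so it respects sums and
products exactly and long products need no correction factors. -/
theorem norm_times (z w : IntPair) : (times z w).norm = z.norm * w.norm := by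
  simp only [norm, times]; ring

theorem val_sum (l : List IntPair) : (sum l).val = (l.map val).sum := by
  induction l with
  | nil => simp [sum, val]
  | cons z l ih => rw [List.map_cons, List.sum_cons, ← ih, ← val_plus]; rfl

theorem val_prod (l : List IntPair) : (prod l).val = (l.map val).prod := by
  induction l with
  | nil => simp [prod, val]
  | cons z l ih => rw [List.map_cons, List.prod_cons, ← ih, ← val_times]; rfl

theorem norm_sum (l : List IntPair) : (sum l).norm = (l.map norm).sum := by
  induction l with
  | nil => rfl
  | cons z l ih => rw [List.map_cons, List.sum_cons, ← ih, ← norm_plus]; rfl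

theorem norm_prod (l : List IntPair) : (prod l).norm = (l.map norm).prod := by
  induction l with
  | nil => rfl
  | cons z l ih => rw [List.map_cons, List.prod_cons, ← ih, ← norm_times]; rfl

end IntPair

theorem two_pow_add_two_pow_le {a b : ℕ} (ha : 1 ≤ a) (hb : 1 ≤ b) :
    2 ^ a + 2 ^ b ≤ 2 ^ (a + b) := by
  have h1 : 2 ^ 1 ≤ 2 ^ a := Nat.pow_le_pow_right (by omega) ha
  have h2 : 2 ^ 1 ≤ 2 ^ b := Nat.pow_le_pow_right (by omega) hb
  rw [pow_add]
  nlinarith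

theorem IntPair.norm_lt (z : IntPair) : z.norm < 2 ^ esize z := by
  have h1 := lt_two_pow_esize z.1
  have h2 := lt_two_pow_esize z.2
  have h3 := two_pow_add_two_pow_le (one_le_esize z.1) (one_le_esize z.2)
  rw [esize_prod]
  unfold norm
  omega

theorem IntPair.esize_le {z : IntPair} {k : ℕ} (h : z.norm < 2 ^ k) : esize z ≤ 4 * k + 2 := by
  unfold norm at h
  have h1 := esize_nat_le_of_lt (n := z.1) (k := k) (by omega)
  have h2 := esize_nat_le_of_lt (n := z.2) (k := k) (by omega)
  rw [esize_prod]
  omega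

theorem IntPair.norm_sum_lt (l : List IntPair) : (sum l).norm < 2 ^ esize l := by
  induction l with
  | nil => exact Nat.two_pow_pos _
  | cons z l ih =>
    have h1 := z.norm_lt
    have h2 := two_pow_add_two_pow_le (one_le_esize z) (one_le_esize l)
    have h3 : (sum (z :: l)).norm = z.norm + (sum l).norm := norm_plus _ _
    rw [h3, esize_cons]
    omega

theorem IntPair.norm_prod_lt (l : List IntPair) : (prod l).norm < 2 ^ esize l := by
  induction l with
  | nil => exact Nat.one_lt_two
  | cons z l ih =>
    have h3 : (prod (z :: l)).norm = z.norm * (prod l).norm := norm_times _ _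
    rw [h3, esize_cons, pow_add]
    exact Nat.mul_lt_mul'' z.norm_lt ih

theorem natProd_lt (l : List ℕ) : l.prod < 2 ^ esize l := by
  induction l with
  | nil => exact Nat.one_lt_two
  | cons n l ih =>
    rw [List.prod_cons, esize_cons, pow_add]
    exact Nat.mul_lt_mul'' (lt_two_pow_esize n) ih

namespace CompIn

variable {α β γ δ : Type} [Enc α] [Enc β] [Enc γ] [Enc δ] {M : δ → ℕ}

@[fun_prop]
theorem plus {z w : δ → IntPair} (hz : CompIn z M) (hw : CompIn w M) :
    CompIn (fun d => (z d).plus (w d)) M := by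
  unfold IntPair.plus; fun_prop

@[fun_prop]
theorem times {z w : δ → IntPair} (hz : CompIn z M) (hw : CompIn w M) :
    CompIn (fun d => (z d).times (w d)) M := by
  unfold IntPair.times; fun_prop

@[fun_prop]
theorem intSum {l : δ → List IntPair} (hl : CompIn l M) :
    CompIn (fun d => IntPair.sum (l d)) M := by
  refine foldr (N := fun q => M q.1) (R := fun d => 4 * esize (l d) + 2 + M d) hl
    (const (0, 0)) (by fun_prop) ((((PolyBd.const 4).mul hl.size_output).add
      (PolyBd.const 2)).add polyBd_self) (fun d l' h => ?_) fun d l' a h => Nat.le_add_left _ _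
  have h1 := IntPair.esize_le (IntPair.norm_sum_lt l')
  have h2 := esize_sublist h.sublist
  change esize (IntPair.sum l') ≤ _
  omega

@[fun_prop]
theorem intProd {l : δ → List IntPair} (hl : CompIn l M) :
    CompIn (fun d => IntPair.prod (l d)) M := by
  refine foldr (N := fun q => M q.1) (R := fun d => 4 * esize (l d) + 2 + M d) hl
    (const (1, 0)) (by fun_prop) ((((PolyBd.const 4).mul hl.size_output).add
      (PolyBd.const 2)).add polyBd_self) (fun d l' h => ?_) fun d l' a h => Nat.le_add_left _ _
  have h1 := IntPair.esize_le (IntPair.norm_prod_lt l')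
  have h2 := esize_sublist h.sublist
  change esize (IntPair.prod l') ≤ _
  omega

@[fun_prop]
theorem natProd {l : δ → List ℕ} (hl : CompIn l M) : CompIn (fun d => (l d).prod) M := by
  refine foldr (N := fun q => M q.1) (R := fun d => 2 * esize (l d) + 1 + M d) hl
    (const 1) (by fun_prop) ((((PolyBd.const 2).mul hl.size_output).add
      (PolyBd.const 1)).add polyBd_self) (fun d l' h => ?_) fun d l' a h => Nat.le_add_left _ _
  have h1 := esize_nat_le_of_lt (natProd_lt l')
  have h2 := esize_sublist h.sublist
  change esize l'.prod ≤ _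
  omega

@[fun_prop]
theorem length {l : δ → List α} (hl : CompIn l M) : CompIn (fun d => (l d).length) M := by
  have h := foldr (N := fun q => M q.1) (s := fun _ _ n => n + 1)
    (R := fun d => 2 * esize (l d) + 1 + M d) hl
    (const 0) (by fun_prop) ((((PolyBd.const 2).mul hl.size_output).add
      (PolyBd.const 1)).add polyBd_self)
  have key : ∀ l : List α, l.foldr (fun _ n => n + 1) 0 = l.length := fun l => by
    induction l <;> simp_all
  refine (h (fun d l' h => ?_) fun d l' a h => Nat.le_add_left _ _).of_enc_eq fun d => by rw [key]
  have h1 := length_lt_esize l'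
  have h2 := esize_sublist h.sublist
  rw [key]
  have h3 := esize_nat_le_of_lt (n := l'.length) (k := esize l') (h1.trans Nat.lt_two_pow_self)
  omega

end CompIn

/-! ### Choices from lists of options -/

/-- All lists that choose one option for every entry of a list. -/
def choices {α β : Type} (o : α → List β) (l : List α) : List (List β) :=
  l.foldr (fun a acc => acc.flatMap fun s => (o a).map fun b => b :: s) [[]]

@[simp] theorem choices_nil {α β : Type} (o : α → List β) : choices o [] = [[]] := rfl

theorem choices_cons {α β : Type} (o : α → List β) (a : α) (l : List α) :
    choices o (a :: l) = (choices o l).flatMap fun s => (o a).map fun b => b :: s := rfl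

theorem length_of_mem_choices {α β : Type} {o : α → List β} {l : List α} {s : List β}
    (h : s ∈ choices o l) : s.length = l.length := by
  induction l generalizing s with
  | nil => simp at h; simp [h]
  | cons a l ih =>
    rw [choices_cons, List.mem_flatMap] at h
    obtain ⟨t, ht, h⟩ := h
    obtain ⟨b, _, rfl⟩ := List.mem_map.1 h
    simp [ih ht]

theorem length_choices_le {α β : Type} {o : α → List β} {k : ℕ} (hk : ∀ a, (o a).length ≤ k)
    (l : List α) : (choices o l).length ≤ k ^ l.length := by
  induction l with
  | nil => simp
  | cons a l ih =>
    rw [choices_cons, List.length_flatMap]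
    simp only [List.length_map, List.map_const', List.sum_replicate, smul_eq_mul,
      List.length_cons, pow_succ]
    exact Nat.mul_le_mul ih (hk a)

section

variable {α β γ δ : Type} [Enc α] [Enc β] [Enc γ] [Enc δ] {M : δ → ℕ}

theorem esize_le_of_forall_mem {l : List α} {G : ℕ} (h : ∀ a ∈ l, esize a ≤ G) :
    esize l ≤ l.length * G + 1 := by
  rw [esize_eq_sum]
  exact Nat.succ_le_succ ((List.sum_le_card_nsmul (l.map esize) G (by simpa using h)).trans
    (by simp))

omit [Enc α] in
theorem esize_of_mem_choices {o : α → List β} {l : List α} {G : ℕ}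
    (hG : ∀ a ∈ l, ∀ b ∈ o a, esize b ≤ G) {s : List β} (h : s ∈ choices o l) :
    esize s ≤ l.length * G + 1 := by
  rw [← length_of_mem_choices h]
  refine esize_le_of_forall_mem ?_
  induction l generalizing s with
  | nil => simp at h; simp [h]
  | cons a l ih =>
    rw [choices_cons, List.mem_flatMap] at h
    obtain ⟨t, ht, h⟩ := h
    obtain ⟨b, hb, rfl⟩ := List.mem_map.1 h
    intro x hx
    rcases List.mem_cons.1 hx with rfl | hx
    · exact hG a (by simp) _ hb
    · exact ih (fun a ha => hG a (by simp [ha])) ht x hx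

/-- The output is exponentially long in the list; the bound `R` on the number of choices lets the
parameter pay for it. -/
theorem CompIn.choices {o : α → List β} {l : δ → List α} (ho : CompIn o fun _ => 0)
    (hl : CompIn l M) {k : ℕ} (hk : ∀ a, (o a).length ≤ k) {R : δ → ℕ}
    (hR : PolyBd (fun d => esize d + M d) R) (hkR : ∀ d, k ^ (l d).length ≤ R d) :
    CompIn (fun d => choices o (l d)) M := by
  obtain ⟨G, hG, hG'⟩ := CompIn.polyBd_image (f := fun _ a => o a) hl
    (ho.comp (f := fun q : δ × α => q.2) (by fun_prop) : CompIn _ fun q => M q.1) polyBd_self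
    fun _ _ _ => le_rfl
  have hstep : CompIn (fun q : δ × List (List β) × α =>
      q.2.1.flatMap fun s => (o q.2.2).map fun b => b :: s) fun q => M q.1 :=
    flatMap (by fun_prop) (map (f := fun (q : (δ × List (List β) × α) × List β) b => b :: q.2)
      (ho.comp (by fun_prop)) (by fun_prop))
  refine foldr (N := fun q => M q.1) (s := fun _ a acc => acc.flatMap fun s =>
      (o a).map fun b => b :: s)
    (R := fun d => (R d + 1) * (esize (l d) * G d + 1) + 1 + M d) hl (const [[]]) hstep
    ((((hR.add (PolyBd.const 1)).mul ((hl.size_output.mul hG).add (PolyBd.const 1))).add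
      (PolyBd.const 1)).add polyBd_self) (fun d l' h => ?_) fun d l' a h => Nat.le_add_left _ _
  change esize (_root_.choices o l') ≤ _
  have hlen := h.length_le
  -- The additional one is for `k = 0`, where the empty suffix has one choice although the full list
  -- may have none.
  have h1 : (_root_.choices o l').length ≤ R d + 1 := by
    refine (length_choices_le hk l').trans ?_
    rcases Nat.eq_zero_or_pos k with rfl | hk0
    · exact (Nat.pow_le_pow_left (Nat.zero_le 1) _).trans (by simp)
    · exact (Nat.pow_le_pow_right hk0 hlen).trans ((hkR d).trans (Nat.le_succ _))
  have h2 : ∀ s ∈ _root_.choices o l', esize s ≤ esize (l d) * G d + 1 := fun s hs => by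
    refine (esize_of_mem_choices (G := G d) (fun a ha b hb => ?_) hs).trans ?_
    · exact (esize_le_of_mem hb).trans (hG' d a (h.subset ha))
    · exact Nat.succ_le_succ (Nat.mul_le_mul_right _ (hlen.trans (length_lt_esize _).le))
  have h3 := esize_le_of_forall_mem h2
  have h4 := Nat.mul_le_mul_right (esize (l d) * G d + 1) h1
  omega

end

/-! ### Brute force: kernels and the labels of a collapsed vertex set -/

/-- The code is the pair of the answers to "kept?" and "looped?", so both are read off by
projections. -/
instance : Enc PartClass where
  enc
    | PartClass.phi => enc (false, false)
    | PartClass.chi => enc (true, false)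
    | PartClass.psi => enc (true, true)

namespace PartClass

/-- The vertex is not deleted. -/
def kept : PartClass → Bool
  | phi => false
  | chi => true
  | psi => true

/-- The vertex gets a loop. -/
def looped : PartClass → Bool
  | phi => false
  | chi => false
  | psi => true

/-- The label that belongs to a class, from the triple of the labels of a vertex. -/
def pick {R : Type} (l : R × R × R) : PartClass → R
  | phi => l.1
  | chi => l.2.1
  | psi => l.2.2

end PartClass

section Kernel

variable {α : Type} (adj : α → α → Bool) (s : α → Bool)

/-- The parity of the number of chosen entries with the property `s`. -/
def parity (x : List ((α × PartClass) × Bool)) : Bool :=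
  x.foldr (fun p acc => (p.2 && s p.1.1) ^^ acc) false

/-- The vector `x` solves `M x = e s`, where `M` is the adjacency matrix. -/
def solves (e : Bool) (x : List ((α × PartClass) × Bool)) : Bool :=
  x.all fun p => !p.1.2.kept ||
    ((parity (adj p.1.1) x ^^ (p.2 && p.1.2.looped)) == (e && s p.1.1))

/-- The possible entries of a vector at a vertex. -/
def entries (p : α × PartClass) : List ((α × PartClass) × Bool) :=
  if p.2.kept then [(p, false), (p, true)] else [(p, false)]

/-- The solutions of `M x = e s`. -/
def solutions (e : Bool) (P : List (α × PartClass)) : List (List ((α × PartClass) × Bool)) :=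
  (choices entries P).filter (solves adj s e)

/-- A list whose length is the nullity of the adjacency matrix. -/
def nullityList (P : List (α × PartClass)) : List Bool :=
  (solutions adj s false P).length.bits.tail

/-- The power of `y = a / b` with exponent the length of `c`, times a power of `b`. -/
def scaledPow (a : IntPair) (b : ℕ) (c : List Bool) (P : List (α × PartClass)) : IntPair :=
  IntPair.times (IntPair.prod (c.map fun _ => a))
    (IntPair.prod ((P.drop c.length).map fun _ => (b, 0)))

/-- The contribution of one labeled partition to the labels of the collapsed vertex set. -/
def contribution (lab : α → IntPair × IntPair × IntPair) (a : IntPair) (b : ℕ)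
    (P : List (α × PartClass)) : IntPair × IntPair × IntPair :=
  if (solutions adj s true P).any (fun x => !parity s x) = true then
    (IntPair.times (IntPair.prod (P.map fun p => p.2.pick (lab p.1)))
      (scaledPow a b (nullityList adj s P) P), (0, 0), (0, 0))
  else if (solutions adj s true P).any (parity s) = true then
    ((0, 0), (0, 0), IntPair.times (IntPair.prod (P.map fun p => p.2.pick (lab p.1)))
      (scaledPow a b (nullityList adj s P) P))
  else ((0, 0), IntPair.times (IntPair.prod (P.map fun p => p.2.pick (lab p.1)))
      (scaledPow a b (nullityList adj s P).tail P), (0, 0))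

/-- The three classes of a vertex. -/
def classes (v : α) : List (α × PartClass) :=
  [(v, PartClass.phi), (v, PartClass.chi), (v, PartClass.psi)]

/-- The labels of the collapsed vertex set `A`. -/
def collapsedLabels (lab : α → IntPair × IntPair × IntPair) (a : IntPair) (b : ℕ)
    (A : List α) : IntPair × IntPair × IntPair :=
  (IntPair.sum ((choices classes A).map fun P => (contribution adj s lab a b P).1),
    IntPair.sum ((choices classes A).map fun P => (contribution adj s lab a b P).2.1),
    IntPair.sum ((choices classes A).map fun P => (contribution adj s lab a b P).2.2))

end Kernel

/-! ### Running time of the brute-force computation -/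

namespace CompIn

section

variable {α β γ δ : Type} [Enc α] [Enc β] [Enc γ] [Enc δ] {M : δ → ℕ}

theorem partClassCode {c : δ → PartClass} (hc : CompIn c M) :
    CompIn (fun d => ((c d).kept, (c d).looped)) M :=
  hc.of_enc_eq fun d => by cases c d <;> rfl

@[fun_prop]
theorem kept {c : δ → PartClass} (hc : CompIn c M) : CompIn (fun d => (c d).kept) M :=
  hc.partClassCode.fst

@[fun_prop]
theorem looped {c : δ → PartClass} (hc : CompIn c M) : CompIn (fun d => (c d).looped) M :=
  hc.partClassCode.snd

@[fun_prop]
theorem pick {l : δ → β × β × β} {c : δ → PartClass} (hl : CompIn l M) (hc : CompIn c M) :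
    CompIn (fun d => (c d).pick (l d)) M :=
  (hc.kept.ite (hc.looped.ite hl.snd.snd hl.snd.fst) hl.fst).of_enc_eq fun d => by
    cases c d <;> rfl

theorem parity {s : δ → α → Bool} {x : δ → List ((α × PartClass) × Bool)}
    (hs : CompIn (fun p : δ × α => s p.1 p.2) fun p => M p.1) (hx : CompIn x M) :
    CompIn (fun d => parity (s d) (x d)) M := by
  have h := foldl_of_growth (l := fun d => (x d).reverse)
    (s := fun d acc p => (p.2 && s d p.1.1) ^^ acc) (b := fun _ => false)
    (by fun_prop) (const false)
    (((snd (f := fun q : δ × Bool × ((α × PartClass) × Bool) => q.2.2) (by fun_prop)).and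
      (hs.comp_of_le (f := fun q : δ × Bool × ((α × PartClass) × Bool) => (q.1, q.2.2.1.1))
        (by fun_prop) polyBd_self)).xor (by fun_prop)) (PolyBd.const 2) fun d acc a _ => by
      have := esize_bool ((a.2 && s d a.1.1) ^^ acc)
      omega
  simpa [_root_.parity] using h

variable {adj : α → α → Bool} {s : α → Bool} {lab : α → IntPair × IntPair × IntPair}
  (hadj : CompIn (fun p : α × α => adj p.1 p.2) fun _ => 0) (hs : CompIn s fun _ => 0)

include hadj hs

theorem solves (e : Bool) {x : δ → List ((α × PartClass) × Bool)} (hx : CompIn x M) :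
    CompIn (fun d => solves adj s e (x d)) M := by
  refine comp (g := fun x => _root_.solves adj s e x) ?_ hx
  refine all (f := fun (x : List ((α × PartClass) × Bool)) p => !p.1.2.kept ||
    ((_root_.parity (adj p.1.1) x ^^ (p.2 && p.1.2.looped)) == (e && s p.1.1))) id ?_
  refine or (by fun_prop) (boolEq (xor (parity ?_ (by fun_prop)) (by fun_prop))
    (and (by fun_prop) (hs.comp (by fun_prop))))
  exact hadj.comp (f := fun p : (List ((α × PartClass) × Bool) × ((α × PartClass) × Bool)) × α =>
    (p.1.2.1.1, p.2)) (by fun_prop)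

theorem solutions (e : Bool) :
    CompIn (fun P : List (α × PartClass) => solutions adj s e P) fun P => 2 ^ P.length := by
  refine filter (f := fun _ => _root_.solves adj s e)
    (choices (R := fun P => 2 ^ P.length) (k := 2) ?_ id (fun a => ?_) polyBd_self
      fun _ => le_rfl) (solves hadj hs e (by fun_prop))
  · unfold entries; fun_prop
  · unfold entries; split_ifs <;> simp

theorem nullityList :
    CompIn (fun P : List (α × PartClass) => nullityList adj s P) fun P => 2 ^ P.length :=
  (solutions hadj hs false).length.bits.tail

omit hadj hs in
theorem scaledPow {a : δ → IntPair} {b : δ → ℕ} {c : δ → List Bool} {P : δ → List (α × PartClass)}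
    (ha : CompIn a M) (hb : CompIn b M) (hc : CompIn c M) (hP : CompIn P M) :
    CompIn (fun d => scaledPow (a d) (b d) (c d) (P d)) M := by
  unfold _root_.scaledPow
  exact times (intProd (map (f := fun d _ => a d) hc ha.ctx))
    (intProd (map (f := fun d _ => (b d, 0)) (hP.dropLength hc) (hb.ctx.prodMk (const 0))))

theorem contribution (hlab : CompIn lab fun _ => 0) :
    CompIn (fun d : (IntPair × ℕ) × List (α × PartClass) => contribution adj s lab d.1.1 d.1.2 d.2)
      fun d => 2 ^ d.2.length := by
  have hany : ∀ f : List ((α × PartClass) × Bool) → Bool, CompIn f (fun _ => 0) →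
      CompIn (fun d : (IntPair × ℕ) × List (α × PartClass) =>
        (_root_.solutions adj s true d.2).any f) fun d => 2 ^ d.2.length := fun f hf =>
    any (f := fun _ => f) ((solutions hadj hs true).comp_of_le (f := fun d :
      (IntPair × ℕ) × List (α × PartClass) => d.2) (by fun_prop) polyBd_self)
      (hf.comp (by fun_prop))
  have hpar : CompIn (_root_.parity s) fun _ => 0 :=
    parity (s := fun _ => s) (hs.comp (by fun_prop)) (by fun_prop)
  have hw : CompIn (fun d : (IntPair × ℕ) × List (α × PartClass) =>
      IntPair.prod (d.2.map fun p => p.2.pick (lab p.1))) fun d => 2 ^ d.2.length :=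
    intProd (map (f := fun _ (p : α × PartClass) => p.2.pick (lab p.1)) (by fun_prop)
      (pick (hlab.comp (by fun_prop)) (by fun_prop)))
  have hn : CompIn (fun d : (IntPair × ℕ) × List (α × PartClass) => _root_.nullityList adj s d.2)
      fun d => 2 ^ d.2.length :=
    (nullityList hadj hs).comp_of_le (f := fun d :
      (IntPair × ℕ) × List (α × PartClass) => d.2) (by fun_prop) polyBd_self
  have hp := hw.times (scaledPow (a := fun d : (IntPair × ℕ) × List (α × PartClass) => d.1.1)
    (b := fun d => d.1.2) (P := fun d => d.2) (by fun_prop) (by fun_prop) hn (by fun_prop))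
  have hp' := hw.times (scaledPow (a := fun d : (IntPair × ℕ) × List (α × PartClass) => d.1.1)
    (b := fun d => d.1.2) (P := fun d => d.2) (by fun_prop) (by fun_prop) hn.tail (by fun_prop))
  exact ite (hany _ hpar.not) (hp.prodMk (const _))
    (ite (hany _ hpar) ((const (0, 0)).prodMk ((const (0, 0)).prodMk hp))
      ((const (0, 0)).prodMk (hp'.prodMk (const (0, 0)))))

/-- There are `3 ^ |A|` partitions and at most `2 ^ |A|` vectors for each. Since `2 ^ |A| ≤ 3 ^
|A|`, the total work is polynomial in the single parameter `3 ^ |A|`. -/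
theorem collapsedLabels (hlab : CompIn lab fun _ => 0) :
    CompIn (fun d : (IntPair × ℕ) × List α => collapsedLabels adj s lab d.1.1 d.1.2 d.2)
      fun d => 3 ^ d.2.length := by
  have hch : CompIn (fun d : (IntPair × ℕ) × List α => _root_.choices classes d.2)
      fun d => 3 ^ d.2.length :=
    choices (k := 3) (R := fun d => 3 ^ d.2.length) (by unfold classes; fun_prop) (by fun_prop)
      (fun a => by simp [classes]) polyBd_self fun _ => le_rfl
  have hmap := map_of_le (f := fun (d : (IntPair × ℕ) × List α) P =>
      _root_.contribution adj s lab d.1.1 d.1.2 P)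
    (N := fun q => 2 ^ q.2.length) (R := fun d => 3 ^ d.2.length) hch
    ((contribution hadj hs hlab).comp_of_le
      (f := fun q : ((IntPair × ℕ) × List α) × List (α × PartClass) => (q.1.1, q.2))
      (by fun_prop) polyBd_self) polyBd_self fun d P hP => by
        rw [length_of_mem_choices hP]
        exact Nat.pow_le_pow_left (by omega) _
  have h : CompIn (fun d => _) fun d : (IntPair × ℕ) × List α => 3 ^ d.2.length :=
    prodMk (intSum (map (f := fun _ t => t.1) hmap (by fun_prop)))
      (prodMk (intSum (map (f := fun _ t => t.2.1) hmap (by fun_prop)))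
        (intSum (map (f := fun _ t => t.2.2) hmap (by fun_prop))))
  unfold _root_.collapsedLabels
  simpa only [List.map_map, Function.comp_def] using h

end

end CompIn

/-! ### The algorithm -/

/-- A vertex: its number in unary, its row of the adjacency matrix, and its labels. -/
abbrev Vert : Type := List Unit × List Bool × IntPair × IntPair × IntPair

namespace Vert

/-- Adjacency, read off from the row of the first vertex. -/
def adj (u v : Vert) : Bool := (u.2.1.drop v.1.length).headD false

/-- Equality of vertices. -/
def same (u v : Vert) : Bool := decide (u.1.length = v.1.length)

/-- The labels. -/
def labels (u : Vert) : IntPair × IntPair × IntPair := u.2.2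

/-- `u ∈ A` forces `w` into `A`, if the split `A` is to separate `a` from `b`. -/
def forces (a b u w : Vert) : Bool := u.adj w ^^ (a.adj b && u.adj b && a.adj w)

end Vert

/-- A list of vertices, some of which are marked. -/
abbrev Marking : Type := List (Vert × Bool)

/-- Mark all vertices that are forced by marked vertices. -/
def growMarking (a b : Vert) (m : Marking) : Marking :=
  m.map fun w => (w.1, w.2 || m.any fun u => u.2 && Vert.forces a b u.1 w.1)

/-- The least marking that contains `a` and `c` and is closed under forcing. -/
def closureMarking (V : List Vert) (t : Vert × Vert × Vert) : Marking :=
  (t.1 :: V).foldl (fun m _ => growMarking t.1 t.2.1 m)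
    (V.map fun w => (w, w.same t.1 || w.same t.2.2))

/-- A set of vertices to be collapsed, with marks at the neighbours of the other vertices; the other
vertices; and the vertex that represents the collapsed set. -/
abbrev Collapse : Type := Marking × List Vert × Vert

/-- The collapse obtained from a closed marking. -/
def candidate (V : List Vert) (t : Vert × Vert × Vert) : Collapse :=
  (((closureMarking V t).filter fun u => u.2).map fun u => (u.1, t.1.adj t.2.1 && u.1.adj t.2.1),
    ((closureMarking V t).filter fun u => !u.2).map fun u => u.1, t.1)

/-- The marked set is one side of a split. -/
def Collapse.valid (k : Collapse) (b : Vert) : Bool :=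
  !k.1.tail.isEmpty && (!k.2.1.tail.isEmpty && k.2.1.any fun w => w.same b)

/-- The better of the collapse `k` and the candidate for `t`. -/
def better (V : List Vert) (k : Collapse) (t : Vert × Vert × Vert) : Collapse :=
  if ((candidate V t).valid t.2.1 && decide ((candidate V t).1.length < k.1.length)) = true then
    candidate V t
  else k

/-- The collapse of all vertices. -/
def totalCollapse (V : List Vert) : Collapse :=
  (V.map fun v => (v, false), [], ([], [], (0, 0), (0, 0), (0, 0)))

instance : Enc Collapse := inferInstanceAs (Enc (List (Vert × Bool) × List Vert × Vert))

/-- All triples of vertices. -/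
def triples (V : List Vert) : List (Vert × Vert × Vert) :=
  V.flatMap fun a => V.flatMap fun b => V.map fun c => (a, b, c)

/-- The collapse of the smallest side of a split, or of all vertices. -/
def bestCollapse (V : List Vert) : Collapse := (triples V).foldl (better V) (totalCollapse V)

/-- The list of vertices after a collapse. -/
def Collapse.apply (y : IntPair × ℕ) (k : Collapse) : List Vert :=
  (k.2.2.1, k.2.2.2.1, collapsedLabels (fun u w : Vert × Bool => u.1.adj w.1) (fun u => u.2)
    (fun u => u.1.labels) y.1 y.2 k.1) :: k.2.1

/-- One step of the main loop; the value of the polynomial is divided by the first component. -/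
def collapseStep (y : IntPair × ℕ) (st : ℕ × List Vert) : ℕ × List Vert :=
  (st.1 * ((bestCollapse st.2).1.map fun _ => y.2).prod, (bestCollapse st.2).apply y)

theorem map_fst_growMarking (a b : Vert) (m : Marking) :
    (growMarking a b m).map Prod.fst = m.map Prod.fst := by
  simp [growMarking]

theorem map_fst_foldl_growMarking {β : Type} (a b : Vert) (m : Marking) (l : List β) :
    (l.foldl (fun m _ => growMarking a b m) m).map Prod.fst = m.map Prod.fst := by
  induction l generalizing m with
  | nil => rfl
  | cons x l ih => rw [List.foldl_cons, ih, map_fst_growMarking]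

/-- A mark costs at most two and a vertex at least one. As forcing changes only the marks, this
bounds all stages of a closure at once. -/
theorem esize_marking_le (m : Marking) : esize m ≤ 3 * esize (m.map Prod.fst) := by
  induction m with
  | nil => simp
  | cons u m ih =>
    have h1 := esize_bool u.2
    have h2 := one_le_esize u.1
    simp only [List.map_cons, esize_cons, esize_prod u]
    omega

/-- The search never builds anything but candidates. This bounds its accumulator and also tells what
its result can be. -/
theorem foldl_better_cases (V : List Vert) (l : List (Vert × Vert × Vert)) (k : Collapse) :
    l.foldl (better V) k = k ∨ ∃ t ∈ l, l.foldl (better V) k = candidate V t ∧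
      (candidate V t).valid t.2.1 = true := by
  induction l using List.reverseRecOn with
  | nil => exact Or.inl rfl
  | append_singleton l t ih =>
    rw [List.foldl_append, List.foldl_cons, List.foldl_nil, better]
    split_ifs with h
    · rw [Bool.and_eq_true] at h
      exact Or.inr ⟨t, by simp, rfl, h.1⟩
    · rcases ih with ih | ⟨t', h1, h2⟩
      · exact Or.inl ih
      · exact Or.inr ⟨t', by simp [h1], h2⟩

/-! ### Running time of one step of the main loop -/

namespace CompIn

variable {α β γ δ : Type} [Enc α] [Enc β] [Enc γ] [Enc δ] {M : δ → ℕ}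

@[fun_prop]
theorem vertAdj {u v : δ → Vert} (hu : CompIn u M) (hv : CompIn v M) :
    CompIn (fun d => (u d).adj (v d)) M := by
  unfold Vert.adj; fun_prop

@[fun_prop]
theorem vertSame {u v : δ → Vert} (hu : CompIn u M) (hv : CompIn v M) :
    CompIn (fun d => (u d).same (v d)) M := by
  unfold Vert.same; fun_prop

@[fun_prop]
theorem forces {a b u v : δ → Vert} (ha : CompIn a M) (hb : CompIn b M) (hu : CompIn u M)
    (hv : CompIn v M) : CompIn (fun d => Vert.forces (a d) (b d) (u d) (v d)) M := by
  unfold Vert.forces; fun_prop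

theorem growMarking :
    CompIn (fun d : (Vert × Vert) × Marking => growMarking d.1.1 d.1.2 d.2) fun _ => 0 :=
  map (f := fun (d : (Vert × Vert) × Marking) (w : Vert × Bool) =>
      (w.1, w.2 || d.2.any fun u => u.2 && Vert.forces d.1.1 d.1.2 u.1 w.1)) (by fun_prop)
    (prodMk (by fun_prop) (or (by fun_prop)
      (any (f := fun (q : ((Vert × Vert) × Marking) × (Vert × Bool)) (u : Vert × Bool) =>
        u.2 && Vert.forces q.1.1.1 q.1.1.2 u.1 q.2.1) (by fun_prop) (by fun_prop))))

theorem closureMarking :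
    CompIn (fun d : List Vert × Vert × Vert × Vert => closureMarking d.1 d.2) fun _ => 0 := by
  refine foldl (l := fun d : List Vert × Vert × Vert × Vert => d.2.1 :: d.1)
    (s := fun d m _ => _root_.growMarking d.2.1 d.2.2.1 m) (N := fun _ => 0)
    (b := fun d => d.1.map fun w => (w, w.same d.2.1 || w.same d.2.2.2))
    (R := fun d => 3 * esize d) (by fun_prop)
    (map (f := fun (d : List Vert × Vert × Vert × Vert) (w : Vert) => (w, w.same d.2.1 || w.same d.2.2.2)) (by fun_prop) (by fun_prop))
    (growMarking.comp (f := fun q : (List Vert × Vert × Vert × Vert) × Marking × Vert =>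
      ((q.1.2.1, q.1.2.2.1), q.2.1)) (by fun_prop)) ((PolyBd.const 3).mul polyBd_esize)
    (fun d l' _ => ?_) fun _ _ _ _ => Nat.zero_le _
  refine (esize_marking_le _).trans (Nat.mul_le_mul_left _ ?_)
  rw [map_fst_foldl_growMarking, List.map_map, esize_prod d]
  have : (Prod.fst ∘ fun w : Vert => (w, w.same d.2.1 || w.same d.2.2.2)) = _root_.id := rfl
  rw [this, List.map_id]
  omega

theorem candidate :
    CompIn (fun d : List Vert × Vert × Vert × Vert => candidate d.1 d.2) fun _ => 0 :=
  prodMk (map (f := fun (d : List Vert × Vert × Vert × Vert) (u : Vert × Bool) =>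
      (u.1, d.2.1.adj d.2.2.1 && u.1.adj d.2.2.1))
      (filter (f := fun _ u => u.2) closureMarking (by fun_prop)) (by fun_prop))
    (prodMk (map (f := fun _ u => u.1) (filter (f := fun _ u => !u.2) closureMarking
      (by fun_prop)) (by fun_prop)) (by fun_prop))

theorem triples : CompIn triples fun _ => 0 :=
  flatMap (f := fun (V : List Vert) a => V.flatMap fun b => V.map fun c => (a, b, c)) id
    (flatMap (f := fun (p : List Vert × Vert) b => p.1.map fun c => (p.2, b, c)) (by fun_prop)
      (map (f := fun (q : (List Vert × Vert) × Vert) c => (q.1.2, q.2, c)) (by fun_prop)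
        (by fun_prop)))

theorem better :
    CompIn (fun q : List Vert × Collapse × Vert × Vert × Vert => better q.1 q.2.1 q.2.2)
      fun _ => 0 := by
  have h : CompIn (fun q : List Vert × Collapse × Vert × Vert × Vert =>
      _root_.candidate q.1 q.2.2) fun _ => 0 :=
    candidate.comp (f := fun q : List Vert × Collapse × Vert × Vert × Vert => (q.1, q.2.2))
      (by fun_prop)
  refine ite (and (h.fst.tail.isEmpty.not.and (h.snd.fst.tail.isEmpty.not.and
    (any (f := fun (q : List Vert × Collapse × Vert × Vert × Vert) w => w.same q.2.2.2.1)
      h.snd.fst (by fun_prop)))) (h.fst.lengthLT (by fun_prop))) h (by fun_prop)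

theorem bestCollapse : CompIn bestCollapse fun _ => 0 := by
  obtain ⟨G, hG, hG'⟩ := polyBd_image triples candidate (PolyBd.const 0) fun _ _ _ => le_rfl
  have h0 : CompIn totalCollapse fun _ => 0 :=
    prodMk (map (f := fun _ v => (v, false)) id (by fun_prop)) (const _)
  refine foldl (s := _root_.better) (N := fun _ => 0)
    (R := fun V => esize (totalCollapse V) + G V) triples h0 better
    (h0.size_output.add hG) (fun V l' hl' => ?_) fun _ _ _ _ => Nat.zero_le _
  rcases foldl_better_cases V l' (totalCollapse V) with h | ⟨t, ht, h, -⟩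
  · rw [h]; exact Nat.le_add_right _ _
  · rw [h]; exact (hG' V t (hl'.subset ht)).trans (Nat.le_add_left _ _)

/-- The parameter depends on the state: only the set collapsed in this very step is treated by brute
force. It is bounded later, on the states that are reached. -/
theorem collapseStep :
    CompIn (fun q : (IntPair × ℕ) × ℕ × List Vert => collapseStep q.1 q.2)
      fun q => 3 ^ (_root_.bestCollapse q.2.2).1.length := by
  have hb : CompIn (fun q : (IntPair × ℕ) × ℕ × List Vert => _root_.bestCollapse q.2.2)
      fun q => 3 ^ (_root_.bestCollapse q.2.2).1.length :=
    bestCollapse.comp (by fun_prop)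
  refine prodMk (mul (by fun_prop) (natProd (map (f := fun (q : (IntPair × ℕ) × ℕ × List Vert) _ =>
    q.1.2) hb.fst (by fun_prop)))) (cons (prodMk (by fun_prop) (prodMk (by fun_prop) ?_))
      (by fun_prop))
  refine (collapsedLabels (α := Vert × Bool) (adj := fun u w => u.1.adj w.1)
    (s := fun u => u.2) (lab := fun u => u.1.labels) (by fun_prop) (by fun_prop)
    (by unfold Vert.labels; fun_prop)).comp_of_le (f := fun q : (IntPair × ℕ) × ℕ × List Vert =>
      (q.1, (_root_.bestCollapse q.2.2).1)) (by fun_prop) polyBd_self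

end CompIn

/-! ### Reading the input and writing the output -/

noncomputable instance : Enc EvalInstance := ⟨EvalInstance.input⟩

/-- A rational number as an integer and a denominator. -/
def ratNum (q : ℚ) : IntPair :=
  if decide (q < 0) = true then (0, q.num.natAbs) else (q.num.natAbs, 0)

open Classical in
/-- The input as a value of an encoded type. -/
noncomputable def EvalInstance.raw (x : EvalInstance) :
    ℚ × List (ℚ × ℚ × ℚ × List Bool × Unit) :=
  (x.y, List.ofFn fun v : Fin x.n => (x.G.phi v, x.G.chi v, x.G.psi v,
    List.ofFn (fun w : Fin x.n => decide (x.G.graph.Adj v w)), ()))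

/-- The vertex for a part of the input, its labels multiplied by the common denominator. -/
def readVert (i : List Unit) (r : ℚ × ℚ × ℚ × List Bool × Unit) : Vert :=
  (i, r.2.2.2.1, (ratNum r.1).times (r.2.1.den * r.2.2.1.den, 0),
    (ratNum r.2.1).times (r.1.den * r.2.2.1.den, 0),
    (ratNum r.2.2.1).times (r.1.den * r.2.1.den, 0))

/-- The list of all vertices, in reverse order. -/
def readVerts (l : List (ℚ × ℚ × ℚ × List Bool × Unit)) : List Unit × List Vert :=
  l.foldl (fun acc r => (() :: acc.1, readVert acc.1 r :: acc.2)) ([], [])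

/-- The initial state of the main loop. -/
def initialState (l : List (ℚ × ℚ × ℚ × List Bool × Unit)) : ℕ × List Vert :=
  ((l.map fun r => r.1.den * (r.2.1.den * r.2.2.1.den)).prod, (readVerts l).2)

/-- The argument of the polynomial, as a fraction. -/
noncomputable def EvalInstance.point (x : EvalInstance) : IntPair × ℕ :=
  (ratNum x.raw.1, x.raw.1.den)

/-- The final state of the main loop. -/
noncomputable def EvalInstance.finalState (x : EvalInstance) : ℕ × List Vert :=
  (collapseStep x.point)^[(initialState x.raw.2).2.length + 1] (initialState x.raw.2)

/-! ### Running time of the input stage and of the main loop -/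

namespace CompIn

variable {α β γ δ : Type} [Enc α] [Enc β] [Enc γ] [Enc δ] {M : δ → ℕ}

theorem ratCode {q : δ → ℚ} (hq : CompIn q M) :
    CompIn (fun d => (decide (q d < 0), (q d).num.natAbs, (q d).den)) M :=
  hq.of_enc_eq fun _ => rfl

@[fun_prop]
theorem den {q : δ → ℚ} (hq : CompIn q M) : CompIn (fun d => (q d).den) M := hq.ratCode.snd.snd

@[fun_prop]
theorem ratNum {q : δ → ℚ} (hq : CompIn q M) : CompIn (fun d => ratNum (q d)) M :=
  hq.ratCode.fst.ite ((const 0).prodMk hq.ratCode.snd.fst) (hq.ratCode.snd.fst.prodMk (const 0))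

theorem raw : CompIn EvalInstance.raw fun _ => 0 := by
  refine (id (δ := EvalInstance)).of_enc_eq fun x => ?_
  simp only [enc, EvalInstance.raw, EvalInstance.input, List.map_ofFn, Function.comp_def]
  rfl

theorem readVert : CompIn (fun d : List Unit × ℚ × ℚ × ℚ × List Bool × Unit => readVert d.1 d.2)
    fun _ => 0 := by
  unfold _root_.readVert; fun_prop

theorem readVerts : CompIn readVerts fun _ => 0 := by
  obtain ⟨c, hc⟩ := readVert.size_output
  refine foldl (N := fun _ => 0) (s := fun _ acc r => (() :: acc.1, _root_.readVert acc.1 r :: acc.2))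
    (R := fun l => 2 * (esize l + 1) + esize l * (2 * (esize l + 1) + 2) ^ c) id (const _)
    (prodMk (by fun_prop) (cons (readVert.comp (f := fun q :
      List (ℚ × ℚ × ℚ × List Bool × Unit) × (List Unit × List Vert) ×
        (ℚ × ℚ × ℚ × List Bool × Unit) => (q.2.1.1, q.2.2)) (by fun_prop)) (by fun_prop)))
    (((PolyBd.const 2).mul (polyBd_esize.add (PolyBd.const 1))).add (polyBd_esize.mul
      ((((PolyBd.const 2).mul (polyBd_esize.add (PolyBd.const 1))).add (PolyBd.const 2)).pow c)))
    (fun l l' hl' => ?_) fun _ _ _ _ => Nat.zero_le _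
  have key : ∀ l', l' <+: l → esize (l'.foldl (fun acc r => (() :: acc.1,
      _root_.readVert acc.1 r :: acc.2)) (([], []) : List Unit × List Vert)).1 = l'.length + 1 ∧
      esize (l'.foldl (fun acc r => (() :: acc.1,
      _root_.readVert acc.1 r :: acc.2)) (([], []) : List Unit × List Vert)).2 ≤
        1 + l'.length * (2 * (esize l + 1) + 2) ^ c := by
    intro l'
    induction l' using List.reverseRecOn with
    | nil => simp
    | append_singleton l' r ih =>
      intro h
      obtain ⟨h1, h2⟩ := ih ((List.prefix_append _ _).trans h)
      have h3 := esize_le_of_mem (h.subset (by simp : r ∈ l' ++ [r]))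
      have h4 := (h.length_le).trans (length_lt_esize l).le
      rw [List.length_append, List.length_singleton] at h4
      rw [List.foldl_append, List.foldl_cons, List.foldl_nil, List.length_append,
        List.length_singleton]
      generalize l'.foldl _ _ = acc at *
      have h5 : esize () = 1 := rfl
      refine ⟨by rw [esize_cons, h1, h5]; omega, ?_⟩
      have h6 := hc (acc.1, r)
      have h7 : (esize (acc.1, r) + 0 + 2) ^ c ≤ (2 * (esize l + 1) + 2) ^ c :=
        Nat.pow_le_pow_left (by rw [esize_mk]; omega) c
      rw [esize_cons, add_mul]
      simp only at h6
      omega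
  obtain ⟨h1, h2⟩ := key l' hl'
  have h3 : l'.length ≤ esize l := hl'.length_le.trans (length_lt_esize l).le
  have h4 := Nat.mul_le_mul_right ((2 * (esize l + 1) + 2) ^ c) h3
  rw [esize_prod]
  omega

theorem initialState : CompIn initialState fun _ => 0 :=
  prodMk (natProd (map (f := fun _ (r : ℚ × ℚ × ℚ × List Bool × Unit) =>
    r.1.den * (r.2.1.den * r.2.2.1.den)) id (by fun_prop))) readVerts.snd

/-- Iteration of a step whose cost is only bounded on the states that are reached. -/
theorem iterateStep {step : γ → β → β} {N : γ × β → ℕ} {y : δ → γ} {b : δ → β}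
    {l : δ → List α} (hstep : CompIn (fun q : γ × β => step q.1 q.2) N) (hy : CompIn y M)
    (hb : CompIn b M) (hl : CompIn l M) {R : δ → ℕ} (hR : PolyBd (fun d => esize d + M d) R)
    (hacc : ∀ d k, k ≤ (l d).length → esize ((step (y d))^[k] (b d)) ≤ R d)
    (hN : ∀ d k, k < (l d).length → N (y d, (step (y d))^[k] (b d)) ≤ R d) :
    CompIn (fun d => (step (y d))^[(l d).length] (b d)) M := by
  have key : ∀ d (l : List α) st, l.foldl (fun st _ => step (y d) st) st =
      (step (y d))^[l.length] st := fun d l => by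
    induction l with
    | nil => intro st; rfl
    | cons a l ih => intro st; rw [List.foldl_cons, ih]; rfl
  have h := foldl (s := fun d st (_ : α) => step (y d) st)
    (N := fun q => N (y q.1, q.2.1) + M q.1) (R := fun d => R d + M d) hl hb
    (hstep.comp_of_le (f := fun q : δ × β × α => (y q.1, q.2.1))
      (prodMk (hy.comp_of_le (f := fun q : δ × β × α => q.1) (by fun_prop)
        (PolyBd.of_le fun q => by omega)) (by fun_prop)) (PolyBd.of_le fun q => by omega))
    (hR.add polyBd_self)
    (fun d l' h => by
      rw [key]; exact (hacc d _ h.length_le).trans (Nat.le_add_right _ _))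
    fun d l' a h => by
      have h1 := h.length_le
      rw [List.length_append, List.length_singleton] at h1
      rw [key]
      have := hN d l'.length (by omega)
      simp only
      omega
  simpa only [key] using h

theorem finalState {K R : EvalInstance → ℕ} (hR : PolyBd (fun x => esize x + K x) R)
    (hacc : ∀ x k, k ≤ (_root_.initialState x.raw.2).2.length + 1 →
      esize ((_root_.collapseStep x.point)^[k] (_root_.initialState x.raw.2)) ≤ R x)
    (hK : ∀ x k, k ≤ (_root_.initialState x.raw.2).2.length →
      3 ^ (_root_.bestCollapse ((_root_.collapseStep x.point)^[k]
        (_root_.initialState x.raw.2)).2).1.length ≤ R x) :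
    CompIn EvalInstance.finalState K := by
  have hraw : CompIn EvalInstance.raw K := raw.mono (PolyBd.const 0)
  have hinit : CompIn (fun x : EvalInstance => _root_.initialState x.raw.2) K :=
    initialState.comp hraw.snd
  have hy : CompIn EvalInstance.point K := (ratNum hraw.fst).prodMk (den hraw.fst)
  -- The vertex list with a dummy entry in front serves as a clock for one more round than there are
  -- vertices.
  have h := iterateStep (l := fun x : EvalInstance => (([], [], (0, 0), (0, 0), (0, 0)) : Vert) ::
      (_root_.initialState x.raw.2).2) collapseStep hy hinit (cons (const _) hinit.snd) hR hacc
      fun x k hk => hK x k (Nat.lt_succ_iff.1 hk)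
  exact h

end CompIn

/-! ### Symmetric linear systems over `GF(2)` -/

section Linear

open Matrix

variable {ι : Type*} [Fintype ι] [DecidableEq ι] {M : Matrix ι ι (ZMod 2)} {s : ι → ZMod 2}

/-- The range of the transpose is the annihilator of the kernel, and `M` is its own transpose. -/
theorem exists_mulVec_eq_of_forall_ker (hM : M.IsSymm) (h : ∀ x, M *ᵥ x = 0 → s ⬝ᵥ x = 0) :
    ∃ x, M *ᵥ x = s := by
  have h1 : dotProductEquiv (ZMod 2) ι s ∈ LinearMap.range M.mulVecLin.dualMap := by
    rw [LinearMap.range_dualMap_eq_dualAnnihilator_ker, Submodule.mem_dualAnnihilator]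
    exact fun x hx => h x hx
  obtain ⟨ψ, hψ⟩ := h1
  obtain ⟨x, rfl⟩ := (dotProductEquiv (ZMod 2) ι).surjective ψ
  refine ⟨x, ?_⟩
  rw [← hM.eq, mulVec_transpose]
  apply (dotProductEquiv (ZMod 2) ι).injective
  refine LinearMap.ext fun v => ?_
  have := LinearMap.congr_fun hψ v
  simpa [dotProduct_mulVec] using this

/-- The number of solutions of `M x = e s` with `s ⬝ x = b`. -/
def solutionCount (M : Matrix ι ι (ZMod 2)) (s : ι → ZMod 2) (e b : ZMod 2) : ℕ :=
  Fintype.card {x : ι → ZMod 2 // M *ᵥ x = e • s ∧ s ⬝ᵥ x = b}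

/-- The number of elements of the kernel of `M`. -/
def kernelCard (M : Matrix ι ι (ZMod 2)) : ℕ := Fintype.card {x : ι → ZMod 2 // M *ᵥ x = 0}

omit [DecidableEq ι] in
theorem dotProduct_ker_eq_zero (hM : M.IsSymm) {x k : ι → ZMod 2} (hx : M *ᵥ x = s)
    (hk : M *ᵥ k = 0) : s ⬝ᵥ k = 0 := by
  rw [← hx, ← hM.eq, mulVec_transpose, ← dotProduct_mulVec, hk, dotProduct_zero]

/-- The kernel is orthogonal to `s = M x₀`, and the solutions of `M x = s` form the coset of the
kernel through `x₀`; hence `s ⬝ x` is constant on each of the two solution sets. -/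
theorem solutionCount_of_solvable (hM : M.IsSymm) {x₀ : ι → ZMod 2} (hx : M *ᵥ x₀ = s) :
    solutionCount M s 0 0 = kernelCard M ∧ solutionCount M s 0 1 = 0 ∧
      solutionCount M s 1 (s ⬝ᵥ x₀) = kernelCard M ∧
      solutionCount M s 1 (s ⬝ᵥ x₀ + 1) = 0 := by
  have h0 : ∀ x, M *ᵥ x = s → s ⬝ᵥ x = s ⬝ᵥ x₀ := fun x h => by
    have := dotProduct_ker_eq_zero hM hx (k := x - x₀) (by rw [mulVec_sub, h, hx, sub_self])
    rw [dotProduct_sub] at this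
    exact sub_eq_zero.1 this
  refine ⟨?_, ?_, ?_, ?_⟩
  · refine Fintype.card_congr (Equiv.subtypeEquivRight fun x => ?_)
    rw [zero_smul]
    exact ⟨fun h => h.1, fun h => ⟨h, dotProduct_ker_eq_zero hM hx h⟩⟩
  · refine Fintype.card_eq_zero_iff.2 ⟨fun x => ?_⟩
    obtain ⟨x, h, h'⟩ := x
    rw [dotProduct_ker_eq_zero hM hx (by simpa using h)] at h'
    exact zero_ne_one h'
  · refine Fintype.card_congr ((Equiv.addRight (-x₀)).subtypeEquiv fun x => ?_)
    rw [one_smul, Equiv.coe_addRight, mulVec_add, mulVec_neg, hx]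
    constructor
    · rintro ⟨h, -⟩; rw [h, add_neg_cancel]
    · intro h
      have h' : M *ᵥ x = s := by rw [← sub_eq_add_neg] at h; exact sub_eq_zero.1 h
      exact ⟨h', h0 x h'⟩
  · refine Fintype.card_eq_zero_iff.2 ⟨fun x => ?_⟩
    obtain ⟨x, h, h1⟩ := x
    rw [h0 _ (by rwa [one_smul] at h)] at h1
    exact one_ne_zero (left_eq_add.1 h1)

theorem zmod_two_cases (b : ZMod 2) : b = 0 ∨ b = 1 := by
  fin_cases b
  · exact Or.inl rfl
  · exact Or.inr rfl

/-- By duality some kernel vector `k` has `s ⬝ k = 1`, and translation by `k` exchanges the two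
halves of the kernel. -/
theorem solutionCount_of_not_solvable (hM : M.IsSymm) (h : ¬ ∃ x, M *ᵥ x = s) :
    2 * solutionCount M s 0 0 = kernelCard M ∧ solutionCount M s 0 1 = solutionCount M s 0 0 := by
  obtain ⟨k, hk, hk'⟩ : ∃ k, M *ᵥ k = 0 ∧ s ⬝ᵥ k = 1 := by
    by_contra hc
    refine h (exists_mulVec_eq_of_forall_ker hM fun x hx => ?_)
    exact (zmod_two_cases _).resolve_right fun h1 => hc ⟨x, hx, h1⟩
  have h1 : solutionCount M s 0 1 = solutionCount M s 0 0 := by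
    refine Fintype.card_congr ((Equiv.addRight k).subtypeEquiv fun x => ?_)
    rw [Equiv.coe_addRight, mulVec_add, hk, add_zero, dotProduct_add, hk']
    have : ∀ b : ZMod 2, b = 1 ↔ b + 1 = 0 := by decide
    rw [this]
  refine ⟨?_, h1⟩
  have h2 : kernelCard M = solutionCount M s 0 0 + solutionCount M s 0 1 := by
    rw [kernelCard, solutionCount, solutionCount, ← Fintype.card_subtype_or_disjoint]
    · refine Fintype.card_congr (Equiv.subtypeEquivRight fun x => ?_)
      rw [zero_smul]
      have := zmod_two_cases (s ⬝ᵥ x)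
      tauto
    · rw [Pi.disjoint_iff]
      intro x
      rw [Prop.disjoint_iff]
      rintro ⟨⟨-, h1⟩, -, h2⟩
      rw [h1] at h2
      exact zero_ne_one h2
  rw [h2, h1, two_mul]

theorem solutionCount_one_ne_zero_iff (b : ZMod 2) :
    solutionCount M s 1 b ≠ 0 ↔ ∃ x, M *ᵥ x = s ∧ s ⬝ᵥ x = b := by
  rw [solutionCount, ← Nat.pos_iff_ne_zero, Fintype.card_pos_iff, nonempty_subtype]
  simp only [one_smul]

theorem kernelCard_eq_two_pow (M : Matrix ι ι (ZMod 2)) :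
    kernelCard M = 2 ^ Module.finrank (ZMod 2) (LinearMap.ker M.mulVecLin) := by
  have := Fintype.ofFinite (LinearMap.ker M.mulVecLin)
  have h := Module.card_eq_pow_finrank (K := ZMod 2) (V := LinearMap.ker M.mulVecLin)
  rw [ZMod.card] at h
  rw [← h]
  exact Fintype.card_congr (Equiv.subtypeEquivRight fun x => by simp [LinearMap.mem_ker])

end Linear

/-! ### Sums over choices -/

section ChoiceSum

variable {α β γ R : Type} [AddCommMonoid R]

/-- The sum of `F` over all choices. -/
def choiceSum (o : α → List β) (l : List α) (F : List β → R) : R := ((choices o l).map F).sum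

@[simp] theorem choiceSum_nil (o : α → List β) (F : List β → R) : choiceSum o [] F = F [] := by
  simp [choiceSum]

theorem choiceSum_zero (o : α → List β) (l : List α) : choiceSum o l (fun _ => (0 : R)) = 0 := by
  simp [choiceSum]

theorem choiceSum_add (o : α → List β) (l : List α) (F G : List β → R) :
    choiceSum o l (fun s => F s + G s) = choiceSum o l F + choiceSum o l G := by
  simp only [choiceSum]
  induction choices o l with
  | nil => simp
  | cons s L ih => simp only [List.map_cons, List.sum_cons, ih]; abel

theorem choiceSum_congr {o : α → List β} {l : List α} {F G : List β → R}
    (h : ∀ s ∈ choices o l, F s = G s) : choiceSum o l F = choiceSum o l G := by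
  rw [choiceSum, choiceSum, List.map_congr_left h]

theorem choiceSum_list_sum (o : α → List β) (l : List α) (L : List γ) (F : γ → List β → R) :
    choiceSum o l (fun s => (L.map fun c => F c s).sum) =
      (L.map fun c => choiceSum o l (F c)).sum := by
  induction L with
  | nil => simp [choiceSum_zero]
  | cons c L ih => simp only [List.map_cons, List.sum_cons, choiceSum_add, ih]

theorem choiceSum_cons (o : α → List β) (a : α) (l : List α) (F : List β → R) :
    choiceSum o (a :: l) F = ((o a).map fun b => choiceSum o l fun s => F (b :: s)).sum := by
  rw [← choiceSum_list_sum, choiceSum, choices_cons, choiceSum]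
  induction choices o l with
  | nil => rfl
  | cons s L ih =>
    rw [List.flatMap_cons, List.map_append, List.sum_append, ih, List.map_cons, List.sum_cons,
      List.map_map]
    rfl

theorem choiceSum_append (o : α → List β) (l l' : List α) (F : List β → R) :
    choiceSum o (l ++ l') F =
      choiceSum o l fun s => choiceSum o l' fun s' => F (s ++ s') := by
  induction l generalizing F with
  | nil => simp
  | cons a l ih => simp only [List.cons_append, choiceSum_cons, ih]

/-- A collapse reorders the vertices. Exchanging two neighbouring entries exchanges two finite sums,
and these exchanges generate all permutations. -/
theorem choiceSum_perm {o : α → List β} {l l' : List α} (h : l.Perm l') {F : List β → R}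
    (hF : ∀ s s', s.Perm s' → F s = F s') : choiceSum o l F = choiceSum o l' F := by
  induction h generalizing F with
  | nil => rfl
  | cons a _ ih =>
    simp only [choiceSum_cons]
    congr 1
    exact List.map_congr_left fun b _ => ih fun s s' h => hF _ _ (h.cons b)
  | swap a b l =>
    simp only [choiceSum_cons]
    have key : ∀ (L : List β) (L' : List β) (G : β → β → R),
        (L.map fun c => (L'.map fun d => G c d).sum).sum =
          (L'.map fun d => (L.map fun c => G c d).sum).sum := by
      intro L L' G
      induction L with
      | nil => simp
      | cons c L ih => simp [ih, List.sum_map_add]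
    rw [key]
    congr 1
    refine List.map_congr_left fun c _ => ?_
    congr 1
    exact List.map_congr_left fun d _ =>
      choiceSum_congr fun s _ => hF _ _ (List.Perm.swap _ _ _)
  | trans _ _ ih1 ih2 => rw [ih1 hF, ih2 hF]

theorem choiceSum_map {α' β' : Type} {o : α → List β} {o' : α' → List β'} {f : α' → α}
    {g : β' → β} (ho : ∀ a, o (f a) = (o' a).map g) (l : List α') (F : List β → R) :
    choiceSum o (l.map f) F = choiceSum o' l fun s => F (s.map g) := by
  induction l generalizing F with
  | nil => simp
  | cons a l ih =>
    simp only [List.map_cons, choiceSum_cons, ho, ih, List.map_map]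
    rfl

end ChoiceSum

theorem choiceSum_mul_left {α β R : Type} [Semiring R] (o : α → List β) (l : List α) (c : R)
    (F : List β → R) : choiceSum o l (fun s => c * F s) = c * choiceSum o l F := by
  rw [choiceSum, choiceSum, List.sum_map_mul_left]

theorem choiceSum_mul_right {α β R : Type} [Semiring R] (o : α → List β) (l : List α) (c : R)
    (F : List β → R) : choiceSum o l (fun s => F s * c) = choiceSum o l F * c := by
  rw [choiceSum, choiceSum, List.sum_map_mul_right]

theorem mem_choices_map_eq {α β : Type} {o : α → List β} {g : β → α} (ho : ∀ a, ∀ b ∈ o a, g b = a)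
    {l : List α} {s : List β} (h : s ∈ choices o l) : s.map g = l := by
  induction l generalizing s with
  | nil => simp at h; simp [h]
  | cons a l ih =>
    rw [choices_cons, List.mem_flatMap] at h
    obtain ⟨t, ht, h⟩ := h
    obtain ⟨b, hb, rfl⟩ := List.mem_map.1 h
    rw [List.map_cons, ho a b hb, ih ht]

/-! ### Solutions as lists and as vectors -/

/-- The element of `GF(2)` for a truth value. -/
def boolZ (b : Bool) : ZMod 2 := if b then 1 else 0

@[simp] theorem boolZ_true : boolZ true = 1 := rfl

@[simp] theorem boolZ_false : boolZ false = 0 := rfl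

theorem boolZ_xor (a b : Bool) : boolZ (a ^^ b) = boolZ a + boolZ b := by
  cases a <;> cases b <;> decide

theorem boolZ_and (a b : Bool) : boolZ (a && b) = boolZ a * boolZ b := by
  cases a <;> cases b <;> decide

theorem boolZ_inj {a b : Bool} : boolZ a = boolZ b ↔ a = b := by
  cases a <;> cases b <;> decide

theorem boolZ_decide (x : ZMod 2) : boolZ (decide (x = 1)) = x := by revert x; decide

section Bridge

open Matrix

variable {α : Type} {R : Type} [AddCommMonoid R] {m : ℕ} (adj : α → α → Bool) (s : α → Bool)

/-- The list form of a vector over `GF(2)`. -/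
def vecList (p : Fin m → α × PartClass) (x : Fin m → ZMod 2) : List ((α × PartClass) × Bool) :=
  List.ofFn fun i => (p i, decide (x i = 1))

/-- A deleted vertex offers only the entry zero, so the listed vectors are exactly those that vanish
on the deleted vertices. -/
theorem choiceSum_entries_ofFn (p : Fin m → α × PartClass)
    (F : List ((α × PartClass) × Bool) → R) :
    choiceSum entries (List.ofFn p) F =
      ∑ x : Fin m → ZMod 2, if ∀ i, (p i).2.kept = false → x i = 0 then F (vecList p x) else 0 := by
  induction m generalizing F with
  | zero => simp [vecList]
  | succ m ih =>
    rw [List.ofFn_succ, choiceSum_cons,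
      ← (Fin.consEquiv fun _ : Fin (m + 1) => ZMod 2).sum_comp, Fintype.sum_prod_type]
    have hv : ∀ (c : ZMod 2) x, vecList p (Fin.cons c x) =
        (p 0, decide (c = 1)) :: vecList (fun i => p i.succ) x := fun c x => by
      simp [vecList, List.ofFn_succ]
    have h2 : ∀ f : ZMod 2 → R, ∑ c, f c = f 0 + f 1 := fun f => Fin.sum_univ_two f
    rw [h2]
    simp only [Fin.consEquiv, Equiv.coe_fn_mk, hv, Fin.forall_fin_succ, Fin.cons_zero, Fin.cons_succ,
      ih]
    by_cases hk : (p 0).2.kept = true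
    · simp [entries, hk]
    · rw [Bool.not_eq_true] at hk
      simp [entries, hk]

theorem boolZ_parity (x : List ((α × PartClass) × Bool)) :
    boolZ (parity s x) = (x.map fun p => boolZ p.2 * boolZ (s p.1.1)).sum := by
  induction x with
  | nil => rfl
  | cons p x ih => rw [List.map_cons, List.sum_cons, ← ih, ← boolZ_and, ← boolZ_xor]; rfl

theorem boolZ_parity_vecList (p : Fin m → α × PartClass) (x : Fin m → ZMod 2) :
    boolZ (parity s (vecList p x)) = ∑ i, x i * boolZ (s (p i).1) := by
  rw [boolZ_parity, vecList, List.map_ofFn, List.sum_ofFn]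
  simp [boolZ_decide]

/-- The adjacency matrix, with unit rows and columns for the deleted vertices. -/
def fullMatrix (p : Fin m → α × PartClass) : Matrix (Fin m) (Fin m) (ZMod 2) := fun i j =>
  if (p i).2.kept = true ∧ (p j).2.kept = true then
    boolZ (adj (p i).1 (p j).1) + if i = j then boolZ (p i).2.looped else 0
  else if i = j then 1 else 0

/-- The vector for `s`, which vanishes on the deleted vertices. -/
def fullVector (p : Fin m → α × PartClass) : Fin m → ZMod 2 := fun i =>
  if (p i).2.kept = true then boolZ (s (p i).1) else 0

variable {adj} in
theorem isSymm_fullMatrix {p : Fin m → α × PartClass}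
    (h : ∀ i j, adj (p i).1 (p j).1 = adj (p j).1 (p i).1) : (fullMatrix adj p).IsSymm := by
  ext i j
  simp only [transpose_apply, fullMatrix]
  by_cases hij : i = j
  · rw [hij]
  · rw [if_neg hij, if_neg hij, if_neg (Ne.symm hij), if_neg (Ne.symm hij), h j i]
    simp only [and_comm]

theorem fullMatrix_mulVec_of_deleted {p : Fin m → α × PartClass} {i : Fin m}
    (hi : (p i).2.kept = false) (x : Fin m → ZMod 2) : (fullMatrix adj p *ᵥ x) i = x i := by
  simp [mulVec, dotProduct, fullMatrix, hi]

theorem fullMatrix_mulVec_of_kept {p : Fin m → α × PartClass} {i : Fin m}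
    (hi : (p i).2.kept = true) {x : Fin m → ZMod 2} (hx : ∀ i, (p i).2.kept = false → x i = 0) :
    (fullMatrix adj p *ᵥ x) i =
      ∑ j, x j * boolZ (adj (p i).1 (p j).1) + x i * boolZ (p i).2.looped := by
  have : ∀ j, fullMatrix adj p i j * x j =
      x j * boolZ (adj (p i).1 (p j).1) + if i = j then x i * boolZ (p i).2.looped else 0 := by
    intro j
    unfold fullMatrix
    by_cases hj : (p j).2.kept = true
    · rw [if_pos ⟨hi, hj⟩]
      by_cases hij : i = j
      · subst hij; simp; ring
      · simp [hij, mul_comm]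
    · have hij : i ≠ j := by rintro rfl; exact hj hi
      rw [Bool.not_eq_true] at hj
      simp [hij, hx j hj]
  simp only [mulVec, dotProduct, this, Finset.sum_add_distrib, Finset.sum_ite_eq,
    Finset.mem_univ, if_true]

/-- The unit rows turn "vanishes on the deleted vertices" into equations of the system. This keeps
the index type `Fin m` for all partitions, and the matrix stays symmetric when `adj` is. -/
theorem fullMatrix_mulVec_eq_iff (p : Fin m → α × PartClass) (e : Bool) (x : Fin m → ZMod 2) :
    fullMatrix adj p *ᵥ x = boolZ e • fullVector s p ↔
      (∀ i, (p i).2.kept = false → x i = 0) ∧ solves adj s e (vecList p x) = true := by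
  have hsolve : solves adj s e (vecList p x) = true ↔ ∀ i, (p i).2.kept = true →
      ∑ j, x j * boolZ (adj (p i).1 (p j).1) + x i * boolZ (p i).2.looped =
        boolZ e * boolZ (s (p i).1) := by
    rw [solves, List.all_eq_true]
    conv_lhs => rw [vecList]
    rw [List.forall_mem_ofFn_iff]
    refine forall_congr' fun i => ?_
    rw [Bool.or_eq_true, beq_iff_eq, ← boolZ_inj (a := _ ^^ _), boolZ_xor, ← vecList, boolZ_parity_vecList,
      boolZ_and, boolZ_and, boolZ_decide]
    cases (p i).2.kept <;> simp
  rw [hsolve]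
  constructor
  · intro h
    have h0 : ∀ i, (p i).2.kept = false → x i = 0 := fun i hi => by
      have := congrFun h i
      rw [fullMatrix_mulVec_of_deleted adj hi] at this
      simpa [fullVector, hi] using this
    refine ⟨h0, fun i hi => ?_⟩
    rw [← fullMatrix_mulVec_of_kept adj hi h0, h]
    simp [fullVector, hi]
  · rintro ⟨h0, h1⟩
    funext i
    by_cases hi : (p i).2.kept = true
    · rw [fullMatrix_mulVec_of_kept adj hi h0, h1 i hi]
      simp [fullVector, hi]
    · rw [Bool.not_eq_true] at hi
      rw [fullMatrix_mulVec_of_deleted adj hi, h0 i hi]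
      simp [fullVector, hi]

theorem dotProduct_fullVector {p : Fin m → α × PartClass} {x : Fin m → ZMod 2}
    (hx : ∀ i, (p i).2.kept = false → x i = 0) :
    fullVector s p ⬝ᵥ x = boolZ (parity s (vecList p x)) := by
  rw [boolZ_parity_vecList, dotProduct]
  refine Finset.sum_congr rfl fun i _ => ?_
  unfold fullVector
  by_cases hi : (p i).2.kept = true
  · rw [if_pos hi, mul_comm]
  · rw [Bool.not_eq_true] at hi
    simp [hx i hi]

end Bridge

/-! ### The table of solution numbers of a vertex set -/

section Table

variable {α : Type} (adj : α → α → Bool) (s : α → Bool)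

/-- The number of solutions of `M x = e s` with `s ⬝ x = b`. -/
def solCount (e b : Bool) (P : List (α × PartClass)) : ℕ :=
  choiceSum entries P fun x => if solves adj s e x = true ∧ parity s x = b then 1 else 0

/-- The number of solutions of `M x = 0`. -/
def kerCount (P : List (α × PartClass)) : ℕ :=
  choiceSum entries P fun x => if solves adj s false x = true then 1 else 0

theorem solCount_ofFn {m : ℕ} (p : Fin m → α × PartClass) (e b : Bool) :
    solCount adj s e b (List.ofFn p) =
      solutionCount (fullMatrix adj p) (fullVector s p) (boolZ e) (boolZ b) := by
  rw [solCount, choiceSum_entries_ofFn, solutionCount, Fintype.card_subtype, Finset.card_filter]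
  refine Finset.sum_congr rfl fun x _ => ?_
  rw [← ite_and]
  refine if_congr ?_ rfl rfl
  rw [fullMatrix_mulVec_eq_iff]
  constructor
  · rintro ⟨h1, h2, h3⟩
    exact ⟨⟨h1, h2⟩, by rw [dotProduct_fullVector s h1, h3]⟩
  · rintro ⟨⟨h1, h2⟩, h3⟩
    rw [dotProduct_fullVector s h1, boolZ_inj] at h3
    exact ⟨h1, h2, h3⟩

theorem kerCount_ofFn {m : ℕ} (p : Fin m → α × PartClass) :
    kerCount adj s (List.ofFn p) = kernelCard (fullMatrix adj p) := by
  rw [kerCount, choiceSum_entries_ofFn, kernelCard, Fintype.card_subtype, Finset.card_filter]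
  refine Finset.sum_congr rfl fun x _ => ?_
  rw [← ite_and]
  refine if_congr ?_ rfl rfl
  rw [← fullMatrix_mulVec_eq_iff, boolZ_false, zero_smul]

theorem kerCount_eq_two_pow (P : List (α × PartClass)) : ∃ k, kerCount adj s P = 2 ^ k := by
  rw [← List.ofFn_get P, kerCount_ofFn]
  exact ⟨_, kernelCard_eq_two_pow _⟩

/-- The three types of a system with its right-hand side: they behave like a single vertex that is
deleted, looped, or neither. -/
theorem solCount_trichotomy {adj : α → α → Bool} (s : α → Bool) {P : List (α × PartClass)}
    (h : ∀ p ∈ P, ∀ q ∈ P, adj p.1 q.1 = adj q.1 p.1) :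
    (solCount adj s true false P ≠ 0 → solCount adj s false false P = kerCount adj s P ∧
      solCount adj s false true P = 0 ∧ solCount adj s true false P = kerCount adj s P ∧
      solCount adj s true true P = 0) ∧
    (solCount adj s true true P ≠ 0 → solCount adj s false false P = kerCount adj s P ∧
      solCount adj s false true P = 0 ∧ solCount adj s true false P = 0 ∧
      solCount adj s true true P = kerCount adj s P) ∧
    (solCount adj s true false P = 0 → solCount adj s true true P = 0 →
      2 * solCount adj s false false P = kerCount adj s P ∧
      solCount adj s false true P = solCount adj s false false P) := by
  rw [← List.ofFn_get P] at h ⊢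
  have hM := isSymm_fullMatrix (adj := adj) (p := P.get) fun i j =>
    h _ ((List.mem_ofFn' _ _).2 ⟨i, rfl⟩) _ ((List.mem_ofFn' _ _).2 ⟨j, rfl⟩)
  simp only [solCount_ofFn, kerCount_ofFn, boolZ_true, boolZ_false]
  refine ⟨fun h => ?_, fun h => ?_, fun h1 h2 => ?_⟩
  · obtain ⟨x, hx, hx'⟩ := (solutionCount_one_ne_zero_iff _).1 h
    have := solutionCount_of_solvable hM hx
    rwa [hx', zero_add] at this
  · obtain ⟨x, hx, hx'⟩ := (solutionCount_one_ne_zero_iff _).1 h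
    obtain ⟨g1, g2, g3, g4⟩ := solutionCount_of_solvable hM hx
    rw [hx'] at g3 g4
    exact ⟨g1, g2, g4, g3⟩
  · refine solutionCount_of_not_solvable hM ?_
    rintro ⟨x, hx⟩
    rcases zmod_two_cases (fullVector s P.get ⬝ᵥ x) with hb | hb
    · exact (solutionCount_one_ne_zero_iff _).2 ⟨x, hx, hb⟩ h1
    · exact (solutionCount_one_ne_zero_iff _).2 ⟨x, hx, hb⟩ h2

end Table

/-! ### Correctness of a collapse -/

section Contraction

variable {α : Type} {adj : α → α → Bool} {s t : α → Bool}

theorem map_fst_of_mem_choices_entries {P : List (α × PartClass)}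
    {x : List ((α × PartClass) × Bool)} (h : x ∈ choices entries P) : x.map Prod.fst = P :=
  mem_choices_map_eq (fun a b hb => by
    unfold entries at hb
    split_ifs at hb
    · rcases List.mem_pair.1 hb with rfl | rfl <;> rfl
    · rw [List.mem_singleton.1 hb]) h

theorem map_fst_of_mem_choices_classes {A : List α} {P : List (α × PartClass)}
    (h : P ∈ choices classes A) : P.map Prod.fst = A :=
  mem_choices_map_eq (fun a b hb => by
    simp only [classes, List.mem_cons, List.not_mem_nil, or_false] at hb
    rcases hb with rfl | rfl | rfl <;> rfl) h

theorem parity_append (x z : List ((α × PartClass) × Bool)) :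
    parity s (x ++ z) = (parity s x ^^ parity s z) := by
  rw [← boolZ_inj, boolZ_xor, boolZ_parity, boolZ_parity, boolZ_parity, List.map_append,
    List.sum_append]

theorem parity_congr_and {c : Bool} {z : List ((α × PartClass) × Bool)}
    (h : ∀ q ∈ z, s q.1.1 = (c && t q.1.1)) : parity s z = (c && parity t z) := by
  rw [← boolZ_inj, boolZ_and, boolZ_parity, boolZ_parity, ← List.sum_map_mul_left]
  congr 1
  refine List.map_congr_left fun q hq => ?_
  rw [h q hq, boolZ_and]
  ring

theorem all_congr_mem {β : Type} {l : List β} {f g : β → Bool} (h : ∀ x ∈ l, f x = g x) :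
    l.all f = l.all g := by
  rw [Bool.eq_iff_iff, List.all_eq_true, List.all_eq_true]
  exact forall₂_congr fun x hx => by rw [h x hx]

/-- The off-diagonal block is the rank-one matrix of `s` and `t`. A row of `A` sees `z` only through
`t ⬝ z`, and over `GF(2)` this term moves to the right-hand side without a change of sign. -/
theorem solves_append {A B : List (α × PartClass)} (s' : α → Bool)
    (h : ∀ p ∈ A, ∀ q ∈ B, adj p.1 q.1 = (s p.1 && t q.1) ∧ adj q.1 p.1 = (s p.1 && t q.1))
    {x z : List ((α × PartClass) × Bool)} (hx : x.map Prod.fst = A) (hz : z.map Prod.fst = B) :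
    solves adj s' false (x ++ z) =
      (solves adj s (parity t z) x && solves adj t (parity s x) z) := by
  subst hx hz
  simp only [List.mem_map, forall_exists_index, and_imp, forall_apply_eq_imp_iff₂] at h
  have h1 : ∀ p ∈ x, parity (adj p.1.1) (x ++ z) =
      (parity (adj p.1.1) x ^^ (s p.1.1 && parity t z)) := fun p hp => by
    rw [parity_append, parity_congr_and fun q hq => (h p hp q hq).1]
  have h2 : ∀ q ∈ z, parity (adj q.1.1) (x ++ z) =
      (parity (adj q.1.1) z ^^ (t q.1.1 && parity s x)) := fun q hq => by
    rw [parity_append, parity_congr_and fun p hp => ((h p hp q hq).2.trans (Bool.and_comm _ _)),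
      Bool.xor_comm]
  have h3 : ∀ k a b l c : Bool, (!k || ((a ^^ (b && c)) ^^ l) == false) =
      (!k || (a ^^ l) == (c && b)) := by decide
  rw [solves, List.all_append, solves, solves]
  congr 1
  · refine all_congr_mem fun p hp => ?_
    rw [h1 p hp, Bool.false_and, h3]
  · refine all_congr_mem fun q hq => ?_
    rw [h2 q hq, Bool.false_and, h3]

theorem kerCount_append {A B : List (α × PartClass)} (s' : α → Bool)
    (h : ∀ p ∈ A, ∀ q ∈ B, adj p.1 q.1 = (s p.1 && t q.1) ∧ adj q.1 p.1 = (s p.1 && t q.1)) :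
    kerCount adj s' (A ++ B) =
      ∑ e : Bool, ∑ b : Bool, solCount adj s e b A * solCount adj t b e B := by
  -- Sorting the pairs by `e = t ⬝ z` and `b = s ⬝ x` decouples the two systems.
  have hbool : ∀ (f g : Bool → Bool) (a b : Bool), (if (f a && g b) = true then 1 else 0) =
      ∑ e : Bool, ∑ b' : Bool, (if f e = true ∧ b = b' then 1 else 0) *
        (if g b' = true ∧ a = e then 1 else 0) := by decide
  rw [kerCount, choiceSum_append]
  have : ∀ x ∈ choices entries A, (choiceSum entries B fun z =>
      if solves adj s' false (x ++ z) = true then 1 else 0) = ∑ e : Bool, ∑ b : Bool,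
        (if solves adj s e x = true ∧ parity s x = b then 1 else 0) * solCount adj t b e B := by
    intro x hx
    have : ∀ z ∈ choices entries B, (if solves adj s' false (x ++ z) = true then 1 else 0) =
        ∑ e : Bool, ∑ b : Bool, (if solves adj s e x = true ∧ parity s x = b then 1 else 0) *
          (if solves adj t b z = true ∧ parity t z = e then 1 else 0) := by
      intro z hz
      rw [solves_append s' h (map_fst_of_mem_choices_entries hx)
        (map_fst_of_mem_choices_entries hz)]
      exact hbool (fun e => solves adj s e x) (fun b => solves adj t b z) _ _
    rw [choiceSum_congr this]
    simp only [Fintype.sum_bool, choiceSum_add, choiceSum_mul_left, solCount]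
  rw [choiceSum_congr this]
  simp only [Fintype.sum_bool, choiceSum_add, choiceSum_mul_right, solCount]

/-- Up to a common factor these are the three tables of the trichotomy, so one vertex can stand for
a whole side of the cut. -/
theorem solCount_singleton {h : α} (hh : adj h h = false) (c : PartClass) (e b : Bool) :
    solCount adj (fun _ => true) e b [(h, c)] = match c with
      | PartClass.phi => if b = false then 1 else 0
      | PartClass.chi => if e = false then 1 else 0
      | PartClass.psi => if e = b then 1 else 0 := by
  cases c <;> cases e <;> cases b <;>
    simp [solCount, choiceSum_cons, entries, solves, parity, PartClass.kept, PartClass.looped, hh]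

theorem length_solutions (P : List (α × PartClass)) :
    (solutions adj s false P).length = kerCount adj s P := by
  rw [solutions, kerCount, choiceSum]
  induction choices entries P with
  | nil => rfl
  | cons x L ih =>
    rw [List.filter_cons, List.map_cons, List.sum_cons, ← ih]
    split_ifs <;> simp [add_comm]

theorem any_solutions (b : Bool) (P : List (α × PartClass)) :
    (solutions adj s true P).any (fun x => parity s x == b) = true ↔
      solCount adj s true b P ≠ 0 := by
  rw [solutions, solCount, choiceSum]
  induction choices entries P with
  | nil => simp
  | cons x L ih =>
    rw [List.filter_cons, List.map_cons, List.sum_cons]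
    by_cases h1 : solves adj s true x = true <;> by_cases h2 : parity s x = b <;>
      simp_all

/-- The number `2 ^ k` has `k + 1` binary digits, so dropping one digit takes the logarithm. -/
theorem length_nullityList {P : List (α × PartClass)} {k : ℕ} (h : kerCount adj s P = 2 ^ k) :
    (nullityList adj s P).length = k := by
  rw [nullityList, length_solutions, h, List.length_tail, Nat.size_eq_bits_len,
    Nat.size_pow, Nat.add_sub_cancel]

theorem kerCount_le (P : List (α × PartClass)) : kerCount adj s P ≤ 2 ^ P.length := by
  rw [← length_solutions]
  exact (List.length_filter_le _ _).trans
    (length_choices_le (fun a => by unfold entries; split_ifs <;> simp) P)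

/-- The list of the labels of a vertex as rational numbers. -/
def labelVals (lab : α → IntPair × IntPair × IntPair) (v : α) : ℚ × ℚ × ℚ :=
  ((lab v).1.val, (lab v).2.1.val, (lab v).2.2.val)

/-- The labeled interlace polynomial of a list of vertices. -/
def listPoly (adj : α → α → Bool) (lab : α → ℚ × ℚ × ℚ) (y : ℚ) (V : List α) : ℚ :=
  choiceSum classes V fun P => (P.map fun p => p.2.pick (lab p.1)).prod *
    y ^ (nullityList adj (fun _ => false) P).length

theorem val_pick (lab : α → IntPair × IntPair × IntPair) (v : α) (c : PartClass) :
    (c.pick (lab v)).val = c.pick (labelVals lab v) := by cases c <;> rfl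

theorem val_scaledPow (a : IntPair) (b : ℕ) (c : List Bool) (P : List (α × PartClass)) :
    (scaledPow a b c P).val = a.val ^ c.length * (b : ℚ) ^ (P.length - c.length) := by
  rw [scaledPow, IntPair.val_times, IntPair.val_prod, IntPair.val_prod]
  have : IntPair.val (b, 0) = b := by simp [IntPair.val]
  simp [this]

/-- Only one of the three terms on the left is nonzero, the one for the shape of the table of `PA`.
That table is a power of two times the table of `h` in the corresponding class, so the two nullities
differ by the exponent, whatever `PB` is. -/
theorem val_contribution (lab : α → IntPair × IntPair × IntPair) (a : IntPair) {b : ℕ}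
    (hb : b ≠ 0) {h : α} (hh : adj h h = false) {PA PB : List (α × PartClass)}
    (hA : ∀ p ∈ PA, ∀ q ∈ PA, adj p.1 q.1 = adj q.1 p.1)
    (hAB : ∀ p ∈ PA, ∀ q ∈ PB, adj p.1 q.1 = (s p.1 && t q.1) ∧ adj q.1 p.1 = (s p.1 && t q.1))
    (hB : ∀ q ∈ PB, adj h q.1 = t q.1 ∧ adj q.1 h = t q.1) (s' : α → Bool) :
    (contribution adj s lab a b PA).1.val *
        (a.val / b) ^ (nullityList adj s' ((h, PartClass.phi) :: PB)).length +
      (contribution adj s lab a b PA).2.1.val *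
        (a.val / b) ^ (nullityList adj s' ((h, PartClass.chi) :: PB)).length +
      (contribution adj s lab a b PA).2.2.val *
        (a.val / b) ^ (nullityList adj s' ((h, PartClass.psi) :: PB)).length =
    (b : ℚ) ^ PA.length * ((PA.map fun p => p.2.pick (labelVals lab p.1)).prod *
      (a.val / b) ^ (nullityList adj s' (PA ++ PB)).length) := by
  have hb' : (b : ℚ) ≠ 0 := Nat.cast_ne_zero.2 hb
  obtain ⟨h1, h2, h3⟩ := solCount_trichotomy s hA
  obtain ⟨k, hk⟩ := kerCount_eq_two_pow adj s PA
  have hkm : k ≤ PA.length := by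
    have := kerCount_le (adj := adj) (s := s) PA
    rw [hk] at this
    exact (Nat.pow_le_pow_iff_right (by omega)).1 this
  have hsingle : ∀ c, kerCount adj s' ((h, c) :: PB) = ∑ e : Bool, ∑ b : Bool,
      solCount adj (fun _ => true) e b [(h, c)] * solCount adj t b e PB := fun c =>
    kerCount_append (A := [(h, c)]) s' fun p hp q hq => by
      rw [List.mem_singleton.1 hp]
      simpa using hB q hq
  have hx := fun c => kerCount_eq_two_pow adj s' ((h, c) :: PB)
  choose x hx using hx
  obtain ⟨n, hn⟩ := kerCount_eq_two_pow adj s' (PA ++ PB)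
  have htot := kerCount_append (adj := adj) (A := PA) (B := PB) s' hAB
  simp only [length_nullityList (hx _), length_nullityList hn]
  have hw : (IntPair.prod (PA.map fun p => p.2.pick (lab p.1))).val =
      (PA.map fun p => p.2.pick (labelVals lab p.1)).prod := by
    rw [IntPair.val_prod, List.map_map]
    simp only [Function.comp_def, val_pick]
  have hz : IntPair.val (0, 0) = 0 := by simp [IntPair.val]
  -- Filling the power of `a / b` up to degree `|PA|` makes it an integer. The price is the factor
  -- `b ^ |PA|`, which is the same for all partitions and can be taken out of the sum.
  have hpow : ∀ j i, j ≤ PA.length → a.val ^ j * (b : ℚ) ^ (PA.length - j) * (a.val / b) ^ i =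
      (b : ℚ) ^ PA.length * (a.val / b) ^ (j + i) := fun j i hj => by
    conv_lhs => rw [show a.val = a.val / b * b by field_simp]
    conv_rhs => rw [← Nat.add_sub_cancel' hj]
    rw [mul_pow, pow_add, pow_add]
    field_simp
  have hparity : (fun x => !parity s x) = fun x => parity s x == false := by
    funext x; cases parity s x <;> rfl
  have hparity' : parity s = fun x => parity s x == true := by
    funext x; cases parity s x <;> rfl
  unfold contribution
  rw [hparity]
  simp only [any_solutions false]
  conv_lhs => simp only [show (solutions adj s true PA).any (parity s) =
    (solutions adj s true PA).any (fun x => parity s x == true) by rw [← hparity']]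
  simp only [any_solutions true]
  simp only [Fintype.sum_bool] at htot hsingle
  by_cases hc1 : solCount adj s true false PA = 0
  · rw [if_neg (not_not.2 hc1)]
    by_cases hc2 : solCount adj s true true PA = 0
    · rw [if_neg (not_not.2 hc2)]
      obtain ⟨g1, g2⟩ := h3 hc1 hc2
      have e1 := hsingle PartClass.chi
      simp only [solCount_singleton hh] at e1
      simp only [hx, if_true, if_false, reduceCtorEq] at e1
      rw [hn, hc1, hc2, g2] at htot
      -- The kernel is twice as large as its half, so its dimension is positive. The kept vertex `h`
      -- accounts for one dimension, which is why this case uses the tail of the nullity list.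
      obtain ⟨j, rfl⟩ : ∃ j, k = j + 1 := by
        refine ⟨k - 1, ?_⟩
        rcases Nat.eq_zero_or_pos k with rfl | hk0
        · rw [hk] at g1; omega
        · omega
      have hn' : n = j + x PartClass.chi := by
        have : 2 ^ n = 2 ^ (j + x PartClass.chi) := by
          rw [htot, pow_add, e1]
          rw [hk, pow_succ] at g1
          have : solCount adj s false false PA = 2 ^ j := by omega
          rw [this]; ring
        exact Nat.pow_right_injective le_rfl this
      simp only [hz, zero_mul, zero_add, add_zero, IntPair.val_times, val_scaledPow, hw,
        List.length_tail, length_nullityList hk, Nat.add_sub_cancel]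
      rw [mul_assoc, hpow j _ (by omega), hn']
      ring
    · rw [if_pos hc2]
      obtain ⟨g1, g2, g3, g4⟩ := h2 hc2
      have e1 := hsingle PartClass.psi
      simp only [solCount_singleton hh] at e1
      simp only [hx, if_true, if_false, reduceCtorEq] at e1
      rw [hn, g1, g2, g3, g4, hk] at htot
      have hn' : n = k + x PartClass.psi := by
        have : 2 ^ n = 2 ^ (k + x PartClass.psi) := by rw [htot, pow_add, e1]; ring
        exact Nat.pow_right_injective le_rfl this
      simp only [hz, zero_mul, zero_add, add_zero, IntPair.val_times, val_scaledPow, hw,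
        length_nullityList hk]
      rw [mul_assoc, hpow k _ hkm, hn']
      ring
  · rw [if_pos hc1]
    obtain ⟨g1, g2, g3, g4⟩ := h1 hc1
    have e1 := hsingle PartClass.phi
    simp only [solCount_singleton hh] at e1
    simp only [hx, if_true, if_false, reduceCtorEq] at e1
    rw [hn, g1, g2, g3, g4, hk] at htot
    have hn' : n = k + x PartClass.phi := by
      have : 2 ^ n = 2 ^ (k + x PartClass.phi) := by rw [htot, pow_add, e1]; ring
      exact Nat.pow_right_injective le_rfl this
    simp only [hz, zero_mul, add_zero, IntPair.val_times, val_scaledPow, hw,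
      length_nullityList hk]
    rw [mul_assoc, hpow k _ hkm, hn']
    ring

/-- The labels of `h` are sums over the partitions of `A`. Expanding them reduces the identity to
one pair of partitions of `A` and `B`, multiplied by the weight of the latter. -/
theorem listPoly_collapse {lab : α → IntPair × IntPair × IntPair} {a : IntPair} {b : ℕ}
    (hb : b ≠ 0) {A B : List α} {h : α} (hlab : lab h = collapsedLabels adj s lab a b A)
    (hh : adj h h = false) (hA : ∀ u ∈ A, ∀ v ∈ A, adj u v = adj v u)
    (hAB : ∀ u ∈ A, ∀ w ∈ B, adj u w = (s u && t w) ∧ adj w u = (s u && t w))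
    (hB : ∀ w ∈ B, adj h w = t w ∧ adj w h = t w) :
    listPoly adj (labelVals lab) (a.val / b) (h :: B) =
      (b : ℚ) ^ A.length * listPoly adj (labelVals lab) (a.val / b) (A ++ B) := by
  have hpick : ∀ f : IntPair × IntPair × IntPair → IntPair,
      (IntPair.sum ((choices classes A).map fun P => f (contribution adj s lab a b P))).val =
        choiceSum classes A fun P => (f (contribution adj s lab a b P)).val := fun f => by
    rw [IntPair.val_sum, List.map_map]; rfl
  have hl : labelVals lab h = (choiceSum classes A fun P => (contribution adj s lab a b P).1.val,
      choiceSum classes A fun P => (contribution adj s lab a b P).2.1.val,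
      choiceSum classes A fun P => (contribution adj s lab a b P).2.2.val) := by
    rw [labelVals, hlab, ← hpick fun q => q.1, ← hpick fun q => q.2.1, ← hpick fun q => q.2.2]
    rfl
  have hp1 : ∀ l : ℚ × ℚ × ℚ, PartClass.phi.pick l = l.1 := fun _ => rfl
  have hp2 : ∀ l : ℚ × ℚ × ℚ, PartClass.chi.pick l = l.2.1 := fun _ => rfl
  have hp3 : ∀ l : ℚ × ℚ × ℚ, PartClass.psi.pick l = l.2.2 := fun _ => rfl
  rw [listPoly, choiceSum_cons, listPoly, choiceSum_append, ← choiceSum_mul_left]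
  simp only [classes, List.map_cons, List.map_nil, List.sum_cons, List.sum_nil, add_zero,
    List.prod_cons, hl, hp1, hp2, hp3]
  have hswap : ∀ f G : List (α × PartClass) → ℚ,
      (choiceSum classes B fun PB => choiceSum classes A f * G PB) =
        choiceSum classes A fun PA => choiceSum classes B fun PB => f PA * G PB := fun f G => by
    simp only [choiceSum_mul_left, choiceSum_mul_right]
  simp only [mul_assoc, hswap]
  rw [← choiceSum_add, ← choiceSum_add]
  refine choiceSum_congr fun PA hPA => ?_
  rw [← choiceSum_add, ← choiceSum_add, ← choiceSum_mul_left]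
  refine choiceSum_congr fun PB hPB => ?_
  have mA := map_fst_of_mem_choices_classes hPA
  have mB := map_fst_of_mem_choices_classes hPB
  have memA : ∀ p ∈ PA, p.1 ∈ A := fun p hp => mA ▸ List.mem_map_of_mem hp
  have memB : ∀ p ∈ PB, p.1 ∈ B := fun p hp => mB ▸ List.mem_map_of_mem hp
  have key := val_contribution (s := s) (t := t) lab a hb hh (PA := PA) (PB := PB)
    (fun p hp q hq => hA _ (memA p hp) _ (memA q hq))
    (fun p hp q hq => hAB _ (memA p hp) _ (memB q hq)) (fun q hq => hB _ (memB q hq))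
    fun _ => false
  have hlen : PA.length = A.length := length_of_mem_choices hPA
  rw [hlen] at key
  rw [List.map_append, List.prod_append]
  linear_combination (PB.map fun p => p.2.pick (labelVals lab p.1)).prod * key

end Contraction

/-! ### The polynomial of a list and the labeled interlace polynomial -/

section Interlace

open Matrix

variable {α : Type}

theorem choiceSum_classes_ofFn {R : Type} [AddCommMonoid R] {m : ℕ} (v : Fin m → α)
    (F : List (α × PartClass) → R) :
    choiceSum classes (List.ofFn v) F =
      ∑ P : Fin m → PartClass, F (List.ofFn fun i => (v i, P i)) := by
  induction m generalizing F with
  | zero => simp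
  | succ m ih =>
    rw [List.ofFn_succ, choiceSum_cons,
      ← (Fin.consEquiv fun _ : Fin (m + 1) => PartClass).sum_comp, Fintype.sum_prod_type]
    have h3 : ∀ f : PartClass → R, ∑ c, f c =
        f PartClass.phi + (f PartClass.chi + f PartClass.psi) := fun f => by
      change ∑ c ∈ {PartClass.phi, PartClass.chi, PartClass.psi}, f c = _
      rw [Finset.sum_insert (by decide), Finset.sum_pair (by decide)]
    rw [h3]
    simp only [Fin.consEquiv, Equiv.coe_fn_mk, ih, classes, List.map_cons, List.map_nil,
      List.sum_cons, List.sum_nil, add_zero, List.ofFn_succ, Fin.cons_zero, Fin.cons_succ]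

/-- Restriction to the remaining vertices and extension by zero are inverse bijections between the
kernels. -/
theorem kernelCard_adjMatrixOf {n : ℕ} (G : SimpleGraph (Fin n)) (P : Fin n → PartClass)
    {adj : α → α → Bool} {v : Fin n → α} (hadj : ∀ i j, adj (v i) (v j) = true ↔ G.Adj i j) :
    kernelCard (adjMatrixOf G P) = kernelCard (fullMatrix adj fun i => (v i, P i)) := by
  have hkept : ∀ i, (P i).kept = true ↔ P i ≠ PartClass.phi := fun i => by
    cases P i <;> simp [PartClass.kept]
  have hkept' : ∀ i, (P i).kept = false ↔ P i = PartClass.phi := fun i => by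
    cases P i <;> simp [PartClass.kept]
  have hrow : ∀ x : Fin n → ZMod 2, (∀ i, (P i).kept = false → x i = 0) →
      ∀ w : {i : Fin n // P i ≠ PartClass.phi},
      (fullMatrix adj (fun i => (v i, P i)) *ᵥ x) w.1 =
        (adjMatrixOf G P *ᵥ fun u => x u.1) w := by
    intro x hx w
    rw [fullMatrix_mulVec_of_kept adj ((hkept _).2 w.2) hx]
    have h0 : x w.1 * boolZ (P w.1).looped =
        ∑ j, if w.1 = j then x j * boolZ (P w.1).looped else 0 := by simp
    simp only
    rw [h0, ← Finset.sum_add_distrib,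
      ← Fintype.sum_subtype_add_sum_subtype (fun i => P i ≠ PartClass.phi)]
    have h1 : ∑ j : {i : Fin n // ¬ P i ≠ PartClass.phi}, (x j.1 * boolZ (adj (v w.1) (v j.1)) +
        if w.1 = j.1 then x j.1 * boolZ (P w.1).looped else 0) = 0 := by
      refine Finset.sum_eq_zero fun j _ => ?_
      rw [hx j.1 ((hkept' _).2 (not_not.1 j.2))]
      simp
    rw [h1, add_zero, mulVec, dotProduct]
    refine Finset.sum_congr rfl fun j _ => ?_
    have h2 : (adjMatrixOf G P) w j = boolZ (adj (v w.1) (v j.1)) +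
        if w.1 = j.1 then boolZ (P w.1).looped else 0 := by
      rw [adjMatrixOf, of_apply]
      by_cases hwj : w = j
      · subst hwj
        have : adj (v w.1) (v w.1) = false := by
          rw [← Bool.not_eq_true, hadj]; exact G.loopless.irrefl _
        rw [this]
        simp only [SimpleGraph.irrefl, false_or, true_and, if_true, boolZ_false, zero_add]
        cases P w.1 <;> simp [PartClass.looped]
      · have h3 : w.1 ≠ j.1 := fun h => hwj (Subtype.ext h)
        simp only [hwj, false_and, or_false, h3, if_false, add_zero, ← hadj]
        rfl
    rw [h2]
    by_cases hwj : w.1 = j.1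
    · simp only [hwj, if_true]; ring
    · simp only [hwj, if_false, add_zero]; ring
  have hsupp : ∀ x, fullMatrix adj (fun i => (v i, P i)) *ᵥ x = 0 →
      ∀ i, (P i).kept = false → x i = 0 := fun x hx i hi => by
    have := congrFun hx i
    rwa [fullMatrix_mulVec_of_deleted adj (p := fun i => (v i, P i)) hi] at this
  have hext : ∀ z : {i : Fin n // P i ≠ PartClass.phi} → ZMod 2, adjMatrixOf G P *ᵥ z = 0 →
      fullMatrix adj (fun i => (v i, P i)) *ᵥ
        (fun i => if h : P i ≠ PartClass.phi then z ⟨i, h⟩ else 0) = 0 := by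
    intro z hz
    have h0 : ∀ i, (P i).kept = false →
        (if h : P i ≠ PartClass.phi then z ⟨i, h⟩ else 0) = 0 := fun i hi => by
      rw [dif_neg (not_not.2 ((hkept' i).1 hi))]
    have h1 : (fun u : {i : Fin n // P i ≠ PartClass.phi} =>
        if h : P u.1 ≠ PartClass.phi then z ⟨u.1, h⟩ else 0) = z :=
      funext fun u => by rw [dif_pos u.2]
    funext i
    by_cases hi : P i ≠ PartClass.phi
    · rw [hrow _ h0 ⟨i, hi⟩, h1, hz]; rfl
    · have hi' := (hkept' i).2 (not_not.1 hi)
      rw [fullMatrix_mulVec_of_deleted adj (p := fun i => (v i, P i)) hi', h0 i hi']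
      rfl
  have hres : ∀ x, fullMatrix adj (fun i => (v i, P i)) *ᵥ x = 0 →
      adjMatrixOf G P *ᵥ (fun u => x u.1) = 0 := fun x hx => funext fun w => by
    rw [← hrow x (hsupp x hx) w, hx]; rfl
  unfold kernelCard
  refine (Fintype.card_congr
    { toFun := fun x => ⟨fun u => x.1 u.1, hres x.1 x.2⟩
      invFun := fun z => ⟨fun i => if h : P i ≠ PartClass.phi then z.1 ⟨i, h⟩ else 0, hext z.1 z.2⟩
      left_inv := fun x => Subtype.ext (funext fun i => ?_)
      right_inv := fun z => Subtype.ext (funext fun u => dif_pos u.2) }).symm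
  simp only
  split_ifs with hi
  · rfl
  · exact (hsupp x.1 x.2 i ((hkept' i).2 (not_not.1 hi))).symm

theorem nullityOf_eq {n : ℕ} (G : SimpleGraph (Fin n)) (P : Fin n → PartClass)
    {adj : α → α → Bool} {v : Fin n → α} (hadj : ∀ i j, adj (v i) (v j) = true ↔ G.Adj i j)
    (s : α → Bool) :
    (nullityList adj s (List.ofFn fun i => (v i, P i))).length = nullityOf G P := by
  refine length_nullityList ?_
  rw [kerCount_ofFn, ← kernelCard_adjMatrixOf G P hadj, kernelCard_eq_two_pow]
  congr 1
  have h := LinearMap.finrank_range_add_finrank_ker (adjMatrixOf G P).mulVecLin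
  rw [Module.finrank_fintype_fun_eq_card] at h
  rw [nullityOf, Matrix.rank]
  omega

/-- Each partition uses exactly one label of every vertex, so common factors `c i`, which clear the
denominators, come out as their product. -/
theorem listPoly_ofFn {n : ℕ} (G : LabeledGraph (Fin n) ℚ) (y : ℚ) {adj : α → α → Bool}
    {v : Fin n → α} (hadj : ∀ i j, adj (v i) (v j) = true ↔ G.graph.Adj i j)
    {lab : α → ℚ × ℚ × ℚ} {c : Fin n → ℚ}
    (hlab : ∀ i, lab (v i) = (c i * G.phi i, c i * G.chi i, c i * G.psi i)) :
    listPoly adj lab y (List.ofFn v) = (∏ i, c i) * labeledInterlace G y := by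
  rw [listPoly, choiceSum_classes_ofFn, labeledInterlace, Finset.mul_sum]
  refine Finset.sum_congr rfl fun P _ => ?_
  rw [nullityOf_eq G.graph P hadj, ← mul_assoc, List.map_ofFn, List.prod_ofFn]
  congr 1
  simp only [Finset.prod_filter, ← Finset.prod_mul_distrib]
  refine Finset.prod_congr rfl fun i _ => ?_
  simp only [Function.comp_apply, hlab]
  cases P i <;> simp [PartClass.pick]

theorem kerCount_perm {adj : α → α → Bool} {s : α → Bool} {P P' : List (α × PartClass)}
    (h : P.Perm P') : kerCount adj s P = kerCount adj s P' := by
  refine choiceSum_perm h fun x x' hx => ?_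
  have hpar : ∀ f : α → Bool, parity f x = parity f x' := fun f => by
    rw [← boolZ_inj, boolZ_parity, boolZ_parity]
    exact (hx.map _).sum_eq
  have : solves adj s false x = solves adj s false x' := by
    rw [Bool.eq_iff_iff, solves, solves, List.all_eq_true, List.all_eq_true]
    simp only [hpar, hx.mem_iff]
  rw [this]

theorem listPoly_perm {adj : α → α → Bool} {lab : α → ℚ × ℚ × ℚ} {y : ℚ} {V V' : List α}
    (h : V.Perm V') : listPoly adj lab y V = listPoly adj lab y V' := by
  refine choiceSum_perm h fun P P' hP => ?_
  rw [(hP.map fun p => p.2.pick (lab p.1)).prod_eq, nullityList, nullityList, length_solutions,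
    length_solutions, kerCount_perm hP]

/-- This permits extra data on the vertices, such as the marks that describe a cut. -/
theorem listPoly_map {β : Type} {adj : α → α → Bool} {lab : α → ℚ × ℚ × ℚ} {y : ℚ}
    (f : β → α) (V : List β) : listPoly adj lab y (V.map f) =
      listPoly (fun u w => adj (f u) (f w)) (fun u => lab (f u)) y V := by
  have hcl : ∀ b : β, classes (f b) = (classes b).map (Prod.map f id) := fun b => rfl
  have hen : ∀ p : β × PartClass, entries (Prod.map f id p) =
      (entries p).map (Prod.map (Prod.map f id) id) := fun p => by
    unfold entries
    rw [show (Prod.map f id p).2 = p.2 from rfl]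
    split_ifs <;> rfl
  have hpar : ∀ (g : α → Bool) (x : List ((β × PartClass) × Bool)),
      parity g (x.map (Prod.map (Prod.map f id) id)) = parity (fun b => g (f b)) x := fun g x => by
    rw [← boolZ_inj, boolZ_parity, boolZ_parity, List.map_map]
    rfl
  have hker : ∀ P : List (β × PartClass), kerCount adj (fun _ => false) (P.map (Prod.map f id)) =
      kerCount (fun u w => adj (f u) (f w)) (fun _ => false) P := fun P => by
    rw [kerCount, choiceSum_map hen, kerCount]
    refine choiceSum_congr fun x _ => ?_
    have : solves adj (fun _ => false) false (x.map (Prod.map (Prod.map f id) id)) =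
        solves (fun u w => adj (f u) (f w)) (fun _ => false) false x := by
      rw [solves, List.all_map, solves]
      refine all_congr_mem fun p _ => ?_
      simp only [Function.comp_apply, hpar]
      rfl
    rw [this]
  rw [listPoly, choiceSum_map hcl, listPoly]
  refine choiceSum_congr fun P _ => ?_
  rw [List.map_map, nullityList, nullityList, length_solutions, length_solutions, hker]
  rfl

end Interlace

/-! ### A lower bound for the split width -/

section Width

/-- No partition of `W` into two sets with at least two elements has a cut of rank at most one. -/
def SplitFree {V : Type*} (G : SimpleGraph V) (W : Finset V) : Prop :=
  ∀ B ⊆ W, ∀ s t : V → Prop, 2 ≤ B.card → B.card + 2 ≤ W.card →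
    ¬ ∀ u ∈ B, ∀ w ∈ W, w ∉ B → (G.Adj u w ↔ s u ∧ t w)

variable {U V : Type*} {R : SimpleGraph U} {G : SimpleGraph V}

/-- An isolated vertex together with any other vertex would be one side of a cut of rank at most
one. -/
theorem SplitFree.exists_adj {W : Finset U} (hR : SplitFree R W) (h4 : 4 ≤ W.card) {w : U}
    (hw : w ∈ W) : ∃ u ∈ W, R.Adj w u := by
  classical
  by_contra hc
  push Not at hc
  obtain ⟨v, hv, hvw⟩ := Finset.exists_mem_ne (by omega : 1 < W.card) w
  have hcard : ({w, v} : Finset U).card = 2 := Finset.card_pair hvw.symm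
  refine hR {w, v} ?_ (fun u => u = v) (fun u => R.Adj v u) hcard.ge (by omega) ?_
  · intro x hx
    rcases Finset.mem_insert.1 hx with rfl | hx
    · exact hw
    · rwa [Finset.mem_singleton.1 hx]
  · intro u hu x hx hxB
    rcases Finset.mem_insert.1 hu with rfl | hu
    · constructor
      · exact fun h => absurd h (hc x hx)
      · rintro ⟨rfl, -⟩; exact absurd rfl hvw
    · rw [Finset.mem_singleton.1 hu]
      exact ⟨fun h => ⟨rfl, h⟩, fun h => h.2⟩

/-- A split-free induced subgraph survives a split reduction, unless it lies in the part that is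
reduced, up to one vertex. -/
theorem exists_embedding_splitReduction [Fintype U] (hR : SplitFree R Finset.univ)
    (h4 : 4 ≤ Fintype.card U) (f : R ↪g G) {A : Set V} {S : Set A} {T : Set (Aᶜ : Set V)}
    (hs : IsSplit G A S T) :
    Fintype.card U ≤ Nat.card {u // f u ∈ A} + 1 ∨
      Nonempty (R ↪g splitReduction G A T) := by
  classical
  have hcut : ∀ (a : A) (b : (Aᶜ : Set V)), G.Adj a.1 b.1 ↔ a ∈ S ∧ b ∈ T := fun a b => by
    have := congrArg (fun H : SimpleGraph (A ⊕ (Aᶜ : Set V)) => H.Adj (Sum.inl a) (Sum.inr b)) hs.2.2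
    simpa [joinGraph] using this
  set B : Finset U := Finset.univ.filter fun u => f u ∈ A with hB
  have hBcard : Nat.card {u // f u ∈ A} = B.card := by
    rw [Nat.card_eq_fintype_card, Fintype.card_subtype]
  have hmem : ∀ u, u ∈ B ↔ f u ∈ A := fun u => by simp [hB]
  rw [hBcard]
  by_cases h1 : B.card ≤ 1
  · refine Or.inr ?_
    -- At most one vertex of the subgraph lies in `A`; it goes to the new vertex and the others
    -- stay.
    let g : U → Unit ⊕ (Aᶜ : Set V) := fun u =>
      if h : f u ∈ A then Sum.inl () else Sum.inr ⟨f u, h⟩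
    have hgA : ∀ u, f u ∈ A → g u = Sum.inl () := fun u h => dif_pos h
    have hgB : ∀ u (h : f u ∉ A), g u = Sum.inr ⟨f u, h⟩ := fun u h => dif_neg h
    have huniq : ∀ u v, f u ∈ A → f v ∈ A → u = v := fun u v hu hv =>
      Finset.card_le_one.1 h1 u ((hmem u).2 hu) v ((hmem v).2 hv)
    have hcross : ∀ u v, ∀ hu : f u ∈ A, ∀ hv : f v ∉ A,
        R.Adj u v ↔ (⟨f v, hv⟩ : (Aᶜ : Set V)) ∈ T := by
      intro u v hu hv
      -- A neighbour of `u` must lie outside `A`, so `f u` belongs to `S`, and its neighbours across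
      -- the cut are all of `T`, like those of the new vertex.
      obtain ⟨w, -, hw⟩ := hR.exists_adj (by rwa [Finset.card_univ]) (Finset.mem_univ u)
      have hwA : f w ∉ A := fun h => hw.ne (huniq u w hu h)
      have h2 := (hcut ⟨f u, hu⟩ ⟨f w, hwA⟩).1 (f.map_adj_iff.2 hw)
      rw [← f.map_adj_iff, hcut ⟨f u, hu⟩ ⟨f v, hv⟩]
      exact ⟨fun h => h.2, fun h => ⟨h2.1, h⟩⟩
    refine ⟨⟨⟨g, fun u v huv => ?_⟩, fun {u v} => ?_⟩⟩
    · by_cases hu : f u ∈ A <;> by_cases hv : f v ∈ A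
      · exact huniq u v hu hv
      · rw [hgA u hu, hgB v hv] at huv; exact absurd huv (by simp)
      · rw [hgB u hu, hgA v hv] at huv; exact absurd huv (by simp)
      · rw [hgB u hu, hgB v hv] at huv
        simp only [Sum.inr.injEq, Subtype.mk.injEq] at huv
        exact f.injective huv
    · change (splitReduction G A T).Adj (g u) (g v) ↔ _
      by_cases hu : f u ∈ A <;> by_cases hv : f v ∈ A
      · obtain rfl := huniq u v hu hv
        simp
      · rw [hgA u hu, hgB v hv, hcross u v hu hv]
        simp [splitReduction, joinGraph]
      · rw [hgB u hu, hgA v hv, R.adj_comm, hcross v u hv hu]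
        simp [splitReduction, joinGraph]
      · rw [hgB u hu, hgB v hv, ← f.map_adj_iff]
        simp [splitReduction, joinGraph]
  · refine Or.inl ?_
    by_contra h2
    -- With two vertices on either side, the split of `G` would cut the split-free subgraph.
    refine hR B (Finset.subset_univ _) (fun u => ∃ h : f u ∈ A, (⟨f u, h⟩ : A) ∈ S)
      (fun w => ∃ h : f w ∉ A, (⟨f w, h⟩ : (Aᶜ : Set V)) ∈ T) (by omega)
      (by rw [Finset.card_univ]; omega) fun u hu w _ hw => ?_
    rw [hmem] at hu hw
    rw [← f.map_adj_iff, hcut ⟨f u, hu⟩ ⟨f w, hw⟩]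
    exact ⟨fun h => ⟨⟨hu, h.1⟩, hw, h.2⟩, fun ⟨⟨_, h⟩, _, h'⟩ => ⟨h, h'⟩⟩

/-- The split width is the largest admissible integer, so it is enough that `|U| - 1` is admissible.
For a given split the subgraph either lies in `A` up to one vertex or embeds in the reduction, which
is smaller, and induction applies. -/
theorem card_le_splitWidth_of_embedding [Fintype U] (hR : SplitFree R Finset.univ)
    (h4 : 4 ≤ Fintype.card U) {V : Type u} [Finite V] (G : SimpleGraph V) (f : R ↪g G) :
    Fintype.card U ≤ splitWidth G + 1 := by
  induction hn : Nat.card V using Nat.strong_induction_on generalizing V with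
  | _ n ih =>
    have hg := (isGreatest_splitWidth G).2
    have hle : Fintype.card U - 1 ≤ splitWidth G := by
      refine hg ⟨?_, fun A S T hs => ?_⟩
      · have := Nat.card_le_card_of_injective f f.injective
        rw [Nat.card_eq_fintype_card] at this
        omega
      · rcases exists_embedding_splitReduction hR h4 f hs with h | ⟨⟨f'⟩⟩
        · refine le_max_of_le_left ?_
          have h1 : Nat.card {u // f u ∈ A} ≤ Nat.card A :=
            Nat.card_le_card_of_injective (fun u => (⟨f u.1, u.2⟩ : A)) fun u v h =>
              Subtype.ext (f.injective (Subtype.ext_iff.1 h))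
          rw [← Nat.card_coe_set_eq]
          omega
        · refine le_max_of_le_right ?_
          have := ih _ (hn ▸ card_splitReduction_lt hs.1) (splitReduction G A T) f' rfl
          omega
    omega

/-- Split-free sets of vertices have at most one vertex more than the split width, if they have at
least four vertices. -/
theorem SplitFree.card_le {V : Type u} [Finite V] {G : SimpleGraph V} {W : Finset V}
    (hW : SplitFree G W) (h4 : 4 ≤ W.card) : W.card ≤ splitWidth G + 1 := by
  classical
  have h := card_le_splitWidth_of_embedding (U := W) (R := G.comap Subtype.val) ?_
    (by rwa [Fintype.card_coe]) G ⟨⟨Subtype.val, Subtype.val_injective⟩, Iff.rfl⟩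
  · rwa [Fintype.card_coe] at h
  · intro B _ s t hB2 hB3 hcut
    refine hW (B.map ⟨Subtype.val, Subtype.val_injective⟩) ?_ (fun v => ∃ h : v ∈ W, s ⟨v, h⟩)
      (fun v => ∃ h : v ∈ W, t ⟨v, h⟩) (by rwa [Finset.card_map])
      (by rw [Finset.card_map]; simpa using hB3) ?_
    · intro x hx
      obtain ⟨y, -, rfl⟩ := Finset.mem_map.1 hx
      exact y.2
    · intro u hu w hw hwB
      obtain ⟨u', hu', rfl⟩ := Finset.mem_map.1 hu
      have h1 := hcut u' hu' ⟨w, hw⟩ (Finset.mem_univ _) fun h =>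
        hwB (Finset.mem_map.2 ⟨_, h, rfl⟩)
      rw [SimpleGraph.comap_adj] at h1
      exact h1.trans ⟨fun ⟨a, b⟩ => ⟨⟨u'.2, a⟩, hw, b⟩, fun ⟨⟨_, a⟩, _, b⟩ => ⟨a, b⟩⟩

end Width

/-! ### Closed markings and the best collapse -/

section Closure

variable (V : List Vert) (a b : Vert)

/-- One round of forcing, for predicates on the vertices. -/
def growPred (K : Vert → Bool) (w : Vert) : Bool :=
  K w || V.any fun u => K u && Vert.forces a b u w

theorem growMarking_map (K : Vert → Bool) :
    growMarking a b (V.map fun w => (w, K w)) = V.map fun w => (w, growPred V a b K w) := by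
  simp [growMarking, growPred, Function.comp_def]

theorem foldl_growMarking_map {β : Type} (l : List β) (K : Vert → Bool) :
    l.foldl (fun m _ => growMarking a b m) (V.map fun w => (w, K w)) =
      V.map fun w => (w, (growPred V a b)^[l.length] K w) := by
  induction l generalizing K with
  | nil => rfl
  | cons x l ih => rw [List.foldl_cons, growMarking_map, ih]; rfl

theorem le_growPred {K : Vert → Bool} {w : Vert} (h : K w = true) : growPred V a b K w = true := by
  simp [growPred, h]

theorem le_iterate_growPred {K : Vert → Bool} {w : Vert} (h : K w = true) (k : ℕ) :
    (growPred V a b)^[k] K w = true := by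
  induction k with
  | zero => exact h
  | succ k ih => rw [Function.iterate_succ_apply']; exact le_growPred V a b ih

/-- Every round that changes something marks at least one new vertex, so there cannot be more such
rounds than vertices. -/
theorem growPred_stable_or (K : Vert → Bool) (k : ℕ) :
    (∀ w ∈ V, growPred V a b ((growPred V a b)^[k] K) w = (growPred V a b)^[k] K w) ∨
      k ≤ V.countP ((growPred V a b)^[k] K) := by
  induction k with
  | zero => exact Or.inr (Nat.zero_le _)
  | succ k ih =>
    rw [Function.iterate_succ_apply']
    generalize (growPred V a b)^[k] K = L at *
    by_cases hs : ∀ w ∈ V, growPred V a b L w = L w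
    · refine Or.inl fun w hw => ?_
      rw [growPred, growPred]
      have : (V.any fun u => growPred V a b L u && Vert.forces a b u w) =
          V.any fun u => L u && Vert.forces a b u w := by
        rw [Bool.eq_iff_iff, List.any_eq_true, List.any_eq_true]
        exact exists_congr fun u => and_congr_right fun hu => by rw [hs u hu]
      rw [this, Bool.or_assoc, Bool.or_self]
    · right
      refine Nat.succ_le_of_lt ((ih.resolve_left hs).trans_lt ?_)
      push Not at hs
      obtain ⟨w, hw, hne⟩ := hs
      refine lt_of_le_of_ne (List.countP_mono_left fun u _ hu => le_growPred V a b hu) fun h => ?_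
      obtain ⟨V₁, V₂, rfl⟩ := List.append_of_mem hw
      have h1 := List.countP_mono_left (l := V₁) fun u _ hu =>
        le_growPred (V₁ ++ w :: V₂) a b (K := L) (w := u) hu
      have h2 := List.countP_mono_left (l := V₂) fun u _ hu =>
        le_growPred (V₁ ++ w :: V₂) a b (K := L) (w := u) hu
      have h3 : L w = false := by
        by_contra h3
        rw [Bool.not_eq_false] at h3
        exact hne ((le_growPred _ a b h3).trans h3.symm)
      have h4 : growPred (V₁ ++ w :: V₂) a b L w = true := by
        rw [← Bool.not_eq_false, ← h3]; exact hne
      rw [List.countP_append, List.countP_append, List.countP_cons_of_pos h4,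
        List.countP_cons_of_neg (by simp [h3])] at h
      omega

/-- The marked vertices form the least set that contains `a` and `c` and is closed under
forcing. -/
theorem exists_closureMarking (c : Vert) : ∃ K : Vert → Bool,
    closureMarking V (a, b, c) = V.map (fun w => (w, K w)) ∧
    (∀ w, (w.same a || w.same c) = true → K w = true) ∧
    (∀ u ∈ V, ∀ w ∈ V, K u = true → Vert.forces a b u w = true → K w = true) ∧
    ∀ X : Vert → Prop, (∀ w ∈ V, (w.same a || w.same c) = true → X w) →
      (∀ u ∈ V, ∀ w ∈ V, X u → Vert.forces a b u w = true → X w) → ∀ w ∈ V, K w = true → X w := by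
  refine ⟨_, foldl_growMarking_map V a b (a :: V) _, fun w hw => le_iterate_growPred V a b hw _,
    fun u hu w hw h1 h2 => ?_, fun X h1 h2 => ?_⟩
  · rcases growPred_stable_or V a b (fun w => w.same a || w.same c) (a :: V).length with h | h
    · rw [← h w hw, growPred, Bool.or_eq_true, List.any_eq_true]
      exact Or.inr ⟨u, hu, by rw [h1, h2]; rfl⟩
    -- There are `|V| + 1` rounds, more than vertices, so the second alternative is impossible.
    · have := h.trans List.countP_le_length
      rw [List.length_cons] at this
      omega
  · generalize (a :: V).length = k
    induction k with
    | zero => exact h1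
    | succ k ih =>
      intro w hw h
      rw [Function.iterate_succ_apply', growPred, Bool.or_eq_true, List.any_eq_true] at h
      rcases h with h | ⟨u, hu, h⟩
      · exact ih w hw h
      · rw [Bool.and_eq_true] at h
        exact h2 u hu w hw (ih u hu h.1) h.2

end Closure

/-! ### The search for the smallest side of a split -/

section Best

theorem map_fst_closureMarking (V : List Vert) (t : Vert × Vert × Vert) :
    (closureMarking V t).map Prod.fst = V := by
  rw [closureMarking, map_fst_foldl_growMarking, List.map_map]
  exact List.map_id V

theorem candidate_perm (V : List Vert) (t : Vert × Vert × Vert) :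
    ((candidate V t).1.map Prod.fst ++ (candidate V t).2.1).Perm V := by
  conv_rhs => rw [← map_fst_closureMarking V t]
  rw [candidate, List.map_map]
  change (List.map Prod.fst _ ++ List.map Prod.fst _).Perm _
  rw [← List.map_append]
  exact (List.filter_append_perm (fun u : Vert × Bool => u.2) _).map _

theorem Collapse.valid_iff {k : Collapse} {b : Vert} : k.valid b = true ↔
    2 ≤ k.1.length ∧ 2 ≤ k.2.1.length ∧ ∃ w ∈ k.2.1, w.same b = true := by
  have h : ∀ {α : Type} (l : List α), (!l.tail.isEmpty) = true ↔ 2 ≤ l.length := fun l => by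
    match l with
    | [] => simp
    | [x] => simp
    | x :: y :: l => simp
  rw [Collapse.valid, Bool.and_eq_true, Bool.and_eq_true, h, h, List.any_eq_true]

/-- The running best never grows and has been compared with every valid candidate; this is the
minimality on which the width bound rests. -/
theorem foldl_better_length_le (V : List Vert) (l : List (Vert × Vert × Vert)) (k : Collapse) :
    (l.foldl (better V) k).1.length ≤ k.1.length ∧ ∀ t ∈ l, (candidate V t).valid t.2.1 = true →
      (l.foldl (better V) k).1.length ≤ (candidate V t).1.length := by
  induction l using List.reverseRecOn with
  | nil => simp
  | append_singleton l t ih =>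
    rw [List.foldl_append, List.foldl_cons, List.foldl_nil, better]
    split_ifs with h
    · rw [Bool.and_eq_true, decide_eq_true_iff] at h
      refine ⟨h.2.le.trans ih.1, fun t' ht' hv => ?_⟩
      rcases List.mem_append.1 ht' with ht' | ht'
      · exact h.2.le.trans (ih.2 t' ht' hv)
      · rw [List.mem_singleton.1 ht']
    · refine ⟨ih.1, fun t' ht' hv => ?_⟩
      rcases List.mem_append.1 ht' with ht' | ht'
      · exact ih.2 t' ht' hv
      · rw [List.mem_singleton] at ht'
        subst ht'
        rw [Bool.and_eq_true, decide_eq_true_iff] at h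
        exact not_lt.1 fun hlt => h ⟨hv, hlt⟩

theorem mem_triples {V : List Vert} {a b c : Vert} :
    (a, b, c) ∈ triples V ↔ a ∈ V ∧ b ∈ V ∧ c ∈ V := by
  simp only [triples, List.mem_flatMap, List.mem_map, Prod.mk.injEq]
  constructor
  · rintro ⟨_, ha, _, hb, _, hc, rfl, rfl, rfl⟩
    exact ⟨ha, hb, hc⟩
  · rintro ⟨ha, hb, hc⟩
    exact ⟨a, ha, b, hb, c, hc, rfl, rfl, rfl⟩

theorem bestCollapse_cases (V : List Vert) : bestCollapse V = totalCollapse V ∨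
    ∃ a ∈ V, ∃ b ∈ V, ∃ c ∈ V, bestCollapse V = candidate V (a, b, c) ∧
      (candidate V (a, b, c)).valid b = true := by
  rcases foldl_better_cases V (triples V) (totalCollapse V) with h | ⟨⟨a, b, c⟩, ht, h⟩
  · exact Or.inl h
  · rw [mem_triples] at ht
    exact Or.inr ⟨a, ht.1, b, ht.2.1, c, ht.2.2, h⟩

theorem length_bestCollapse_le {V : List Vert} {a b c : Vert} (ha : a ∈ V) (hb : b ∈ V)
    (hc : c ∈ V) (h : (candidate V (a, b, c)).valid b = true) :
    (bestCollapse V).1.length ≤ (candidate V (a, b, c)).1.length :=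
  (foldl_better_length_le V (triples V) (totalCollapse V)).2 _ (mem_triples.2 ⟨ha, hb, hc⟩) h

theorem bestCollapse_perm (V : List Vert) :
    ((bestCollapse V).1.map Prod.fst ++ (bestCollapse V).2.1).Perm V := by
  rcases bestCollapse_cases V with h | ⟨a, -, b, -, c, -, h, -⟩ <;> rw [h]
  · simp [totalCollapse, Function.comp_def]
  · exact candidate_perm V _

theorem length_bestCollapse_add (V : List Vert) :
    (bestCollapse V).1.length + (bestCollapse V).2.1.length = V.length := by
  rw [← (bestCollapse_perm V).length_eq, List.length_append, List.length_map]

end Best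

/-! ### The best collapse is small -/

section BestCut

variable {n : ℕ} {G : SimpleGraph (Fin n)}

/-- The vertex `v` has the number and the row of the vertex `i` of `G`. -/
def IsVert (G : SimpleGraph (Fin n)) (v : Vert) (i : Fin n) : Prop :=
  v.1.length = i ∧ ∀ j : Fin n, (v.2.1.drop j).headD false = true ↔ G.Adj i j

theorem IsVert.adj_iff {u v : Vert} {i j : Fin n} (hu : IsVert G u i) (hv : IsVert G v j) :
    u.adj v = true ↔ G.Adj i j := by
  rw [Vert.adj, hv.1, hu.2]

theorem IsVert.same_iff {u v : Vert} {i j : Fin n} (hu : IsVert G u i) (hv : IsVert G v j) :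
    u.same v = true ↔ i = j := by
  rw [Vert.same, decide_eq_true_iff, hu.1, hv.1, Fin.ext_iff]

variable {p : Fin n → Vert} (hp : ∀ i, IsVert G (p i) i)
include hp

theorem IsVert.injective : Function.Injective p := fun i j h =>
  ((hp i).same_iff (hp j)).1 (by rw [h]; exact ((hp j).same_iff (hp j)).2 rfl)

theorem IsVert.forces_iff {a b u w : Fin n} : Vert.forces (p a) (p b) (p u) (p w) = true ↔
    ¬ (G.Adj u w ↔ (G.Adj a b ∧ G.Adj u b) ∧ G.Adj a w) := by
  rw [Vert.forces, Bool.xor_iff_ne, ne_eq, Bool.eq_iff_iff]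
  simp only [Bool.and_eq_true, (hp _).adj_iff (hp _)]

/-- Closedness makes the marked set one side of a cut of rank at most one. Leastness places it
inside every set that contains `a` and `c` and has the cut relation given by `a` and `b`. -/
theorem candidate_spec (L : List (Fin n)) (a b c : Fin n) : ∃ κ : Fin n → Bool,
    candidate (L.map p) (p a, p b, p c) =
      ((L.filter κ).map fun i => (p i, (p a).adj (p b) && (p i).adj (p b)),
        (L.filter fun i => !κ i).map p, p a) ∧ κ a = true ∧ κ c = true ∧
    (∀ u ∈ L, ∀ w ∈ L, κ u = true → κ w = false →
      (G.Adj u w ↔ (G.Adj a b ∧ G.Adj u b) ∧ G.Adj a w)) ∧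
    ∀ X : Fin n → Prop, X a → X c → (∀ u ∈ L, ∀ w ∈ L, X u → ¬ X w →
      (G.Adj u w ↔ (G.Adj a b ∧ G.Adj u b) ∧ G.Adj a w)) → ∀ w ∈ L, κ w = true → X w := by
  obtain ⟨K, h1, h2, h3, h4⟩ := exists_closureMarking (L.map p) (p a) (p b) (p c)
  have hinj := IsVert.injective hp
  refine ⟨fun i => K (p i), ?_, h2 _ ?_, h2 _ ?_, fun u hu w hw hKu hKw => ?_,
    fun X ha hc hX w hw hKw => ?_⟩
  · rw [candidate, h1]
    simp only [List.map_map, List.filter_map, Function.comp_def]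
  · rw [((hp a).same_iff (hp a)).2 rfl]; rfl
  · rw [((hp c).same_iff (hp c)).2 rfl, Bool.or_true]
  · by_contra hc
    have := h3 _ (List.mem_map_of_mem hu) _ (List.mem_map_of_mem hw) hKu
      ((IsVert.forces_iff hp).2 hc)
    exact Bool.false_ne_true (hKw.symm.trans this)
  · have h5 := h4 (fun v => ∃ i, v = p i ∧ X i) (fun v hv hs => ?_) (fun u hu w hw => ?_) (p w)
      (List.mem_map_of_mem hw) hKw
    · obtain ⟨i, hi, hXi⟩ := h5
      rwa [hinj hi]
    · obtain ⟨i, -, rfl⟩ := List.mem_map.1 hv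
      rw [Bool.or_eq_true, (hp _).same_iff (hp _), (hp _).same_iff (hp _)] at hs
      rcases hs with rfl | rfl
      · exact ⟨_, rfl, ha⟩
      · exact ⟨_, rfl, hc⟩
    · obtain ⟨i, hi, rfl⟩ := List.mem_map.1 hu
      obtain ⟨j, hj, rfl⟩ := List.mem_map.1 hw
      rintro ⟨i', hi', hX'⟩ hf
      rw [IsVert.forces_iff hp] at hf
      rw [← hinj hi'] at hX'
      by_contra hc
      exact hf (hX i hi j hj hX' fun h => hc ⟨j, rfl, h⟩)

/-- The best collapse is at most as large as one side of any split. -/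
theorem length_bestCollapse_le_card {L : List (Fin n)} (hL : L.Nodup) {X : Finset (Fin n)}
    (hX : ∀ i ∈ X, i ∈ L) (h2 : 2 ≤ X.card) (h3 : X.card + 2 ≤ L.length) {s t : Fin n → Prop}
    (hcut : ∀ u ∈ X, ∀ w ∈ L, w ∉ X → (G.Adj u w ↔ s u ∧ t w)) :
    (bestCollapse (L.map p)).1.length ≤ X.card := by
  -- An edge `a b` across the cut determines it: `s` is adjacency to `b` and `t` is adjacency to
  -- `a`. Without such an edge any `a` and `b` will do, as both sides are then always false.
  have key : ∃ a ∈ X, ∃ b ∈ L, b ∉ X ∧ ∀ u ∈ X, ∀ w ∈ L, w ∉ X →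
      (G.Adj u w ↔ (G.Adj a b ∧ G.Adj u b) ∧ G.Adj a w) := by
    by_cases hadj : ∃ a ∈ X, ∃ b ∈ L, b ∉ X ∧ G.Adj a b
    · obtain ⟨a, ha, b, hb, hbX, hab⟩ := hadj
      refine ⟨a, ha, b, hb, hbX, fun u hu w hw hwX => ?_⟩
      rw [hcut a ha b hb hbX] at hab
      rw [hcut u hu w hw hwX, hcut a ha b hb hbX, hcut u hu b hb hbX, hcut a ha w hw hwX]
      tauto
    · push Not at hadj
      obtain ⟨a, ha⟩ := Finset.card_pos.1 (by omega : 0 < X.card)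
      obtain ⟨b, hb, hbX⟩ : ∃ b ∈ L, b ∉ X := by
        by_contra hc
        push Not at hc
        have := Finset.card_le_card (s := L.toFinset) (t := X) fun i hi =>
          hc i (List.mem_toFinset.1 hi)
        rw [List.toFinset_card_of_nodup hL] at this
        omega
      refine ⟨a, ha, b, hb, hbX, fun u hu w hw hwX => ?_⟩
      have h4 := hadj a ha b hb hbX
      have h5 := hadj u hu w hw hwX
      tauto
  obtain ⟨a, ha, b, hb, hbX, hab⟩ := key
  -- The second element ensures that the closure has the two elements that a side of a split needs.
  obtain ⟨c, hc, hca⟩ := Finset.exists_mem_ne (by omega : 1 < X.card) a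
  obtain ⟨κ, h4, h5, h6, -, h7⟩ := candidate_spec hp L a b c
  have h8 := h7 (· ∈ X) ha hc fun u _ w hw hu hwX => hab u hu w hw hwX
  have h9 : (L.filter κ).length ≤ X.card := by
    rw [← List.toFinset_card_of_nodup (hL.filter _)]
    refine Finset.card_le_card fun i hi => ?_
    rw [List.mem_toFinset, List.mem_filter] at hi
    exact h8 i hi.1 hi.2
  have h10 : 2 ≤ (L.filter κ).length := by
    rw [← List.toFinset_card_of_nodup (hL.filter _), ← Finset.card_pair hca.symm]
    refine Finset.card_le_card fun i hi => ?_
    rw [List.mem_toFinset, List.mem_filter]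
    rcases Finset.mem_insert.1 hi with rfl | hi
    · exact ⟨hX _ ha, h5⟩
    · rw [Finset.mem_singleton.1 hi]
      exact ⟨hX _ hc, h6⟩
  have h11 : (L.filter κ).length + (L.filter fun i => !κ i).length = L.length := by
    rw [← List.length_append]
    exact (List.filter_append_perm κ L).length_eq
  have hv : (candidate (L.map p) (p a, p b, p c)).valid (p b) = true := by
    rw [Collapse.valid_iff, h4]
    refine ⟨by simpa using h10, by rw [List.length_map]; omega, p b, List.mem_map_of_mem ?_,
      ((hp b).same_iff (hp b)).2 rfl⟩
    rw [List.mem_filter]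
    refine ⟨hb, ?_⟩
    by_contra hc'
    exact hbX (h8 b hb (by simpa using hc'))
  refine (length_bestCollapse_le (List.mem_map_of_mem (hX _ ha)) (List.mem_map_of_mem hb)
    (List.mem_map_of_mem (hX _ hc)) hv).trans ?_
  rw [h4, List.length_map]
  exact h9

/-- Either the whole list is split-free, or the chosen side together with one outside vertex is, by
minimality. The bound for split-free sets then applies, the summand `3` covering sets with fewer
than four vertices. -/
theorem length_bestCollapse_le_splitWidth {L : List (Fin n)} (hL : L.Nodup) :
    (bestCollapse (L.map p)).1.length ≤ splitWidth G + 3 := by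
  rcases bestCollapse_cases (L.map p) with h | ⟨_, ha, _, hb, _, hc, h, hv⟩
  · have hlen : (bestCollapse (L.map p)).1.length = L.length := by
      rw [h, totalCollapse, List.length_map, List.length_map]
    have hfree : SplitFree G L.toFinset := fun B hB s t h2 h3 hcut => by
      rw [List.toFinset_card_of_nodup hL] at h3
      have := length_bestCollapse_le_card hp hL (fun i hi => List.mem_toFinset.1 (hB hi)) h2 h3
        (fun u hu w hw => hcut u hu w (List.mem_toFinset.2 hw))
      omega
    by_contra hc
    have := hfree.card_le (by rw [List.toFinset_card_of_nodup hL]; omega)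
    rw [List.toFinset_card_of_nodup hL] at this
    omega
  · obtain ⟨a, ha, rfl⟩ := List.mem_map.1 ha
    obtain ⟨b, hb, rfl⟩ := List.mem_map.1 hb
    obtain ⟨c, hc, rfl⟩ := List.mem_map.1 hc
    obtain ⟨κ, h1, -, -, h2, -⟩ := candidate_spec hp L a b c
    have hlen : (bestCollapse (L.map p)).1.length = (L.filter κ).length := by
      rw [h, h1, List.length_map]
    rw [h1, Collapse.valid_iff] at hv
    simp only [List.length_map] at hv
    obtain ⟨hv1, hv2, _, hw, hwb⟩ := hv
    obtain ⟨b', hb', rfl⟩ := List.mem_map.1 hw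
    rw [(hp _).same_iff (hp _)] at hwb
    subst hwb
    rw [List.mem_filter, Bool.not_eq_true'] at hb'
    have h11 : (L.filter κ).length + (L.filter fun i => !κ i).length = L.length := by
      rw [← List.length_append]
      exact (List.filter_append_perm κ L).length_eq
    have hbA : b' ∉ (L.filter κ).toFinset := by
      rw [List.mem_toFinset, List.mem_filter, hb'.2]
      simp
    have hcard : (insert b' (L.filter κ).toFinset).card = (L.filter κ).length + 1 := by
      rw [Finset.card_insert_of_notMem hbA, List.toFinset_card_of_nodup (hL.filter _)]
    -- no subset of the marked set is one side of a smaller split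
    have key : ∀ X : Finset (Fin n), X ⊆ (L.filter κ).toFinset → 2 ≤ X.card →
        X.card < (L.filter κ).length → ∀ s t : Fin n → Prop,
        ¬ ∀ u ∈ X, ∀ w ∈ insert b' (L.filter κ).toFinset, w ∉ X → (G.Adj u w ↔ s u ∧ t w) := by
      intro X hX h2X h3X s t hcut
      have hXL : ∀ i ∈ X, i ∈ L ∧ κ i = true := fun i hi => by
        simpa [List.mem_filter] using hX hi
      -- Towards the unmarked vertices the marked set acts through adjacency to `b'`: `u` is
      -- adjacent to `w` iff it is adjacent to `b'` and `w` to `a`. So a cut that treats `b'`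
      -- correctly extends to all of them.
      have := length_bestCollapse_le_card hp hL (fun i hi => (hXL i hi).1) h2X (by omega) (s := s)
        (t := fun w => if κ w = true then t w else t b' ∧ G.Adj a w) fun u hu w hw hwX => by
          by_cases hκ : κ w = true
          · rw [if_pos hκ]
            exact hcut u hu w (Finset.mem_insert_of_mem (by simp [hw, hκ])) hwX
          · have hub := hcut u hu b' (Finset.mem_insert_self _ _) fun h => hbA (hX h)
            have hub' := h2 u (hXL u hu).1 b' hb'.1 (hXL u hu).2 hb'.2
            rw [if_neg hκ, h2 u (hXL u hu).1 w hw (hXL u hu).2 (by simpa using hκ)]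
            tauto
      omega
    have hfree : SplitFree G (insert b' (L.filter κ).toFinset) := fun B hB s t h2B h3B hcut => by
      rw [hcard] at h3B
      -- A cut has two sides; the one without `b'` consists of marked vertices and is smaller than
      -- the marked set.
      by_cases hbB : b' ∈ B
      · have hcard' := Finset.card_sdiff_add_card_eq_card hB
        rw [hcard] at hcard'
        refine key (insert b' (L.filter κ).toFinset \ B) (fun i hi => ?_) (by omega) (by omega) t s
          fun u hu w hw hwX => ?_
        · rw [Finset.mem_sdiff, Finset.mem_insert] at hi
          exact hi.1.resolve_left fun h => hi.2 (h ▸ hbB)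
        · rw [Finset.mem_sdiff] at hu hwX
          rw [G.adj_comm, hcut w (by by_contra hc; exact hwX ⟨hw, hc⟩) u hu.1 hu.2, and_comm]
      · exact key B (fun i hi => (Finset.mem_insert.1 (hB hi)).resolve_left fun h => hbB (h ▸ hi))
          h2B (by omega) s t hcut
    by_contra hcon
    have := hfree.card_le (by omega)
    omega

end BestCut

/-! ### Correctness of the main loop -/

section Correctness

/-- If `s` vanishes on `P`, the zero vector solves `M x = s` with even parity, so only the shape of
a deleted vertex occurs. -/
theorem contribution_of_not_adjacent {α : Type} {adj : α → α → Bool} {s : α → Bool}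
    {lab : α → IntPair × IntPair × IntPair} {a : IntPair} {b : ℕ} {P : List (α × PartClass)}
    (hs : ∀ p ∈ P, s p.1 = false) : (contribution adj s lab a b P).2 = ((0, 0), (0, 0)) := by
  have hpar : ∀ f : α → Bool, parity f (P.map fun p => (p, false)) = false := fun f => by
    rw [← boolZ_inj, boolZ_parity, List.map_map]
    simp [Function.comp_def]
  have hmem : (P.map fun p => (p, false)) ∈ choices entries P := by
    clear hs hpar
    induction P with
    | nil => simp
    | cons p P ih =>
      rw [choices_cons]
      simp only [List.map_cons, List.mem_flatMap, List.mem_map]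
      refine ⟨_, ih, _, ?_, rfl⟩
      unfold entries
      split_ifs <;> simp
  rw [contribution, if_pos]
  rw [List.any_eq_true]
  refine ⟨_, List.mem_filter.2 ⟨hmem, ?_⟩, by rw [hpar]; rfl⟩
  rw [solves, List.all_eq_true]
  intro q hq
  obtain ⟨p, hp, rfl⟩ := List.mem_map.1 hq
  simp [hpar, hs p hp]

theorem collapsedLabels_of_not_adjacent {α : Type} {adj : α → α → Bool} {s : α → Bool}
    {lab : α → IntPair × IntPair × IntPair} {a : IntPair} {b : ℕ} {A : List α}
    (hs : ∀ u ∈ A, s u = false) : (collapsedLabels adj s lab a b A).2.1.val = 0 ∧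
      (collapsedLabels adj s lab a b A).2.2.val = 0 := by
  have h : ∀ P ∈ choices classes A, (contribution adj s lab a b P).2 = ((0, 0), (0, 0)) :=
    fun P hP => contribution_of_not_adjacent fun p hp => hs _ <| by
      rw [← map_fst_of_mem_choices_classes hP]
      exact List.mem_map_of_mem hp
  constructor
  · rw [collapsedLabels, IntPair.val_sum, List.map_map]
    refine List.sum_eq_zero fun z hz => ?_
    obtain ⟨P, hP, rfl⟩ := List.mem_map.1 hz
    simp [h P hP, IntPair.val]
  · rw [collapsedLabels, IntPair.val_sum, List.map_map]
    refine List.sum_eq_zero fun z hz => ?_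
    obtain ⟨P, hP, rfl⟩ := List.mem_map.1 hz
    simp [h P hP, IntPair.val]

/-- The polynomial of a list of vertices. -/
def vertsPoly (y : IntPair × ℕ) (V : List Vert) : ℚ :=
  listPoly Vert.adj (labelVals Vert.labels) (y.1.val / y.2) V

theorem vertsPoly_apply {y : IntPair × ℕ} (hy : y.2 ≠ 0) {k : Collapse}
    (hh : k.2.2.adj k.2.2 = false) (hA : ∀ u ∈ k.1, ∀ v ∈ k.1, u.1.adj v.1 = v.1.adj u.1)
    (hAB : ∀ u ∈ k.1, ∀ w ∈ k.2.1, u.1.adj w = (u.2 && k.2.2.adj w) ∧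
      w.adj u.1 = (u.2 && k.2.2.adj w)) (hB : ∀ w ∈ k.2.1, w.adj k.2.2 = k.2.2.adj w) :
    vertsPoly y (k.apply y) = (y.2 : ℚ) ^ k.1.length * vertsPoly y (k.1.map Prod.fst ++ k.2.1) := by
  have hfst : ∀ B : List Vert, (B.map fun w => (w, false)).map Prod.fst = B := fun B => by
    rw [List.map_map]; exact List.map_id B
  -- The marks serve as the function `s`; the vertices outside the collapsed set receive idle marks,
  -- so that both sides have the same type.
  have h := listPoly_collapse (α := Vert × Bool) (adj := fun u w => u.1.adj w.1)
    (s := fun u => u.2) (t := fun w => k.2.2.adj w.1) (lab := fun u => u.1.labels) (a := y.1) hy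
    (A := k.1) (B := k.2.1.map fun w => (w, false))
    (h := ((k.2.2.1, k.2.2.2.1, collapsedLabels (fun u w : Vert × Bool => u.1.adj w.1)
      (fun u => u.2) (fun u => u.1.labels) y.1 y.2 k.1), false)) rfl hh hA
    (fun u hu w hw => by
      obtain ⟨w, hw', rfl⟩ := List.mem_map.1 hw
      exact hAB u hu w hw')
    (fun w hw => by
      obtain ⟨w, hw', rfl⟩ := List.mem_map.1 hw
      exact ⟨rfl, hB w hw'⟩)
  have hm : ∀ l : List (Vert × Bool), vertsPoly y (l.map Prod.fst) =
      listPoly (fun u w => u.1.adj w.1) (labelVals fun u => u.1.labels) (y.1.val / y.2) l :=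
    fun l => listPoly_map Prod.fst l
  rw [← hm, ← hm, List.map_cons, List.map_append, hfst] at h
  exact h

/-- The list of vertices consists of vertices of `G`, up to the labels. -/
def Represents {n : ℕ} (G : SimpleGraph (Fin n)) (V : List Vert) : Prop :=
  ∃ (L : List (Fin n)) (p : Fin n → Vert), L.Nodup ∧ (∀ i, IsVert G (p i) i) ∧ V = L.map p

/-- There is only one vertex left, and only its first label counts. -/
def Finished (V : List Vert) : Prop :=
  ∃ h : Vert, V = [h] ∧ h.adj h = false ∧ h.labels.2.1.val = 0 ∧ h.labels.2.2.val = 0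

theorem finished_apply_totalCollapse (y : IntPair × ℕ) (V : List Vert) :
    Finished ((totalCollapse V).apply y) := by
  refine ⟨_, rfl, rfl, ?_⟩
  exact collapsedLabels_of_not_adjacent fun u hu => by
    obtain ⟨v, -, rfl⟩ := List.mem_map.1 hu
    rfl

theorem vertsPoly_apply_totalCollapse {y : IntPair × ℕ} (hy : y.2 ≠ 0) {V : List Vert}
    (hV : ∀ u ∈ V, ∀ v ∈ V, u.adj v = v.adj u) :
    vertsPoly y ((totalCollapse V).apply y) =
      (y.2 : ℚ) ^ (totalCollapse V).1.length * vertsPoly y V := by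
  have h := vertsPoly_apply (k := totalCollapse V) hy rfl (fun u hu v hv => by
    obtain ⟨u, hu', rfl⟩ := List.mem_map.1 hu
    obtain ⟨v, hv', rfl⟩ := List.mem_map.1 hv
    exact hV u hu' v hv') (by simp [totalCollapse]) (by simp [totalCollapse])
  rwa [show (totalCollapse V).1.map Prod.fst ++ (totalCollapse V).2.1 = V by
    simp [totalCollapse, Function.comp_def]] at h

/-- A split needs two vertices on each side. -/
theorem bestCollapse_of_length_lt {V : List Vert} (hV : V.length < 4) :
    bestCollapse V = totalCollapse V := by
  rcases bestCollapse_cases V with h | ⟨a, -, b, -, c, -, h, hv⟩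
  · exact h
  · have h1 := length_bestCollapse_add V
    rw [Collapse.valid_iff] at hv
    rw [h] at h1
    omega

theorem Represents.adj_comm {n : ℕ} {G : SimpleGraph (Fin n)} {V : List Vert}
    (hV : Represents G V) : ∀ u ∈ V, ∀ v ∈ V, u.adj v = v.adj u := by
  obtain ⟨L, p, -, hp, rfl⟩ := hV
  intro u hu v hv
  obtain ⟨i, -, rfl⟩ := List.mem_map.1 hu
  obtain ⟨j, -, rfl⟩ := List.mem_map.1 hv
  rw [Bool.eq_iff_iff, (hp i).adj_iff (hp j), (hp j).adj_iff (hp i), G.adj_comm]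

/-- The collapsed set borrows the number and the row of `a`, and only the labels are new. So the
collapsed graph is again an induced subgraph of `G`, and the split width of `G` itself bounds all
later steps. -/
theorem represents_cons {n : ℕ} {G : SimpleGraph (Fin n)} {p : Fin n → Vert}
    (hp : ∀ i, IsVert G (p i) i) {a : Fin n} {L : List (Fin n)} (ha : a ∉ L) (hL : L.Nodup)
    (l : IntPair × IntPair × IntPair) : Represents G (((p a).1, (p a).2.1, l) :: L.map p) := by
  refine ⟨a :: L, Function.update p a ((p a).1, (p a).2.1, l), List.nodup_cons.2 ⟨ha, hL⟩,
    fun i => ?_, ?_⟩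
  · rcases eq_or_ne i a with rfl | hi
    · rw [Function.update_self]
      exact hp i
    · rw [Function.update_of_ne hi]
      exact hp i
  · rw [List.map_cons, Function.update_self]
    congr 1
    exact List.map_congr_left fun i hi => (Function.update_of_ne (by
      rintro rfl
      exact ha hi) _ _).symm

/-- The outcome of a collapse. -/
theorem Represents.apply_bestCollapse {n : ℕ} {G : SimpleGraph (Fin n)} {V : List Vert}
    (hV : Represents G V) {y : IntPair × ℕ} (hy : y.2 ≠ 0) :
    vertsPoly y ((bestCollapse V).apply y) =
      (y.2 : ℚ) ^ (bestCollapse V).1.length * vertsPoly y V ∧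
    (Finished ((bestCollapse V).apply y) ∨
      Represents G ((bestCollapse V).apply y) ∧ ((bestCollapse V).apply y).length < V.length) := by
  have hcomm := hV.adj_comm
  rcases bestCollapse_cases V with h | ⟨_, ha, _, hb, _, hc, h, hv⟩
  · rw [h]
    exact ⟨vertsPoly_apply_totalCollapse hy hcomm, Or.inl (finished_apply_totalCollapse y V)⟩
  · have hlen := length_bestCollapse_add V
    have hperm := bestCollapse_perm V
    rw [h] at hlen hperm ⊢
    obtain ⟨L, p, hL, hp, rfl⟩ := hV
    obtain ⟨a, ha, rfl⟩ := List.mem_map.1 ha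
    obtain ⟨b, hb, rfl⟩ := List.mem_map.1 hb
    obtain ⟨c, hc, rfl⟩ := List.mem_map.1 hc
    rw [Collapse.valid_iff] at hv
    obtain ⟨κ, h1, h2, -, h3, -⟩ := candidate_spec hp L a b c
    rw [h1] at hlen hperm hv ⊢
    have hcut : ∀ u ∈ L.filter κ, ∀ w ∈ L.filter (fun i => !κ i), (p u).adj (p w) =
        (((p a).adj (p b) && (p u).adj (p b)) && (p a).adj (p w)) := fun u hu w hw => by
      rw [List.mem_filter] at hu hw
      rw [Bool.eq_iff_iff]
      simp only [Bool.and_eq_true, (hp _).adj_iff (hp _)]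
      exact h3 u hu.1 w hw.1 hu.2 (by simpa using hw.2)
    have hmemp : ∀ {i}, i ∈ L → p i ∈ L.map p := fun hi => List.mem_map_of_mem hi
    refine ⟨?_, Or.inr ⟨?_, ?_⟩⟩
    · rw [vertsPoly_apply hy]
      · rw [vertsPoly, listPoly_perm hperm, vertsPoly]
      · rw [Bool.eq_false_iff, ne_eq, (hp a).adj_iff (hp a)]
        exact G.loopless.irrefl a
      · intro u hu v hv
        obtain ⟨u, hu', rfl⟩ := List.mem_map.1 hu
        obtain ⟨v, hv', rfl⟩ := List.mem_map.1 hv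
        exact hcomm _ (hmemp (List.mem_filter.1 hu').1) _ (hmemp (List.mem_filter.1 hv').1)
      · intro u hu w hw
        obtain ⟨u, hu', rfl⟩ := List.mem_map.1 hu
        obtain ⟨w, hw', rfl⟩ := List.mem_map.1 hw
        refine ⟨hcut u hu' w hw', ?_⟩
        rw [hcomm _ (hmemp (List.mem_filter.1 hw').1) _ (hmemp (List.mem_filter.1 hu').1)]
        exact hcut u hu' w hw'
      · intro w hw
        obtain ⟨w, hw', rfl⟩ := List.mem_map.1 hw
        exact hcomm _ (hmemp (List.mem_filter.1 hw').1) _ ha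
    · have haB : a ∉ L.filter fun i => !κ i := by
        rw [List.mem_filter]
        simp [h2]
      exact represents_cons hp haB (hL.filter _) _
    · rw [Collapse.apply, List.length_cons]
      omega

/-- The invariant of the main loop after `k` steps. -/
def LoopInvariant {n : ℕ} (G : SimpleGraph (Fin n)) (y : IntPair × ℕ) (q : ℚ) (k : ℕ)
    (st : ℕ × List Vert) : Prop :=
  0 < st.1 ∧ vertsPoly y st.2 = st.1 * q ∧
    (Finished st.2 ∨ Represents G st.2 ∧ st.2.length + k ≤ n)

theorem LoopInvariant.step {n : ℕ} {G : SimpleGraph (Fin n)} {y : IntPair × ℕ} {q : ℚ} {k : ℕ}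
    {st : ℕ × List Vert} (hy : y.2 ≠ 0) (h : LoopInvariant G y q k st) :
    LoopInvariant G y q (k + 1) (collapseStep y st) := by
  obtain ⟨h1, h2, h3⟩ := h
  have hpos : 0 < (collapseStep y st).1 := by
    refine Nat.mul_pos h1 (List.prod_pos fun m hm => ?_)
    obtain ⟨-, -, rfl⟩ := List.mem_map.1 hm
    exact Nat.pos_of_ne_zero hy
  have hval : vertsPoly y ((bestCollapse st.2).apply y) =
      (y.2 : ℚ) ^ (bestCollapse st.2).1.length * vertsPoly y st.2 →
      vertsPoly y (collapseStep y st).2 = (collapseStep y st).1 * q := fun h => by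
    rw [collapseStep, h, h2]
    simp only [List.map_const', List.prod_replicate]
    push_cast
    ring
  rcases h3 with ⟨h, hst, hh, -⟩ | ⟨h3, h4⟩
  -- A finished state is not left: its only vertex is collapsed onto itself, which multiplies
  -- numerator and denominator by the same factor.
  · have hb : bestCollapse st.2 = totalCollapse st.2 :=
      bestCollapse_of_length_lt (by rw [hst]; simp)
    refine ⟨hpos, hval ?_, Or.inl ?_⟩
    · rw [hb]
      refine vertsPoly_apply_totalCollapse hy ?_
      rw [hst]
      simp
    · rw [collapseStep, hb]
      exact finished_apply_totalCollapse y _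
  · obtain ⟨h5, h6⟩ := h3.apply_bestCollapse hy
    refine ⟨hpos, hval h5, h6.imp_right fun h6 => ⟨h6.1, ?_⟩⟩
    have := h6.2
    change ((bestCollapse st.2).apply y).length + (k + 1) ≤ n
    omega

theorem LoopInvariant.iterate {n : ℕ} {G : SimpleGraph (Fin n)} {y : IntPair × ℕ} {q : ℚ}
    {st : ℕ × List Vert} (hy : y.2 ≠ 0) (h : LoopInvariant G y q 0 st) (k : ℕ) :
    LoopInvariant G y q k ((collapseStep y)^[k] st) := by
  induction k with
  | zero => exact h
  | succ k ih => rw [Function.iterate_succ_apply']; exact ih.step hy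

theorem LoopInvariant.length_bestCollapse_le {n : ℕ} {G : SimpleGraph (Fin n)}
    {y : IntPair × ℕ} {q : ℚ} {k : ℕ} {st : ℕ × List Vert} (h : LoopInvariant G y q k st) :
    (bestCollapse st.2).1.length ≤ splitWidth G + 3 := by
  rcases h.2.2 with ⟨h, hst, -⟩ | ⟨⟨L, p, hL, hp, hst⟩, -⟩
  · have := length_bestCollapse_add st.2
    rw [hst, List.length_singleton] at this
    rw [hst]
    omega
  · rw [hst]
    exact length_bestCollapse_le_splitWidth hp hL

theorem vertsPoly_singleton {y : IntPair × ℕ} {h : Vert} (h1 : h.labels.2.1.val = 0)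
    (h2 : h.labels.2.2.val = 0) : vertsPoly y [h] = h.labels.1.val := by
  have h3 : (nullityList Vert.adj (fun _ => false) [(h, PartClass.phi)]).length = 0 :=
    length_nullityList (by
      simp [kerCount, choiceSum_cons, entries, PartClass.kept, solves])
  rw [vertsPoly, listPoly, choiceSum_cons]
  simp [classes, PartClass.pick, labelVals, h1, h2, h3]

/-- When the loop ends, the value can be read off. -/
theorem LoopInvariant.eq_div {n : ℕ} {G : SimpleGraph (Fin n)} {y : IntPair × ℕ} {q : ℚ} {k : ℕ}
    {st : ℕ × List Vert} (h : LoopInvariant G y q k st) (hk : n < k) {d : Vert} :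
    q = (st.2.headD d).labels.1.val / st.1 := by
  obtain ⟨h1, h2, ⟨v, hst, -, h3, h4⟩ | ⟨-, h3⟩⟩ := h
  · rw [hst, vertsPoly_singleton h3 h4] at h2
    rw [hst, List.headD_cons, h2, mul_div_cancel_left₀]
    exact_mod_cast h1.ne'
  · omega

end Correctness

/-! ### The size of the numbers in the main loop -/

section Sizes

theorem length_nullityList_le {α : Type} (adj : α → α → Bool) (s : α → Bool)
    (P : List (α × PartClass)) : (nullityList adj s P).length ≤ P.length := by
  have h1 : (solutions adj s false P).length ≤ 2 ^ P.length :=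
    (List.length_filter_le _ _).trans (length_choices_le (fun p => by
      unfold entries; split_ifs <;> simp) P)
  have h2 : (solutions adj s false P).length.size ≤ P.length + 1 :=
    Nat.size_le.2 (h1.trans_lt (Nat.pow_lt_pow_right one_lt_two (Nat.lt_succ_self _)))
  rw [nullityList, List.length_tail, Nat.size_eq_bits_len]
  omega

theorem IntPair.norm_scaledPow_le {α : Type} {a : IntPair} {b C : ℕ} (ha : a.norm ≤ C)
    (hb : b ≤ C) {c : List Bool} {P : List (α × PartClass)} (hc : c.length ≤ P.length) :
    (scaledPow a b c P).norm ≤ C ^ P.length := by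
  rw [scaledPow, norm_times, norm_prod, norm_prod, List.map_map, List.map_map]
  simp only [Function.comp_def, List.map_const', List.prod_replicate, List.length_drop]
  calc a.norm ^ c.length * (norm (b, 0)) ^ (P.length - c.length)
      ≤ C ^ c.length * C ^ (P.length - c.length) :=
        Nat.mul_le_mul (Nat.pow_le_pow_left ha _) (Nat.pow_le_pow_left hb _)
    _ = C ^ P.length := by rw [← pow_add, Nat.add_sub_cancel' hc]

/-- A partition contributes to one label only, so the sum of the three norms is the norm of a single
product. -/
theorem norm_contribution_le {α : Type} {adj : α → α → Bool} {s : α → Bool}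
    {lab : α → IntPair × IntPair × IntPair} {a : IntPair} {b C : ℕ} (ha : a.norm ≤ C)
    (hb : b ≤ C) (P : List (α × PartClass)) :
    (contribution adj s lab a b P).1.norm + (contribution adj s lab a b P).2.1.norm +
      (contribution adj s lab a b P).2.2.norm ≤
        (P.map fun p => (p.2.pick (lab p.1)).norm).prod * C ^ P.length := by
  have h1 := length_nullityList_le adj s P
  have h2 : (nullityList adj s P).tail.length ≤ P.length := by
    rw [List.length_tail]; omega
  have h0 : IntPair.norm (0, 0) = 0 := rfl
  have hw := IntPair.norm_prod (P.map fun p => p.2.pick (lab p.1))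
  rw [List.map_map] at hw
  rw [contribution]
  split_ifs <;> simp only [h0, IntPair.norm_times, hw, Nat.add_zero, Nat.zero_add] <;>
    exact Nat.mul_le_mul_left _ (IntPair.norm_scaledPow_le ha hb (by assumption))

theorem choiceSum_classes_prod {α R : Type} [CommSemiring R] (A : List α)
    (f : α × PartClass → R) : (choiceSum classes A fun P => (P.map f).prod) =
      (A.map fun u => f (u, PartClass.phi) + f (u, PartClass.chi) + f (u, PartClass.psi)).prod := by
  induction A with
  | nil => simp
  | cons u A ih =>
    rw [choiceSum_cons, List.map_cons, List.prod_cons, ← ih]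
    simp only [classes, List.map_cons, List.map_nil, List.sum_cons, List.sum_nil, List.prod_cons,
      choiceSum_mul_left]
    ring

/-- One more than the size of the labels. -/
def labelWeight (l : IntPair × IntPair × IntPair) : ℕ := 1 + l.1.norm + l.2.1.norm + l.2.2.norm

/-- The sum over all partitions of the products of norms factors into a product over the vertices.
So the new labels are as long as the old ones together, despite the exponential number of summands;
the factor two absorbs the additional one in the weight. -/
theorem labelWeight_collapsedLabels_le {α : Type} {adj : α → α → Bool} {s : α → Bool}
    {lab : α → IntPair × IntPair × IntPair} {a : IntPair} {b C : ℕ} (ha : a.norm ≤ C)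
    (hb : b ≤ C) (hC : 1 ≤ C) (A : List α) : labelWeight (collapsedLabels adj s lab a b A) ≤
      2 * C ^ A.length * (A.map fun u => labelWeight (lab u)).prod := by
  have h1 : (collapsedLabels adj s lab a b A).1.norm + (collapsedLabels adj s lab a b A).2.1.norm +
      (collapsedLabels adj s lab a b A).2.2.norm ≤ choiceSum classes A fun P =>
        (P.map fun p => (p.2.pick (lab p.1)).norm).prod * C ^ A.length := by
    simp only [collapsedLabels, IntPair.norm_sum, List.map_map]
    have := fun f g : List (α × PartClass) → ℕ => choiceSum_add classes A f g
    simp only [choiceSum] at this ⊢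
    simp only [Function.comp_def, ← this]
    refine List.sum_le_sum fun P hP => ?_
    rw [← length_of_mem_choices hP]
    exact norm_contribution_le ha hb P
  rw [choiceSum_mul_right, choiceSum_classes_prod] at h1
  have h2 : (A.map fun u => (lab u).1.norm + (lab u).2.1.norm + (lab u).2.2.norm).prod ≤
      (A.map fun u => labelWeight (lab u)).prod := by
    refine List.prod_le_prod' fun u _ => ?_
    rw [labelWeight]
    omega
  have h3 := Nat.mul_le_mul_right (C ^ A.length) h2
  have h4 : 1 ≤ (A.map fun u => labelWeight (lab u)).prod * C ^ A.length :=
    Nat.mul_pos (List.prod_pos fun m hm => by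
      obtain ⟨u, -, rfl⟩ := List.mem_map.1 hm
      rw [labelWeight]
      omega) (Nat.pow_pos hC)
  rw [labelWeight]
  calc 1 + (collapsedLabels adj s lab a b A).1.norm + (collapsedLabels adj s lab a b A).2.1.norm +
      (collapsedLabels adj s lab a b A).2.2.norm
      ≤ 1 + (A.map fun u => labelWeight (lab u)).prod * C ^ A.length := by
        rw [add_assoc, add_assoc, ← add_assoc (IntPair.norm _)]
        exact Nat.add_le_add_left (h1.trans h3) 1
    _ ≤ 2 * C ^ A.length * (A.map fun u => labelWeight (lab u)).prod := by
        rw [mul_assoc, mul_comm (C ^ A.length)]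
        omega

/-- A bound for the numbers in a state of the main loop. -/
def stateWeight (st : ℕ × List Vert) : ℕ := st.1 * (st.2.map fun v => labelWeight v.labels).prod

theorem prod_labelWeight_pos (V : List Vert) : 0 < (V.map fun v => labelWeight v.labels).prod :=
  List.prod_pos fun m hm => by
    obtain ⟨u, -, rfl⟩ := List.mem_map.1 hm
    rw [labelWeight]
    omega

theorem stateWeight_collapseStep_le {y : IntPair × ℕ} {C : ℕ} (ha : y.1.norm ≤ C) (hb : y.2 ≤ C)
    (hC : 2 ≤ C) (st : ℕ × List Vert) :
    stateWeight (collapseStep y st) ≤ C ^ (2 * st.2.length + 1) * stateWeight st := by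
  have h1 := length_bestCollapse_add st.2
  have h2 := ((bestCollapse_perm st.2).map fun v => labelWeight v.labels).prod_eq
  rw [List.map_append, List.prod_append, List.map_map] at h2
  have h3 := labelWeight_collapsedLabels_le (adj := fun u w : Vert × Bool => u.1.adj w.1)
    (s := fun u => u.2) (lab := fun u => u.1.labels) ha hb (by omega) (bestCollapse st.2).1
  rw [stateWeight, stateWeight, collapseStep, Collapse.apply, List.map_cons, List.prod_cons, ← h2]
  simp only [List.map_const', List.prod_replicate]
  have h4 : y.2 ^ (bestCollapse st.2).1.length ≤ C ^ (bestCollapse st.2).1.length :=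
    Nat.pow_le_pow_left hb _
  -- One power of `C` per collapsed vertex comes from the denominator and one from the labels; the
  -- last factor `C` absorbs the two.
  have h5 : 2 * C ^ (2 * (bestCollapse st.2).1.length) ≤ C ^ (2 * st.2.length + 1) := by
    rw [pow_succ, mul_comm]
    exact Nat.mul_le_mul (Nat.pow_le_pow_right (by omega) (by omega)) hC
  calc _ ≤ st.1 * C ^ (bestCollapse st.2).1.length * ((2 * C ^ (bestCollapse st.2).1.length *
        ((bestCollapse st.2).1.map fun u => labelWeight u.1.labels).prod) *
          ((bestCollapse st.2).2.1.map fun v => labelWeight v.labels).prod) :=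
        Nat.mul_le_mul (Nat.mul_le_mul_left _ h4) (Nat.mul_le_mul_right _ h3)
    _ = 2 * C ^ (2 * (bestCollapse st.2).1.length) * (st.1 *
        (((bestCollapse st.2).1.map fun u => labelWeight u.1.labels).prod *
          ((bestCollapse st.2).2.1.map fun v => labelWeight v.labels).prod)) := by ring
    _ ≤ _ := Nat.mul_le_mul_right _ h5

/-- The list has at most `N` vertices, whose numbers and rows have size at most `E`. -/
def ShapeBound (E N : ℕ) (V : List Vert) : Prop :=
  V.length ≤ N ∧ ∀ v ∈ V, esize v.1 ≤ E ∧ esize v.2.1 ≤ E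

theorem ShapeBound.apply_bestCollapse {E N : ℕ} {V : List Vert} (h : ShapeBound E N V)
    (hE : 1 ≤ E) (hN : 1 ≤ N) (y : IntPair × ℕ) : ShapeBound E N ((bestCollapse V).apply y) := by
  have hrep : esize (bestCollapse V).2.2.1 ≤ E ∧ esize (bestCollapse V).2.2.2.1 ≤ E := by
    rcases bestCollapse_cases V with hb | ⟨a, ha, b, -, c, -, hb, -⟩
    · rw [hb]
      exact ⟨hE, hE⟩
    · rw [hb]
      exact h.2 a ha
  refine ⟨?_, fun v hv => ?_⟩
  · have h1 := length_bestCollapse_add V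
    have h2 := h.1
    rw [Collapse.apply, List.length_cons]
    rcases bestCollapse_cases V with hb | ⟨a, ha, b, -, c, -, hb, hv⟩
    · rw [hb, totalCollapse]
      exact hN
    · rw [Collapse.valid_iff, ← hb] at hv
      omega
  · rw [Collapse.apply, List.mem_cons] at hv
    rcases hv with rfl | hv
    · exact hrep
    · exact h.2 v ((bestCollapse_perm V).subset (List.mem_append_right _ hv))

theorem bounds_iterate {y : IntPair × ℕ} {C E N : ℕ} (ha : y.1.norm ≤ C) (hb : y.2 ≤ C)
    (hC : 2 ≤ C) (hE : 1 ≤ E) (hN : 1 ≤ N) {st : ℕ × List Vert} (h : ShapeBound E N st.2)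
    (k : ℕ) : ShapeBound E N ((collapseStep y)^[k] st).2 ∧
      stateWeight ((collapseStep y)^[k] st) ≤ C ^ (k * (2 * N + 1)) * stateWeight st := by
  induction k with
  | zero => simpa using h
  | succ k ih =>
    rw [Function.iterate_succ_apply']
    refine ⟨ih.1.apply_bestCollapse hE hN y, (stateWeight_collapseStep_le ha hb hC _).trans ?_⟩
    have h1 := ih.1.1
    calc _ ≤ C ^ (2 * N + 1) * (C ^ (k * (2 * N + 1)) * stateWeight st) :=
          Nat.mul_le_mul (Nat.pow_le_pow_right (by omega) (by omega)) ih.2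
      _ = _ := by rw [← mul_assoc, ← pow_add]; congr 2; ring

theorem esize_state_le {E N S : ℕ} {st : ℕ × List Vert} (h : ShapeBound E N st.2)
    (hpos : 0 < st.1) (hS : stateWeight st < 2 ^ S) :
    esize st ≤ 2 * S + 2 + N * (2 * E + 12 * S + 6) := by
  have h1 : st.1 < 2 ^ S := (Nat.le_mul_of_pos_right _ (prod_labelWeight_pos _)).trans_lt hS
  have h2 : ∀ v ∈ st.2, esize v ≤ 2 * E + 12 * S + 6 := fun v hv => by
    have h3 : labelWeight v.labels < 2 ^ S := by
      refine lt_of_le_of_lt ?_ hS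
      -- All weights are at least one, so each is at most the product; this is the purpose of the
      -- summand one in `labelWeight`.
      refine (Nat.le_of_dvd (prod_labelWeight_pos st.2) ?_).trans (Nat.le_mul_of_pos_left _ hpos)
      exact List.dvd_prod (List.mem_map_of_mem (f := fun v : Vert => labelWeight v.labels) hv)
    rw [labelWeight] at h3
    have h4 := IntPair.esize_le (z := v.2.2.1) (k := S) (by change v.labels.1.norm < _; omega)
    have h5 := IntPair.esize_le (z := v.2.2.2.1) (k := S) (by change v.labels.2.1.norm < _; omega)
    have h6 := IntPair.esize_le (z := v.2.2.2.2) (k := S) (by change v.labels.2.2.norm < _; omega)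
    have h7 := h.2 v hv
    rw [esize_prod v, esize_prod v.2, esize_prod v.2.2, esize_prod v.2.2.2]
    omega
  have h3 := esize_le_of_forall_mem h2
  have h4 := Nat.mul_le_mul_right (2 * E + 12 * S + 6) h.1
  have h5 := esize_nat_le_of_lt h1
  rw [esize_prod st]
  omega

theorem labelWeight_le (v : Vert) : labelWeight v.labels ≤ 2 ^ esize v := by
  have h1 := IntPair.norm_lt v.2.2.1
  have h2 := IntPair.norm_lt v.2.2.2.1
  have h3 := IntPair.norm_lt v.2.2.2.2
  have h4 := two_pow_add_two_pow_le (one_le_esize v.2.2.1) (one_le_esize v.2.2.2.1)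
  have h5 := two_pow_add_two_pow_le (a := esize v.2.2.1 + esize v.2.2.2.1)
    (by have := one_le_esize v.2.2.1; omega) (one_le_esize v.2.2.2.2)
  have h6 : 2 ^ (esize v.2.2.1 + esize v.2.2.2.1 + esize v.2.2.2.2) ≤ 2 ^ esize v :=
    Nat.pow_le_pow_right two_pos (by
      rw [esize_prod v, esize_prod v.2, esize_prod v.2.2, esize_prod v.2.2.2]; omega)
  simp only [labelWeight, Vert.labels]
  omega

theorem stateWeight_le (st : ℕ × List Vert) : stateWeight st ≤ 2 ^ esize st := by
  have h : (st.2.map fun v => labelWeight v.labels).prod ≤ 2 ^ esize st.2 := by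
    induction st.2 with
    | nil => simp
    | cons v V ih =>
      rw [List.map_cons, List.prod_cons, esize_cons, pow_add]
      exact Nat.mul_le_mul (labelWeight_le v) ih
  rw [stateWeight, esize_prod st, pow_add]
  exact Nat.mul_le_mul (lt_two_pow_esize _).le h

/-- A step multiplies the weight by at most `(2 ^ X) ^ (2 * X + 1)`, there are at most `X` steps,
and the initial weight is at most `2 ^ X`. The exponents add up to a polynomial, one more making the
inequality strict. -/
theorem esize_iterate_le {X : ℕ} {y : IntPair × ℕ} {st : ℕ × List Vert} (hy : esize y ≤ X)
    (hy0 : y.2 ≠ 0) (hst : esize st ≤ X) {k : ℕ} (hk : k ≤ X)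
    (hpos : 0 < ((collapseStep y)^[k] st).1) :
    esize ((collapseStep y)^[k] st) ≤ 2 * (X * (X * (2 * X + 1)) + X + 1) + 2 +
      X * (2 * X + 12 * (X * (X * (2 * X + 1)) + X + 1) + 6) := by
  have h1 := esize_prod st
  have h2 := one_le_esize st.1
  have hshape : ShapeBound X X st.2 := by
    refine ⟨?_, fun v hv => ?_⟩
    · have := length_lt_esize st.2
      omega
    · have h3 := esize_le_of_mem hv
      have h4 := esize_prod v
      have h5 := esize_prod v.2
      omega
  have h3 := IntPair.norm_lt y.1
  have h4 := lt_two_pow_esize y.2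
  have h5 := two_pow_add_two_pow_le (one_le_esize y.1) (one_le_esize y.2)
  obtain ⟨h6, h7⟩ := bounds_iterate (y := y) (C := y.1.norm + y.2 + 1) (by omega) (by omega) (by omega)
    (by omega) (by omega) hshape k
  refine esize_state_le h6 hpos (h7.trans_lt ?_)
  have h8 : y.1.norm + y.2 + 1 ≤ 2 ^ X := by
    refine le_trans ?_ (Nat.pow_le_pow_right two_pos hy)
    rw [esize_prod y]
    omega
  calc (y.1.norm + y.2 + 1) ^ (k * (2 * X + 1)) * stateWeight st
      ≤ (2 ^ X) ^ (X * (2 * X + 1)) * 2 ^ X :=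
        Nat.mul_le_mul ((Nat.pow_le_pow_left h8 _).trans (Nat.pow_le_pow_right (Nat.pow_pos two_pos)
          (Nat.mul_le_mul_right _ hk)))
          ((stateWeight_le st).trans (Nat.pow_le_pow_right two_pos hst))
    _ = 2 ^ (X * (X * (2 * X + 1)) + X) := by rw [← pow_mul, ← pow_add]
    _ < _ := Nat.pow_lt_pow_right one_lt_two (Nat.lt_succ_self _)

end Sizes

/-! ### The initial state -/

section Initial

theorem val_ratNum (q : ℚ) : (ratNum q).val = q * q.den := by
  rw [Rat.mul_den_eq_num, ratNum, IntPair.val]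
  split_ifs with h
  · have h1 : q.num < 0 := Rat.num_neg.2 (by simpa using h)
    have h2 : (q.num.natAbs : ℤ) = -q.num := by omega
    have h3 : ((q.num.natAbs : ℤ) : ℚ) = -q.num := by rw [h2]; push_cast; rfl
    rw [Int.cast_natCast] at h3
    simp only [h3, Nat.cast_zero]
    ring
  · have h1 : 0 ≤ q.num := Rat.num_nonneg.2 (by simpa using h)
    have h2 : (q.num.natAbs : ℤ) = q.num := by omega
    have h3 : ((q.num.natAbs : ℤ) : ℚ) = q.num := by rw [h2]
    rw [Int.cast_natCast] at h3
    simp only [h3, Nat.cast_zero, sub_zero]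

theorem readVerts_eq (l : List (ℚ × ℚ × ℚ × List Bool × Unit)) :
    readVerts l = (List.replicate l.length (),
      (l.mapIdx fun i r => readVert (List.replicate i ()) r).reverse) := by
  induction l using List.reverseRecOn with
  | nil => rfl
  | append_singleton l r ih =>
    rw [readVerts] at ih ⊢
    rw [List.foldl_append, ih]
    simp [List.replicate_succ]

theorem mapIdx_ofFn {α β : Type} {n : ℕ} (f : Fin n → α) (g : ℕ → α → β) :
    (List.ofFn f).mapIdx g = List.ofFn fun i => g i (f i) :=
  List.ext_getElem (by simp) fun i h₁ h₂ => by simp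

open Classical in
/-- The data of a vertex of the instance. -/
noncomputable def EvalInstance.vert (x : EvalInstance) (i : Fin x.n) : Vert :=
  readVert (List.replicate i ()) (x.G.phi i, x.G.chi i, x.G.psi i,
    List.ofFn (fun w : Fin x.n => decide (x.G.graph.Adj i w)), ())

theorem EvalInstance.isVert (x : EvalInstance) (i : Fin x.n) :
    IsVert x.G.graph (x.vert i) i := by
  refine ⟨List.length_replicate, fun j => ?_⟩
  rw [EvalInstance.vert, readVert]
  simp only
  rw [List.headD_eq_head?_getD, List.head?_drop]
  simp

theorem EvalInstance.initialState_snd (x : EvalInstance) :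
    (initialState x.raw.2).2 = (List.ofFn x.vert).reverse := by
  rw [initialState, readVerts_eq, EvalInstance.raw, mapIdx_ofFn]
  rfl

theorem EvalInstance.length_initialState (x : EvalInstance) :
    (initialState x.raw.2).2.length = x.n := by
  rw [x.initialState_snd, List.length_reverse, List.length_ofFn]

theorem EvalInstance.point_ne_zero (x : EvalInstance) : x.point.2 ≠ 0 := x.y.den_nz

theorem EvalInstance.loopInvariant_initialState (x : EvalInstance) :
    LoopInvariant x.G.graph x.point (labeledInterlace x.G x.y) 0 (initialState x.raw.2) := by
  have hd : (initialState x.raw.2).1 =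
      ∏ i, (x.G.phi i).den * ((x.G.chi i).den * (x.G.psi i).den) := by
    rw [initialState, EvalInstance.raw, List.map_ofFn, List.prod_ofFn]
    rfl
  refine ⟨?_, ?_, Or.inr ⟨⟨(List.finRange x.n).reverse, x.vert, ?_, x.isVert, ?_⟩, ?_⟩⟩
  · rw [hd]
    exact Finset.prod_pos fun i _ =>
      Nat.mul_pos (Rat.den_pos _) (Nat.mul_pos (Rat.den_pos _) (Rat.den_pos _))
  · have hy : x.point.1.val / x.point.2 = x.y := by
      change (ratNum x.y).val / (x.y.den : ℚ) = x.y
      rw [val_ratNum, mul_div_cancel_right₀]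
      exact_mod_cast x.y.den_nz
    rw [x.initialState_snd, vertsPoly, hy, listPoly_perm (List.reverse_perm _), hd]
    push_cast
    refine listPoly_ofFn x.G x.y (fun i j => (x.isVert i).adj_iff (x.isVert j)) fun i => ?_
    -- The numerator already accounts for the label's own denominator, and `m` is the product of the
    -- other two; so all three labels of a vertex get the same factor.
    have hm : ∀ (q : ℚ) (m : ℕ), ((ratNum q).times (m, 0)).val = q * q.den * m := fun q m => by
      rw [IntPair.val_times, val_ratNum, IntPair.val]
      simp
    change (((ratNum (x.G.phi i)).times _).val, ((ratNum (x.G.chi i)).times _).val,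
      ((ratNum (x.G.psi i)).times _).val) = _
    rw [hm, hm, hm]
    push_cast
    refine Prod.ext ?_ (Prod.ext ?_ ?_) <;> simp only <;> ring
  · exact List.nodup_reverse.2 (List.nodup_finRange _)
  · rw [x.initialState_snd, List.ofFn_eq_map, List.map_reverse]
  · rw [x.length_initialState]
    rfl

theorem EvalInstance.loopInvariant (x : EvalInstance) (k : ℕ) :
    LoopInvariant x.G.graph x.point (labeledInterlace x.G x.y) k
      ((collapseStep x.point)^[k] (initialState x.raw.2)) :=
  x.loopInvariant_initialState.iterate x.point_ne_zero k

end Initial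

/-! ### The complete algorithm and its parameter -/

section Main

theorem CompIn.finalState_splitWidth :
    CompIn EvalInstance.finalState fun x => 3 ^ (splitWidth x.G.graph + 3) := by
  have hraw : CompIn EvalInstance.raw fun x => 3 ^ (splitWidth x.G.graph + 3) :=
    raw.mono (PolyBd.const 0)
  have hX : PolyBd (fun x => esize x + 3 ^ (splitWidth x.G.graph + 3)) fun x : EvalInstance =>
      esize (_root_.initialState x.raw.2) + esize x.point :=
    (initialState.comp hraw.snd).size_output.add
      (prodMk (ratNum hraw.fst) (den hraw.fst)).size_output
  have hS := ((hX.mul (hX.mul (((PolyBd.const 2).mul hX).add (PolyBd.const 1)))).add hX).add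
    (PolyBd.const 1)
  have hR := ((((PolyBd.const 2).mul hS).add (PolyBd.const 2)).add (hX.mul
    ((((PolyBd.const 2).mul hX).add ((PolyBd.const 12).mul hS)).add (PolyBd.const 6)))).add
    polyBd_self
  refine finalState hR (fun x k hk => ?_) fun x k hk => ?_
  · have h1 := length_lt_esize (_root_.initialState x.raw.2).2
    have h2 := esize_prod (_root_.initialState x.raw.2)
    have h3 := one_le_esize (_root_.initialState x.raw.2).1
    have h4 := one_le_esize x.point
    exact (esize_iterate_le (Nat.le_add_left _ _) x.point_ne_zero (Nat.le_add_right _ _) (by omega)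
      (x.loopInvariant k).1).trans (Nat.le_add_right _ _)
  · exact (Nat.pow_le_pow_right (by omega) (x.loopInvariant k).length_bestCollapse_le).trans
      (Nat.le_add_left _ _)

theorem CompIn.labeledInterlace :
    CompIn (fun x : EvalInstance => labeledInterlace x.G x.y)
      fun x => 3 ^ (splitWidth x.G.graph + 3) := by
  have hinv := fun x : EvalInstance => x.loopInvariant ((_root_.initialState x.raw.2).2.length + 1)
  have hlab : CompIn (fun x : EvalInstance =>
      (x.finalState.2.headD ([], [], (0, 0), (0, 0), (0, 0))).2.2.1) fun x =>
        3 ^ (splitWidth x.G.graph + 3) :=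
    (headD finalState_splitWidth.snd (const _)).snd.snd.fst
  have h := ratOfNats hlab.fst hlab.snd finalState_splitWidth.fst fun x => (hinv x).1
  refine h.of_enc_eq fun x => congrArg enc ?_
  -- Every unfinished step loses a vertex, so `n + 1` steps suffice; the first label of the
  -- remaining vertex over the accumulated denominator is the value.
  exact ((hinv x).eq_div (by rw [x.length_initialState]; omega)).symm

/-- A problem that is solved in time polynomial in the size of the input and a computable function
of the parameter is fixed-parameter tractable. -/
theorem CompIn.fixedParameterTractable {α β : Type} [Enc α] [Enc β] {f : α → β} {param : α → ℕ}
    {g : ℕ → ℕ} (hg : Computable g) (h : CompIn f fun x => g (param x)) :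
    FixedParameterTractable (fun x : α => enc x) param fun x => enc (f x) := by
  obtain ⟨p, T, ⟨c, hc⟩, hp⟩ := h
  have hpow : Primrec₂ ((· ^ ·) : ℕ → ℕ → ℕ) := Primrec₂.unpaired'.1 Nat.Primrec.pow
  have hshift : Primrec fun m : ℕ => (m + 3) ^ c :=
    hpow.comp (Primrec.nat_add.comp Primrec.id (Primrec.const 3)) (Primrec.const c)
  -- As the input has size at least one, `|x| + g + 2 ≤ (g + 3) * |x|`, which separates the
  -- parameter from the input size.
  refine ⟨p, fun k => (g k + 3) ^ c, c, hshift.to_comp.comp hg, fun x => ?_⟩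
  obtain ⟨t, ht, hrun⟩ := hp x
  refine ⟨t, ht.trans ((hc x).trans ?_), hrun⟩
  rw [← mul_pow]
  refine Nat.pow_le_pow_left ?_ c
  have h1 := one_le_esize x
  change esize x + g (param x) + 2 ≤ (g (param x) + 3) * esize x
  nlinarith

end Main

theorem mainTheorem12 :
    FixedParameterTractable (ι := EvalInstance) (fun x => x.input)
      (fun x => splitWidth x.G.graph)
      (fun x => Data.ofRat (labeledInterlace x.G x.y)) := by
  have hg : Primrec fun k : ℕ => 3 ^ (k + 3) :=
    (Primrec₂.unpaired'.1 Nat.Primrec.pow).comp (Primrec.const 3)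
      (Primrec.nat_add.comp Primrec.id (Primrec.const 3))
  exact CompIn.labeledInterlace.fixedParameterTractable (g := fun k => 3 ^ (k + 3)) hg.to_comp
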